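/- **Theorem.** Let $\Sigma$ be a connected 2-dimensional conformal manifold, possibly non-orientable and possibly with boundary, with interior $\Sigma^\circ$. Let $\pi:\widehat\Sigma\to\Sigma$ be its orientation double (pairs of a point and a local orientation, the two orientations being identified at each boundary point), which is a Riemann surface. Let $L\to\widehat\Sigma$ be a holomorphic vector bundle such that $V\mapsto(\Omega^{0,\bullet}_c(V,L),\bar\partial)$ is a precosheaf of DG Lie algebras, and let $\alpha$ be a 2-cocycle on each $\Omega^{0,\bullet}_c(V,L)$. Assume that over every coordinate chart $\xi:W\to\mathbb C$ of $\widehat\Sigma$ a holomorphic trivialisation $L|_W\cong W\times\mathfrak a_\xi$ is given, with $\mathfrak a_\xi$ finite-dimensional, together with an isomorphism $\mathfrak a\to\mathfrak a_\xi$, $\mathsf a\mapsto\mathsf a_\xi$, from a fixed vector space $\mathfrak a$. For $U\subset\Sigma$ open let $$\mathcal L^\Sigma_\alpha(U)=\Omega^{0,\bullet}_c(\pi^{-1}(U),L)\oplus\mathbb C\mathbf 1,$$ with $\mathbf 1$ a cocycle of degree $1$; this is the pointed DG vector space (DG vector space with a distinguished map from $\mathbb C$ to its $1$-cocycles) that underlies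 the central extension of $\Omega^{0,\bullet}_c(\pi^{-1}(U),L)$ by $\alpha$. For $W\subset\mathbb C$ bounded and open let $W^c=\mathbb{CP}^1\setminus W$, and let $\mathcal O_\infty(W^c)$ be the space of germs at $W^c$ of holomorphic functions vanishing at $\infty$. For $\omega\in\Omega^{0,1}_c(W)$ put $\omega^\downarrow(\lambda)=\frac1{2\pi i}\int_W\frac{d\mu\wedge\omega}{\mu-\lambda}$. Choose a basis of $\mathcal O_\infty(W^c)$, for each basis element a representative $f$, holomorphic on an open neighbourhood $\Delta_f$ of $W^c$, and a smooth function $\rho_f$ with compact support in $W$ that equals $1$ on a neighbourhood of $\mathbb{CP}^1\setminus\Delta_f$; let $\lceil\cdot\rceil:\mathcal O_\infty(W^c)\to\Omega^{0,1}_c(W)$ be the linear map with $\lceil f\rceil=-f\,\bar\partial\rho_f$ on basis elements. Let $U\subset\Sigma^\circ$ be open and connected, and let $\pi^{-1}(U)=\bigsqcup_{j=1}^mW_j$, $m\in\{1,2\}$, with $W_j$ open and connected and with holomorphic coordinates $\xi_j:W_j\to\mathbb C$ whose images $\xi_j(W_j)$ are bounded. Put $$\mathcal L_{\mathcal O}=\bigoplus_{j=1}^m\mathfrak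 a\otimes\mathcal O_\infty(\xi_j(W_j)^c)\oplus\mathbb C,$$ and regard $\mathcal L_{\mathcal O}[-1]$, which is concentrated in degree $1$, as pointed by the summand $\mathbb C$. Then, for all choices made in the definition of $\lceil\cdot\rceil$ for the sets $\xi_j(W_j)$, the formulas $$i\big((\mathsf a_j\otimes[f_j])_j\big)=\sum_j(\mathsf a_j)_{\xi_j}\otimes\xi_j^*\lceil f_j\rceil,\qquad i(a)=a\mathbf 1,$$ $$p\Big(\sum_j(\mathsf a_j)_{\xi_j}\otimes\omega_j\Big)=\Big(\mathsf a_j\otimes\big[((\xi_j^{-1})^*\omega_j)^\downarrow\big]\Big)_j,\qquad p(a\mathbf 1)=a,$$ $$h\Big(\sum_j(\mathsf a_j)_{\xi_j}\otimes\omega_j\Big)=\sum_j(\mathsf a_j)_{\xi_j}\otimes\xi_j^*\Big((\xi_j^{-1})^*\omega_j-\big\lceil((\xi_j^{-1})^*\omega_j)^\downarrow\big\rceil\Big)^\downarrow,\qquad h(a\mathbf 1)=0,$$ for $\mathsf a_j\in\mathfrak a$, $\omega_j\in\Omega^{0,1}_c(W_j)$, $[f_j]\in\mathcal O_\infty(\xi_j(W_j)^c)$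 and $a\in\mathbb C$, with $p=h=0$ on elements of degree $0$, define morphisms $i:\mathcal L_{\mathcal O}[-1]\to\mathcal L^\Sigma_\alpha(U)$ and $p:\mathcal L^\Sigma_\alpha(U)\to\mathcal L_{\mathcal O}[-1]$ of pointed DG vector spaces and a linear map $h:\mathcal L^\Sigma_\alpha(U)\to\mathcal L^\Sigma_\alpha(U)$ of degree $-1$ that form a strong deformation retract: $$p\,i=\mathrm{id},\qquad i\,p-\mathrm{id}=-(\bar\partial h+h\bar\partial),\qquad p\,h=0,\quad h\,i=0,\quad h\,h=0.$$ In particular $H^0(\mathcal L^\Sigma_\alpha(U))=0$, and $p$ induces an isomorphism $H^1(\mathcal L^\Sigma_\alpha(U))\cong\mathcal L_{\mathcal O}$. -/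

import Mathlib

open Set Filter Topology Bundle CategoryTheory
open scoped Manifold ContDiff ComplexConjugate TensorProduct

universe u

noncomputable section

namespace CFT

/-! ## Conformal surfaces -/

/-- The closed upper half-plane, the local model of surfaces with boundary. -/
abbrev HalfPlane : Type := {z : ℂ // 0 ≤ z.im}

/-- `f` is holomorphic at `x`: near `x` it is the restriction of a function that is holomorphic on
a neighbourhood of `x` in `ℂ`. -/
def HolAt (f : HalfPlane → ℂ) (x : HalfPlane) : Prop :=
  ∃ F : ℂ → ℂ, AnalyticAt ℂ F x ∧ ∀ᶠ y : HalfPlane in 𝓝 x, f y = F y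

/-- `f` is antiholomorphic at `x`. -/
def AntiHolAt (f : HalfPlane → ℂ) (x : HalfPlane) : Prop :=
  HolAt (fun y => conj (f y)) x

theorem analyticAt_conj_conj {F : ℂ → ℂ} {x : ℂ} (h : AnalyticAt ℂ F (conj x)) :
    AnalyticAt ℂ (fun z => conj (F (conj z))) x := by
  rw [Complex.analyticAt_iff_eventually_differentiableAt] at h ⊢
  have hc : Tendsto (fun z : ℂ => conj z) (𝓝 x) (𝓝 (conj x)) :=
    Complex.continuous_conj.continuousAt
  filter_upwards [hc.eventually h] with z hz
  have := hz.conj_conj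
  simpa [Function.comp_def] using this

theorem HolAt.continuousAt {f : HalfPlane → HalfPlane} {x : HalfPlane}
    (h : HolAt (fun y => (f y : ℂ)) x) : ContinuousAt f x := by
  obtain ⟨F, hF, hfF⟩ := h
  refine (⟨rfl⟩ : IsInducing (Subtype.val : HalfPlane → ℂ)).continuousAt_iff.2 ?_
  have h1 : ContinuousAt (fun y : HalfPlane => F y) x :=
    ContinuousAt.comp (f := fun y : HalfPlane => (y : ℂ)) hF.continuousAt
      continuous_subtype_val.continuousAt
  exact h1.congr (hfF.mono fun y hy => hy.symm)

theorem AntiHolAt.continuousAt {f : HalfPlane → HalfPlane} {x : HalfPlane}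
    (h : AntiHolAt (fun y => (f y : ℂ)) x) : ContinuousAt f x := by
  obtain ⟨F, hF, hfF⟩ := h
  refine (⟨rfl⟩ : IsInducing (Subtype.val : HalfPlane → ℂ)).continuousAt_iff.2 ?_
  have h1 : ContinuousAt (fun y : HalfPlane => conj (F y)) x :=
    Complex.continuous_conj.continuousAt.comp
      (ContinuousAt.comp (f := fun y : HalfPlane => (y : ℂ)) hF.continuousAt
      continuous_subtype_val.continuousAt)
  refine h1.congr (hfF.mono fun y hy => ?_)
  simp only [Function.comp_def]
  rw [← hy, Complex.conj_conj]

theorem HolAt.comp {g : HalfPlane → ℂ} {f : HalfPlane → HalfPlane} {x : HalfPlane}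
    (hg : HolAt g (f x)) (hf : HolAt (fun y => (f y : ℂ)) x) : HolAt (fun y => g (f y)) x := by
  have hc := hf.continuousAt
  obtain ⟨F, hF, hfF⟩ := hf
  obtain ⟨G, hG, hgG⟩ := hg
  refine ⟨fun z => G (F z), ?_, ?_⟩
  · refine AnalyticAt.fun_comp ?_ hF
    rw [← hfF.self_of_nhds]; exact hG
  · filter_upwards [hfF, hc.eventually hgG] with y h1 h2
    rw [h2, h1]

theorem HolAt.comp_anti {g : HalfPlane → ℂ} {f : HalfPlane → HalfPlane} {x : HalfPlane}
    (hg : HolAt g (f x)) (hf : AntiHolAt (fun y => (f y : ℂ)) x) :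
    AntiHolAt (fun y => g (f y)) x := by
  have hc := hf.continuousAt
  obtain ⟨F, hF, hfF⟩ := hf
  obtain ⟨G, hG, hgG⟩ := hg
  refine ⟨fun z => conj (G (conj (F z))), ?_, ?_⟩
  · refine AnalyticAt.fun_comp (g := fun z => conj (G (conj z))) ?_ hF
    apply analyticAt_conj_conj
    have := hfF.self_of_nhds
    rw [← this, Complex.conj_conj]; exact hG
  · filter_upwards [hfF, hc.eventually hgG] with y h1 h2
    rw [h2, ← h1, Complex.conj_conj]

theorem AntiHolAt.comp_anti {g : HalfPlane → ℂ} {f : HalfPlane → HalfPlane} {x : HalfPlane}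
    (hg : AntiHolAt g (f x)) (hf : AntiHolAt (fun y => (f y : ℂ)) x) :
    HolAt (fun y => g (f y)) x := by
  have := HolAt.comp_anti (g := fun y => conj (g y)) hg hf
  simpa [AntiHolAt] using this

/-- Conformal maps between open subsets of the half-plane: maps which near each point are
holomorphic or antiholomorphic, and which map boundary points to boundary points and interior
points to interior points. -/
def conformalPregroupoid : Pregroupoid HalfPlane where
  property f s := ∀ x ∈ s, (HolAt (fun y => (f y : ℂ)) x ∨ AntiHolAt (fun y => (f y : ℂ)) x) ∧
    ((f x : ℂ).im = 0 ↔ (x : ℂ).im = 0)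
  comp := by
    intro f g u v hf hg _ _ _ x hx
    obtain ⟨h1, h1'⟩ := hf x hx.1
    obtain ⟨h2, h2'⟩ := hg (f x) hx.2
    refine ⟨?_, h2'.trans h1'⟩
    rcases h1 with h1 | h1 <;> rcases h2 with h2 | h2
    · exact Or.inl (HolAt.comp (g := fun y => (g y : ℂ)) h2 h1)
    · exact Or.inr (HolAt.comp (g := fun y => conj (g y : ℂ)) h2 h1)
    · exact Or.inr (HolAt.comp_anti (g := fun y => (g y : ℂ)) h2 h1)
    · exact Or.inl (AntiHolAt.comp_anti (g := fun y => (g y : ℂ)) h2 h1)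
  id_mem := fun x _ => ⟨Or.inl ⟨id, analyticAt_id, Eventually.of_forall fun _ => rfl⟩, Iff.rfl⟩
  locality := by
    intro f u _ h x hx
    obtain ⟨v, _, hxv, h'⟩ := h x hx
    exact h' x ⟨hx, hxv⟩
  congr := by
    intro f g u hu hfg hf x hx
    have he : ∀ᶠ y in 𝓝 x, g y = f y := by
      filter_upwards [hu.mem_nhds hx] with y hy
      exact hfg y hy
    obtain ⟨h1, h2⟩ := hf x hx
    rw [hfg x hx]
    refine ⟨?_, h2⟩
    rcases h1 with ⟨F, hF, h⟩ | ⟨F, hF, h⟩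
    · refine Or.inl ⟨F, hF, ?_⟩
      filter_upwards [h, he] with y h1 h2
      rw [h2, h1]
    · refine Or.inr ⟨F, hF, ?_⟩
      filter_upwards [h, he] with y h1 h2
      rw [h2, h1]

/-- The conformal structure groupoid. A two-dimensional conformal manifold, possibly with boundary
and possibly non-orientable, is a space with an atlas of charts in `HalfPlane` whose changes of
charts belong to it. -/
def conformalGroupoid : StructureGroupoid HalfPlane := conformalPregroupoid.groupoid


variable {M : Type u} [TopologicalSpace M] [ChartedSpace HalfPlane M]

/-- The charts `φ` and `ψ` induce the same orientation at `p`: the change of charts is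
holomorphic (and not antiholomorphic) there. -/
def SameOr (φ ψ : OpenPartialHomeomorph M HalfPlane) (p : M) : Prop :=
  HolAt (fun z => (φ (ψ.symm z) : ℂ)) (ψ p)

/-- The charts `φ` and `ψ` induce opposite orientations at `p`. -/
def OppOr (φ ψ : OpenPartialHomeomorph M HalfPlane) (p : M) : Prop :=
  AntiHolAt (fun z => (φ (ψ.symm z) : ℂ)) (ψ p)

/-- `φ` is a chart of the atlas around `p`. -/
def ChartNear (φ : OpenPartialHomeomorph M HalfPlane) (p : M) : Prop :=
  φ ∈ atlas HalfPlane M ∧ p ∈ φ.source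

theorem HolAt.congr {f g : HalfPlane → ℂ} {x : HalfPlane} (h : HolAt f x)
    (he : ∀ᶠ y in 𝓝 x, g y = f y) : HolAt g x := by
  obtain ⟨F, hF, hf⟩ := h
  refine ⟨F, hF, ?_⟩
  filter_upwards [hf, he] with y h1 h2
  rw [h2, h1]

theorem not_antiHolAt_id (x : HalfPlane) : ¬ AntiHolAt (fun y => (y : ℂ)) x := by
  rintro ⟨G, hG, h⟩
  have hd := hG.differentiableAt.hasDerivAt
  -- differentiate along `x + t v` for `v = 1` and `v = I`
  have key : ∀ v : ℂ, 0 ≤ v.im → v * deriv G x = conj v := by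
    intro v hv
    have h1 : HasDerivAt (fun t : ℝ => G (x + t * v)) (v * deriv G x) 0 := by
      have hl : HasDerivAt (fun t : ℝ => (x : ℂ) + t * v) v 0 := by
        have := ((Complex.ofRealCLM.hasDerivAt (x := (0 : ℝ))).mul_const v).const_add (x : ℂ)
        simpa using this
      have hd' : HasDerivAt G (deriv G x) ((x : ℂ) + ((0 : ℝ) : ℂ) * v) := by simpa using hd
      have := hd'.scomp (𝕜 := ℝ) 0 hl
      simpa [Function.comp_def] using this
    have h2 : HasDerivAt (fun t : ℝ => conj (x : ℂ) + t * conj v) (conj v) 0 := by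
      have := ((Complex.ofRealCLM.hasDerivAt (x := (0 : ℝ))).mul_const (conj v)).const_add
        (conj (x : ℂ))
      simpa using this
    have hm : ∀ t : ℝ, 0 ≤ t → 0 ≤ ((x : ℂ) + t * v).im := by
      intro t ht
      have := x.2
      simp only [Complex.add_im, Complex.mul_im, Complex.ofReal_re, Complex.ofReal_im, zero_mul,
        add_zero]
      positivity
    have he : (fun t : ℝ => G (x + t * v)) =ᶠ[𝓝[Ici 0] 0]
        fun t : ℝ => conj (x : ℂ) + t * conj v := by
      have hnb : ∀ᶠ w in 𝓝 (x : ℂ), ∀ hw : 0 ≤ w.im, conj w = G w := by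
        rw [nhds_subtype_eq_comap, eventually_comap] at h
        filter_upwards [h] with w hw hw'
        exact hw ⟨w, hw'⟩ rfl
      have hcont : Tendsto (fun t : ℝ => (x : ℂ) + t * v) (𝓝[Ici 0] 0) (𝓝 (x : ℂ)) := by
        have : Continuous (fun t : ℝ => (x : ℂ) + t * v) := by fun_prop
        have := this.tendsto 0
        simp only [Complex.ofReal_zero, zero_mul, add_zero] at this
        exact this.mono_left nhdsWithin_le_nhds
      filter_upwards [hcont.eventually hnb, self_mem_nhdsWithin] with t ht ht0
      rw [← ht (hm t ht0)]
      simp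
    have hu : UniqueDiffWithinAt ℝ (Ici (0 : ℝ)) 0 := uniqueDiffOn_Ici 0 0 self_mem_Ici
    have h3 := (h2.hasDerivWithinAt (s := Ici 0)).congr_of_eventuallyEq_of_mem he self_mem_Ici
    exact hu.eq_deriv _ h1.hasDerivWithinAt h3
  have k1 := key 1 (by simp)
  have k2 := key Complex.I (by simp)
  simp only [one_mul, map_one] at k1
  rw [k1] at k2
  have := congrArg Complex.im k2
  simp at this
  norm_num at this

theorem transition_eventuallyEq {φ ψ χ : OpenPartialHomeomorph M HalfPlane} {p : M}
    (hψ : p ∈ ψ.source) (hχ : p ∈ χ.source) :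
    ∀ᶠ z in 𝓝 (χ p), φ (χ.symm z) = φ (ψ.symm (ψ (χ.symm z))) := by
  have h1 : ∀ᶠ z in 𝓝 (χ p), χ.symm z ∈ ψ.source := by
    have hc := χ.symm.continuousAt (x := χ p) (by simpa using χ.map_source hχ)
    have hm : ψ.source ∈ 𝓝 (χ.symm (χ p)) := by
      rw [χ.left_inv hχ]; exact ψ.open_source.mem_nhds hψ
    exact hc.eventually_mem hm
  filter_upwards [h1] with z hz
  rw [ψ.left_inv hz]

theorem orient_comp {φ ψ χ : OpenPartialHomeomorph M HalfPlane} {p : M}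
    (hψ : p ∈ ψ.source) (hχ : p ∈ χ.source) :
    (SameOr φ ψ p → SameOr ψ χ p → SameOr φ χ p) ∧
    (SameOr φ ψ p → OppOr ψ χ p → OppOr φ χ p) ∧
    (OppOr φ ψ p → SameOr ψ χ p → OppOr φ χ p) ∧
    (OppOr φ ψ p → OppOr ψ χ p → SameOr φ χ p) := by
  have hp : ψ (χ.symm (χ p)) = ψ p := by rw [χ.left_inv hχ]
  have he := transition_eventuallyEq (φ := φ) hψ hχ
  have he1 := he.mono fun z hz => congrArg (fun w : HalfPlane => (w : ℂ)) hz
  have he2 := he.mono fun z hz => congrArg (fun w : HalfPlane => conj (w : ℂ)) hz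
  unfold SameOr OppOr
  rw [← hp]
  refine ⟨fun h1 h2 => ?_, fun h1 h2 => ?_, fun h1 h2 => ?_, fun h1 h2 => ?_⟩
  · exact (HolAt.comp (f := fun z => ψ (χ.symm z)) h1 h2).congr he1
  · exact HolAt.congr (HolAt.comp_anti (f := fun z => ψ (χ.symm z)) h1 h2) he2
  · exact HolAt.congr (HolAt.comp (f := fun z => ψ (χ.symm z)) h1 h2) he2
  · exact (AntiHolAt.comp_anti (f := fun z => ψ (χ.symm z)) h1 h2).congr he1

theorem transition_mem [HasGroupoid M conformalGroupoid]
    {φ ψ : OpenPartialHomeomorph M HalfPlane} {p : M}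
    (hφ : ChartNear φ p) (hψ : ChartNear ψ p) :
    (SameOr φ ψ p ∨ OppOr φ ψ p) ∧ ((φ p : ℂ).im = 0 ↔ (ψ p : ℂ).im = 0) := by
  have h := HasGroupoid.compatible (G := conformalGroupoid) hψ.1 hφ.1
  have h' := (mem_groupoid_of_pregroupoid.1 h).1 (ψ p) (by
    simp [hψ.2, hφ.2, ψ.left_inv hψ.2])
  simpa [ψ.left_inv hψ.2, conformalPregroupoid, SameOr, OppOr] using h'

theorem not_oppOr_self {φ : OpenPartialHomeomorph M HalfPlane} {p : M} (hφ : p ∈ φ.source) :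
    ¬ OppOr φ φ p := by
  intro h
  refine not_antiHolAt_id (φ p) (HolAt.congr h ?_)
  filter_upwards [φ.open_target.mem_nhds (φ.map_source hφ)] with z hz
  rw [φ.right_inv hz]

theorem oppOr_iff [HasGroupoid M conformalGroupoid]
    {φ ψ : OpenPartialHomeomorph M HalfPlane} {p : M}
    (hφ : ChartNear φ p) (hψ : ChartNear ψ p) : OppOr φ ψ p ↔ ¬ SameOr φ ψ p := by
  constructor
  · intro h1 h2
    rcases (transition_mem hψ hφ).1 with h | h
    · exact not_oppOr_self hψ.2 ((orient_comp hφ.2 hψ.2).2.1 h h1)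
    · exact not_oppOr_self hψ.2 ((orient_comp hφ.2 hψ.2).2.2.1 h h2)
  · intro h
    exact (transition_mem hφ hψ).1.resolve_left h

theorem sameOr_comp_iff [HasGroupoid M conformalGroupoid]
    {φ ψ χ : OpenPartialHomeomorph M HalfPlane} {p : M}
    (hφ : ChartNear φ p) (hψ : ChartNear ψ p) (hχ : ChartNear χ p) :
    (SameOr φ χ p ↔ SameOr ψ χ p) ↔ SameOr φ ψ p := by
  obtain ⟨h1, h2, h3, h4⟩ := orient_comp (φ := φ) hψ.2 hχ.2
  rw [oppOr_iff hψ hχ, oppOr_iff hφ hχ, oppOr_iff hφ hψ] at *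
  tauto

/-! ## The orientation double -/

/-- An orientation of the surface at `p`, given as the set of those charts around `p` that are
positively oriented at `p`. -/
@[ext]
structure PointOrientation (p : M) where
  /-- the positively oriented charts -/
  pos : Set (OpenPartialHomeomorph M HalfPlane)
  near : ∀ φ ∈ pos, ChartNear φ p
  compat : ∀ φ ψ, ChartNear φ p → ChartNear ψ p → ((φ ∈ pos ↔ ψ ∈ pos) ↔ SameOr φ ψ p)

variable (M) in
/-- The orientation bundle, as a set. -/
abbrev OrientationBundle : Type u := Σ p : M, PointOrientation p

variable (M) in
/-- The boundary of the surface. -/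
def boundary : Set M := {p | ((chartAt HalfPlane p p : HalfPlane) : ℂ).im = 0}

variable (M) in
/-- The interior of the surface. -/
def surfaceInterior : Set M := (boundary M)ᶜ

variable (M) in
/-- The relation that identifies the two orientations at each boundary point. -/
def doubleSetoid : Setoid (OrientationBundle M) where
  r a b := a = b ∨ (a.1 = b.1 ∧ a.1 ∈ boundary M)
  iseqv := by
    refine ⟨fun _ => Or.inl rfl, ?_, ?_⟩
    · rintro a b (h | ⟨h, h'⟩)
      · exact Or.inl h.symm
      · exact Or.inr ⟨h.symm, h ▸ h'⟩
    · rintro a b c (rfl | ⟨h, h'⟩) (rfl | ⟨k, k'⟩)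
      · exact Or.inl rfl
      · exact Or.inr ⟨k, k'⟩
      · exact Or.inr ⟨h, h'⟩
      · exact Or.inr ⟨h.trans k, h'⟩

variable (M) in
/-- The orientation double of the surface. -/
def Double : Type u := Quotient (doubleSetoid M)

/-- The projection of the double onto the surface. -/
def Double.proj : Double M → M :=
  Quotient.lift (fun a : OrientationBundle M => a.1) (by
    rintro a b (rfl | ⟨h, _⟩)
    · rfl
    · exact h)

theorem im_eq_zero_of_boundary [HasGroupoid M conformalGroupoid]
    {φ : OpenPartialHomeomorph M HalfPlane} {p : M} (hφ : ChartNear φ p) (hp : p ∈ boundary M) :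
    (φ p : ℂ).im = 0 :=
  (transition_mem hφ ⟨chart_mem_atlas HalfPlane p, mem_chart_source HalfPlane p⟩).2.2 hp

open Classical in
/-- The orientation at `p` for which the chart `φ` is positively oriented if and only if `s`
holds (for `φ` not a chart around `p`, a junk value). -/
def orientBy [HasGroupoid M conformalGroupoid] (φ : OpenPartialHomeomorph M HalfPlane) (p : M)
    (s : Prop) : PointOrientation p where
  pos := {ψ | ChartNear ψ p ∧
    (SameOr ψ (if ChartNear φ p then φ else chartAt HalfPlane p) p ↔ s)}
  near := fun ψ h => h.1
  compat := by
    intro ψ χ hψ hχ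
    have hb : ChartNear (if ChartNear φ p then φ else chartAt HalfPlane p) p := by
      split_ifs with h
      · exact h
      · exact ⟨chart_mem_atlas HalfPlane p, mem_chart_source HalfPlane p⟩
    have := sameOr_comp_iff hψ hχ hb
    simp only [mem_ofPred_eq, hψ, hχ, true_and]
    tauto

theorem mem_orientBy [HasGroupoid M conformalGroupoid] {φ ψ : OpenPartialHomeomorph M HalfPlane}
    {p : M} (hφ : ChartNear φ p) (hψ : ChartNear ψ p) (s : Prop) :
    ψ ∈ (orientBy φ p s).pos ↔ (SameOr ψ φ p ↔ s) := by
  simp [orientBy, hφ, hψ]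

theorem sameOr_self {φ : OpenPartialHomeomorph M HalfPlane} {p : M} (hφ : p ∈ φ.source) :
    SameOr φ φ p := by
  refine HolAt.congr (f := fun z => (z : ℂ))
    ⟨id, analyticAt_id, Eventually.of_forall fun _ => rfl⟩ ?_
  filter_upwards [φ.open_target.mem_nhds (φ.map_source hφ)] with z hz
  rw [φ.right_inv hz]

/-- Folding the complex plane onto the closed upper half-plane. -/
def fold (z : ℂ) : HalfPlane := ⟨⟨z.re, |z.im|⟩, abs_nonneg _⟩

theorem continuous_fold : Continuous fold := by
  refine Continuous.subtype_mk ?_ _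
  have h : (fun z : ℂ => (⟨z.re, |z.im|⟩ : ℂ)) = fun z => (z.re : ℂ) + (|z.im| : ℝ) * Complex.I := by
    funext z
    apply Complex.ext <;> simp
  rw [h]
  fun_prop

theorem fold_of_nonneg {z : ℂ} (h : 0 ≤ z.im) : (fold z : ℂ) = z := by
  apply Complex.ext <;> simp [fold, abs_of_nonneg h]

theorem fold_of_nonpos {z : ℂ} (h : z.im ≤ 0) : (fold z : ℂ) = conj z := by
  apply Complex.ext <;> simp [fold, abs_of_nonpos h]

open Classical in
/-- The chart of the double defined by a chart `φ` of the surface: a point `p` with an orientation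
is sent to `φ p` if `φ` is positively oriented, and to the complex conjugate of `φ p`
otherwise. -/
def doubleChart [HasGroupoid M conformalGroupoid] (φ : OpenPartialHomeomorph M HalfPlane)
    (hφ : φ ∈ atlas HalfPlane M) : PartialEquiv (Double M) ℂ where
  toFun := Quotient.lift
    (fun a : OrientationBundle M => if φ ∈ a.2.pos then (φ a.1 : ℂ) else conj (φ a.1 : ℂ)) (by
      rintro ⟨p, o⟩ ⟨q, o'⟩ (h | ⟨h, h'⟩)
      · rw [h]
      · obtain rfl : p = q := h
        by_cases hp : p ∈ φ.source
        · have him := im_eq_zero_of_boundary ⟨hφ, hp⟩ h'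
          have : conj (φ p : ℂ) = φ p := Complex.conj_eq_iff_im.2 him
          simp [this]
        · have h1 : φ ∉ o.pos := fun h => hp (o.near φ h).2
          have h2 : φ ∉ o'.pos := fun h => hp (o'.near φ h).2
          simp [h1, h2])
  invFun z := Quotient.mk (doubleSetoid M)
    ⟨φ.symm (fold z), orientBy φ (φ.symm (fold z)) (0 ≤ z.im)⟩
  source := Double.proj ⁻¹' φ.source
  target := fold ⁻¹' φ.target
  map_source' := by
    intro a
    induction a using Quotient.inductionOn with
    | h a =>
      intro ha
      change a.1 ∈ φ.source at ha
      have hφa := φ.map_source ha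
      change fold (if φ ∈ a.2.pos then (φ a.1 : ℂ) else conj (φ a.1 : ℂ)) ∈ φ.target
      have : fold (if φ ∈ a.2.pos then (φ a.1 : ℂ) else conj (φ a.1 : ℂ)) = φ a.1 := by
        apply Subtype.ext
        split_ifs
        · exact fold_of_nonneg (φ a.1).2
        · rw [fold_of_nonpos (by simpa using (φ a.1).2), Complex.conj_conj]
      rw [this]; exact hφa
  map_target' := fun z hz => φ.map_target hz
  left_inv' := by
    intro a
    induction a using Quotient.inductionOn with
    | h a =>
      obtain ⟨p, o⟩ := a
      intro ha
      change p ∈ φ.source at ha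
      have hn : ChartNear φ p := ⟨hφ, ha⟩
      change Quotient.mk (doubleSetoid M) ⟨φ.symm (fold (if φ ∈ o.pos then (φ p : ℂ)
        else conj (φ p : ℂ))), orientBy φ (φ.symm (fold (if φ ∈ o.pos then (φ p : ℂ)
        else conj (φ p : ℂ)))) (0 ≤ (if φ ∈ o.pos then (φ p : ℂ) else conj (φ p : ℂ)).im)⟩ = _
      have hf : fold (if φ ∈ o.pos then (φ p : ℂ) else conj (φ p : ℂ)) = φ p := by
        apply Subtype.ext
        split_ifs
        · exact fold_of_nonneg (φ p).2
        · rw [fold_of_nonpos (by simpa using (φ p).2), Complex.conj_conj]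
      rw [hf, φ.left_inv ha]
      apply Quotient.sound
      by_cases hb : p ∈ boundary M
      · exact Or.inr ⟨rfl, hb⟩
      · refine Or.inl ?_
        congr 1
        have him : (φ p : ℂ).im ≠ 0 := fun h => hb
          ((transition_mem hn ⟨chart_mem_atlas HalfPlane p, mem_chart_source HalfPlane p⟩).2.1 h)
        have hpos : 0 < (φ p : ℂ).im := lt_of_le_of_ne (φ p).2 (Ne.symm him)
        have hs : (0 ≤ (if φ ∈ o.pos then (φ p : ℂ) else conj (φ p : ℂ)).im) ↔ φ ∈ o.pos := by
          split_ifs with h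
          · simp [h, hpos.le]
          · simp [h, hpos]
        ext ψ
        by_cases hψ : ChartNear ψ p
        · rw [mem_orientBy hn hψ, hs, ← o.compat ψ φ hψ hn]
          tauto
        · exact ⟨fun h => absurd ((orientBy _ _ _).near ψ h) hψ, fun h => absurd (o.near ψ h) hψ⟩
  right_inv' := by
    intro z hz
    have hs : φ.symm (fold z) ∈ φ.source := φ.map_target hz
    change (if φ ∈ (orientBy φ (φ.symm (fold z)) (0 ≤ z.im)).pos then
      (φ (φ.symm (fold z)) : ℂ) else conj (φ (φ.symm (fold z)) : ℂ)) = z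
    rw [φ.right_inv hz]
    have := mem_orientBy (φ := φ) (ψ := φ) ⟨hφ, hs⟩ ⟨hφ, hs⟩ (0 ≤ z.im)
    simp only [this, sameOr_self hs, true_iff]
    split_ifs with h
    · exact fold_of_nonneg h
    · rw [fold_of_nonpos (not_le.1 h).le, Complex.conj_conj]

/-- Extension of `F` from the upper half-plane by reflection. -/
def reflect (F : ℂ → ℂ) (z : ℂ) : ℂ := if 0 ≤ z.im then F z else conj (F (conj z))

theorem analyticAt_reflect {F : ℂ → ℂ} {z₀ : ℂ} (hF : AnalyticAt ℂ F (fold z₀))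
    (hreal : ∀ᶠ y : HalfPlane in 𝓝 (fold z₀), (y : ℂ).im = 0 → (F y).im = 0) :
    AnalyticAt ℂ (reflect F) z₀ := by
  rcases lt_trichotomy z₀.im 0 with h | h | h
  · rw [fold_of_nonpos h.le] at hF
    refine (analyticAt_conj_conj hF).congr ?_
    filter_upwards [(isOpen_lt Complex.continuous_im continuous_const).mem_nhds h] with z hz
    have hz : z.im < 0 := hz
    simp [reflect, not_le.2 hz]
  · rw [fold_of_nonneg h.ge] at hF
    have hG : AnalyticAt ℂ (fun z => conj (F (conj z))) z₀ := by
      apply analyticAt_conj_conj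
      rwa [Complex.conj_eq_iff_im.2 h]
    have hFG : ∀ᶠ z in 𝓝 z₀, F z = conj (F (conj z)) := by
      refine (hF.frequently_eq_iff_eventually_eq hG).1 ?_
      have hnb : ∀ᶠ w in 𝓝 z₀, w.im = 0 → (F w).im = 0 := by
        rw [nhds_subtype_eq_comap, eventually_comap, fold_of_nonneg h.ge] at hreal
        filter_upwards [hreal] with w hw hw'
        exact hw ⟨w, hw'.ge⟩ rfl hw'
      have hcont : Tendsto (fun t : ℝ => z₀ + (t : ℂ)) (𝓝[≠] 0) (𝓝[≠] z₀) := by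
        refine tendsto_nhdsWithin_of_tendsto_nhds_of_eventually_within _ ?_ ?_
        · have hc : Continuous (fun t : ℝ => z₀ + (t : ℂ)) := by fun_prop
          have := hc.tendsto 0
          simp only [Complex.ofReal_zero, add_zero] at this
          exact this.mono_left nhdsWithin_le_nhds
        · filter_upwards [self_mem_nhdsWithin] with t ht
          simpa using ht
      refine hcont.frequently (Eventually.frequently ?_)
      filter_upwards [(hcont.mono_right nhdsWithin_le_nhds).eventually hnb] with t ht
      have him : (z₀ + (t : ℂ)).im = 0 := by simp [h]
      rw [Complex.conj_eq_iff_im.2 him, Complex.conj_eq_iff_im.2 (ht him)]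
    refine hF.congr ?_
    filter_upwards [hFG] with z hz
    unfold reflect
    split_ifs
    · rfl
    · exact hz
  · rw [fold_of_nonneg h.le] at hF
    refine hF.congr ?_
    filter_upwards [(isOpen_lt continuous_const Complex.continuous_im).mem_nhds h] with z hz
    have hz : 0 < z.im := hz
    simp [reflect, hz.le]

theorem doubleChart_transition_source [HasGroupoid M conformalGroupoid]
    {φ ψ : OpenPartialHomeomorph M HalfPlane}
    (hφ : φ ∈ atlas HalfPlane M) (hψ : ψ ∈ atlas HalfPlane M) :
    ((doubleChart ψ hψ).symm.trans (doubleChart φ hφ)).source = fold ⁻¹' (ψ.symm.trans φ).source :=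
  rfl

theorem HolAt.eventually {f : HalfPlane → ℂ} {x : HalfPlane} (h : HolAt f x) :
    ∀ᶠ y in 𝓝 x, HolAt f y := by
  obtain ⟨F, hF, hf⟩ := h
  have h1 : ∀ᶠ y : HalfPlane in 𝓝 x, AnalyticAt ℂ F y :=
    continuous_subtype_val.continuousAt.eventually hF.eventually_analyticAt
  filter_upwards [h1, hf.eventually_nhds] with y h2 h3
  exact ⟨F, h2, h3⟩

theorem doubleChart_transition_analyticAt [HasGroupoid M conformalGroupoid]
    {φ ψ : OpenPartialHomeomorph M HalfPlane}
    (hφ : φ ∈ atlas HalfPlane M) (hψ : ψ ∈ atlas HalfPlane M) {z₀ : ℂ}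
    (hz₀ : z₀ ∈ ((doubleChart ψ hψ).symm.trans (doubleChart φ hφ)).source) :
    AnalyticAt ℂ ((doubleChart ψ hψ).symm.trans (doubleChart φ hφ)) z₀ := by
  classical
  rw [doubleChart_transition_source] at hz₀
  have hopen : ∀ᶠ x in 𝓝 (fold z₀), x ∈ (ψ.symm.trans φ).source :=
    (ψ.symm.trans φ).open_source.mem_nhds hz₀
  -- properties of a point `x` near `fold z₀`
  have hx : ∀ x ∈ (ψ.symm.trans φ).source, ChartNear φ (ψ.symm x) ∧ ChartNear ψ (ψ.symm x) ∧
      ψ (ψ.symm x) = x := by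
    intro x hx
    simp only [OpenPartialHomeomorph.trans_source, OpenPartialHomeomorph.symm_source,
      mem_inter_iff, mem_preimage] at hx
    exact ⟨⟨hφ, hx.2⟩, ⟨hψ, ψ.map_target hx.1⟩, ψ.right_inv hx.1⟩
  -- the value of the transition map
  have hval : ∀ z, ((doubleChart ψ hψ).symm.trans (doubleChart φ hφ)) z =
      if φ ∈ (orientBy ψ (ψ.symm (fold z)) (0 ≤ z.im)).pos then (φ (ψ.symm (fold z)) : ℂ)
      else conj (φ (ψ.symm (fold z)) : ℂ) := fun z => rfl
  have hval' : ∀ z, fold z ∈ (ψ.symm.trans φ).source →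
      ((doubleChart ψ hψ).symm.trans (doubleChart φ hφ)) z =
      if (HolAt (fun y => (φ (ψ.symm y) : ℂ)) (fold z) ↔ 0 ≤ z.im) then
        (φ (ψ.symm (fold z)) : ℂ) else conj (φ (ψ.symm (fold z)) : ℂ) := by
    intro z hz
    obtain ⟨h1, h2, h3⟩ := hx _ hz
    rw [hval]
    have := mem_orientBy h2 h1 (0 ≤ z.im)
    unfold SameOr at this
    rw [h3] at this
    simp only [this]
  have hreal : ∀ x ∈ (ψ.symm.trans φ).source, (x : ℂ).im = 0 → (φ (ψ.symm x) : ℂ).im = 0 := by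
    intro x hxs h
    obtain ⟨h1, h2, h3⟩ := hx _ hxs
    exact (transition_mem h1 h2).2.2 (by rw [h3]; exact h)
  have hfold : ∀ {P : HalfPlane → Prop}, (∀ᶠ x in 𝓝 (fold z₀), P x) → ∀ᶠ z in 𝓝 z₀, P (fold z) :=
    fun h => continuous_fold.continuousAt.eventually h
  obtain ⟨h1, h2, h3⟩ := hx _ hz₀
  have hcase := (transition_mem h1 h2).1
  unfold SameOr OppOr at hcase
  rw [h3] at hcase
  rcases hcase with hc | hc
  · obtain ⟨F, hF, hfF⟩ := hc
    have hc : HolAt (fun y => (φ (ψ.symm y) : ℂ)) (fold z₀) := ⟨F, hF, hfF⟩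
    refine (analyticAt_reflect (F := F) hF ?_).congr ?_
    · filter_upwards [hfF, hopen] with y hy hy' h0
      rw [← hy]; exact hreal y hy' h0
    · filter_upwards [hfold hfF, hfold hopen, hfold hc.eventually] with z k1 k2 k3
      rw [hval' z k2]
      simp only [k3, true_iff, k1, reflect]
      split_ifs with hz
      · rw [fold_of_nonneg hz]
      · rw [fold_of_nonpos (not_le.1 hz).le]
  · obtain ⟨F, hF, hfF⟩ := hc
    have hc : AntiHolAt (fun y => (φ (ψ.symm y) : ℂ)) (fold z₀) := ⟨F, hF, hfF⟩
    refine (analyticAt_reflect (F := F) hF ?_).congr ?_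
    · filter_upwards [hfF, hopen] with y hy hy' h0
      rw [← hy, Complex.conj_im, hreal y hy' h0, neg_zero]
    · filter_upwards [hfold hfF, hfold hopen, hfold (HolAt.eventually hc)] with z k1 k2 k3
      obtain ⟨m1, m2, m3⟩ := hx _ k2
      have hno : ¬ HolAt (fun y => (φ (ψ.symm y) : ℂ)) (fold z) := by
        have := (oppOr_iff m1 m2)
        unfold SameOr OppOr at this
        rw [m3] at this
        exact this.1 k3
      rw [hval' z k2]
      simp only [hno, false_iff, k1, reflect]
      by_cases hz : 0 ≤ z.im
      · simp only [hz, not_true_eq_false, if_false, if_true]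
        rw [fold_of_nonneg hz]
      · simp only [hz, not_false_eq_true, if_false, if_true]
        rw [← fold_of_nonpos (not_le.1 hz).le, ← k1, Complex.conj_conj]

variable (M) in
/-- The atlas of the double: the topology and the complex structure are those for which all
`doubleChart`s are charts. -/
def doubleCore [HasGroupoid M conformalGroupoid] : ChartedSpaceCore ℂ (Double M) where
  atlas := {e | ∃ φ, ∃ hφ : φ ∈ atlas HalfPlane M, e = doubleChart φ hφ}
  chartAt x := doubleChart (chartAt HalfPlane x.proj) (chart_mem_atlas _ _)
  mem_chart_source x := mem_chart_source HalfPlane x.proj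
  chart_mem_atlas x := ⟨_, _, rfl⟩
  open_source := by
    rintro _ _ ⟨ψ, hψ, rfl⟩ ⟨φ, hφ, rfl⟩
    exact (ψ.symm.trans φ).open_source.preimage continuous_fold
  continuousOn_toFun := by
    rintro _ _ ⟨ψ, hψ, rfl⟩ ⟨φ, hφ, rfl⟩ z hz
    exact (doubleChart_transition_analyticAt hφ hψ hz).continuousAt.continuousWithinAt

instance [HasGroupoid M conformalGroupoid] : TopologicalSpace (Double M) :=
  (doubleCore M).toTopologicalSpace

instance [HasGroupoid M conformalGroupoid] : ChartedSpace ℂ (Double M) :=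
  (doubleCore M).toChartedSpace

instance [HasGroupoid M conformalGroupoid] : IsManifold 𝓘(ℂ, ℂ) ω (Double M) := by
  refine isManifold_of_contDiffOn _ _ _ ?_
  intro e e' he he'
  change e ∈ ⋃ (e : PartialEquiv (Double M) ℂ) (he : e ∈ (doubleCore M).atlas), _ at he
  change e' ∈ ⋃ (e : PartialEquiv (Double M) ℂ) (he : e ∈ (doubleCore M).atlas), _ at he'
  simp only [mem_iUnion, mem_singleton_iff] at he he'
  obtain ⟨_, ⟨ψ, hψ, rfl⟩, rfl⟩ := he
  obtain ⟨_, ⟨φ, hφ, rfl⟩, rfl⟩ := he'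
  intro z hz
  exact (doubleChart_transition_analyticAt hφ hψ hz.1).contDiffAt.contDiffWithinAt

/-! ## The Dolbeault complex with values in a holomorphic vector bundle

Here `X` is a Riemann surface and `L` a holomorphic vector bundle over `X` with model fibre `F`. -/

section Dolbeault

variable {F : Type u} [NormedAddCommGroup F] [NormedSpace ℂ F]

/-- The antilinear part `v ↦ (D v + i D (i v)) / 2` of a real-linear map on `ℂ`. -/
def antilinearPart (D : ℂ →L[ℝ] F) : ℂ →ₛₗ[starRingEnd ℂ] F where
  toFun v := (1 / 2 : ℂ) • (D v + Complex.I • D (Complex.I * v))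
  map_add' v w := by
    simp only [mul_add, map_add, smul_add]
    abel
  map_smul' c v := by
    have h1 : c * v = c.re • v + c.im • (Complex.I * v) := by
      simp only [Complex.real_smul]
      conv_lhs => rw [← Complex.re_add_im c]
      ring
    have h2 : Complex.I * (c * v) = c.re • (Complex.I * v) + (-c.im) • v := by
      simp only [Complex.real_smul]
      conv_lhs => rw [← Complex.re_add_im c]
      push_cast
      linear_combination (c.im * v : ℂ) * Complex.I_mul_I
    have h3 : (starRingEnd ℂ) c = (c.re : ℂ) - c.im * Complex.I := by
      apply Complex.ext <;> simp
    simp only [smul_eq_mul, h2, h3]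
    rw [h1]
    simp only [map_add, map_smul]
    have hr : ∀ (r : ℝ) (y : F), r • y = (r : ℂ) • y := fun r y => (Complex.coe_smul r y).symm
    simp only [hr, smul_add, smul_smul, Complex.ofReal_neg]
    match_scalars
    · ring
    · ring_nf
      simp only [Complex.I_sq]
      ring

theorem antilinearPart_eq (D : ℂ →L[ℝ] F) (v : ℂ) :
    antilinearPart D v = conj v • antilinearPart D 1 := by
  have := (antilinearPart D).map_smulₛₗ v 1
  simpa using this

theorem antilinearPart_comp {G : ℂ → F} {τ : ℂ → ℂ} {z : ℂ} (hτ : DifferentiableAt ℂ τ z)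
    (hG : DifferentiableAt ℝ G (τ z)) (v : ℂ) :
    antilinearPart (fderiv ℝ (fun y => G (τ y)) z) v =
      conj (fderiv ℂ τ z v) • antilinearPart (fderiv ℝ G (τ z)) 1 := by
  have h1 : HasFDerivAt τ ((fderiv ℂ τ z).restrictScalars ℝ) z :=
    hτ.hasFDerivAt.restrictScalars ℝ
  have h2 := (hG.hasFDerivAt.comp z h1).fderiv
  have h3 : fderiv ℝ (fun y => G (τ y)) z =
      (fderiv ℝ G (τ z)).comp ((fderiv ℂ τ z).restrictScalars ℝ) := h2
  rw [← antilinearPart_eq, h3]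
  have hl : fderiv ℂ τ z (Complex.I * v) = Complex.I * fderiv ℂ τ z v := by
    simpa using (fderiv ℂ τ z).map_smul Complex.I v
  simp only [antilinearPart, LinearMap.coe_mk, AddHom.coe_mk, ContinuousLinearMap.comp_apply,
    ContinuousLinearMap.coe_restrictScalars', hl]

theorem antilinearPart_smul {T : ℂ → F →L[ℂ] F} {g : ℂ → F} {z : ℂ} (hT : DifferentiableAt ℂ T z)
    (hg : DifferentiableAt ℝ g z) (v : ℂ) :
    antilinearPart (fderiv ℝ (fun y => T y (g y)) z) v =
      T z (antilinearPart (fderiv ℝ g z) v) := by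
  have h1 : HasFDerivAt T ((fderiv ℂ T z).restrictScalars ℝ) z :=
    hT.hasFDerivAt.restrictScalars ℝ
  have h0 : HasFDerivAt (fun p : (F →L[ℂ] F) × F => p.1 p.2) _ (T z, g z) :=
    ((isBoundedBilinearMap_apply (𝕜 := ℂ) (E := F) (F := F)).hasFDerivAt
      (T z, g z)).restrictScalars ℝ
  have h2 := (h0.comp z (h1.prodMk hg.hasFDerivAt)).fderiv
  have h3 : fderiv ℝ (fun y => T y (g y)) z = _ := h2
  have hl : fderiv ℂ T z (Complex.I * v) = Complex.I • fderiv ℂ T z v := by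
    simpa using (fderiv ℂ T z).map_smul Complex.I v
  have h4 : ∀ w, fderiv ℝ (fun y => T y (g y)) z w =
      T z (fderiv ℝ g z w) + (fderiv ℂ T z w) (g z) := by
    intro w
    rw [h3]
    rfl
  simp only [antilinearPart, LinearMap.coe_mk, AddHom.coe_mk, h4, hl, map_smul, map_add,
    _root_.smul_apply, smul_add, smul_smul]
  match_scalars
  · ring
  · ring_nf
    simp only [Complex.I_sq]
    ring
  · ring

variable {X : Type u} [TopologicalSpace X] [ChartedSpace ℂ X]

/-- The complex derivative at `x` of a complex-valued function. -/
def coordDeriv (φ : X → ℂ) (x : X) : ℂ →L[ℂ] ℂ := mfderiv 𝓘(ℂ, ℂ) 𝓘(ℂ, ℂ) φ x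

/-- The real derivative at `x` of a vector-valued function. -/
def realDeriv (g : X → F) (x : X) : ℂ →L[ℝ] F := mfderiv 𝓘(ℝ, ℂ) 𝓘(ℝ, F) g x

/-- The (topological) support of the section `s` is compact and contained in `V`. -/
def CompactSuppIn {E : X → Type u} [∀ x, Zero (E x)] (V : Set X) (s : ∀ x, E x) : Prop :=
  IsCompact (closure {x | s x ≠ 0}) ∧ closure {x | s x ≠ 0} ⊆ V

theorem CompactSuppIn.mono_supp {E E' : X → Type u} [∀ x, Zero (E x)] [∀ x, Zero (E' x)]
    {V : Set X} {s : ∀ x, E x} {t : ∀ x, E' x} (h : CompactSuppIn V s)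
    (hs : {x | t x ≠ 0} ⊆ closure {x | s x ≠ 0}) : CompactSuppIn V t := by
  have := closure_minimal hs isClosed_closure
  exact ⟨h.1.of_isClosed_subset isClosed_closure this, this.trans h.2⟩

theorem CompactSuppIn.add {E : X → Type u} [∀ x, AddCommGroup (E x)]
    {V : Set X} {s t : ∀ x, E x} (hs : CompactSuppIn V s) (ht : CompactSuppIn V t) :
    CompactSuppIn V (s + t) := by
  have h : closure {x | (s + t) x ≠ 0} ⊆ closure {x | s x ≠ 0} ∪ closure {x | t x ≠ 0} := by
    rw [← closure_union]
    refine closure_mono fun x hx => ?_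
    by_contra hc
    simp only [mem_union, mem_ofPred_eq, not_or, not_not] at hc
    exact hx (by simp [hc.1, hc.2])
  exact ⟨(hs.1.union ht.1).of_isClosed_subset isClosed_closure h,
    h.trans (union_subset hs.2 ht.2)⟩

theorem CompactSuppIn.zero {E : X → Type u} [∀ x, AddCommGroup (E x)] (V : Set X) :
    CompactSuppIn V (0 : ∀ x, E x) := by
  simp [CompactSuppIn]

variable (F) (L : X → Type u) [TopologicalSpace (TotalSpace F L)] [∀ x, AddCommGroup (L x)]
  [∀ x, Module ℂ (L x)] [∀ x, TopologicalSpace (L x)] [FiberBundle F L] [VectorBundle ℂ F L]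

/-- Smoothness (in the real sense) of a section of `L`: its expressions in local trivialisations
are smooth. -/
def IsSmoothSection (s : ∀ x, L x) : Prop :=
  ∀ x₀, ContMDiffAt 𝓘(ℝ, ℂ) 𝓘(ℝ, F) ∞
    (fun x => (trivializationAt F L x₀).linearMapAt ℂ x (s x)) x₀

/-- `L`-valued `(0,1)`-forms, without any regularity: antilinear maps from the tangent spaces of
`X` to the fibres of `L`. The tangent space `TangentSpace 𝓘(ℂ, ℂ) x` is by definition `ℂ`, which we
write to have the norm and the complex structure at hand. -/
abbrev Form01 : Type u := ∀ x : X, ℂ →ₛₗ[starRingEnd ℂ] L x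

/-- Smoothness (in the real sense) of an `L`-valued `(0,1)`-form: in a local trivialisation of `L`
and a local holomorphic coordinate `φ` it reads `c • dφ̄` with `c` smooth. -/
def IsSmoothForm (s : Form01 L) : Prop :=
  ∀ x₀, ∃ c : X → F, ContMDiffAt 𝓘(ℝ, ℂ) 𝓘(ℝ, F) ∞ c x₀ ∧
    ∀ᶠ x in 𝓝 x₀, ∀ v : ℂ,
      (trivializationAt F L x₀).linearMapAt ℂ x (s x v) =
        conj (coordDeriv (chartAt ℂ x₀) x v) • c x

/-- `Ω^{0,0}_c(V, L)`. Sections over `V` with compact support in `V` are extended by zero, so that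
the extension maps `Ω^{0,0}_c(V, L) → Ω^{0,0}_c(V', L)` are the inclusions. -/
def Omega0 (V : Set X) : Submodule ℂ (∀ x, L x) where
  carrier := {s | IsSmoothSection F L s ∧ CompactSuppIn V s}
  zero_mem' := by
    refine ⟨fun x₀ => ?_, CompactSuppIn.zero V⟩
    simpa using contMDiffAt_const
  add_mem' := by
    rintro s t ⟨h1, h2⟩ ⟨k1, k2⟩
    refine ⟨fun x₀ => ?_, h2.add k2⟩
    simpa [Pi.add_def] using (h1 x₀).add (k1 x₀)
  smul_mem' := by
    rintro a s ⟨h1, h2⟩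
    refine ⟨fun x₀ => ?_, h2.mono_supp ?_⟩
    · have h : ContMDiff 𝓘(ℝ, F) 𝓘(ℝ, F) ∞ (fun y : F => a • y) := by
        apply ContDiff.contMDiff
        fun_prop
      simpa [Function.comp_def] using h.contMDiffAt.comp x₀ (h1 x₀)
    · intro x hx
      refine subset_closure fun hx' => hx ?_
      simp [hx']

/-- `Ω^{0,1}_c(V, L)`, again with forms on `V` extended by zero. -/
def Omega1 (V : Set X) : Submodule ℂ (Form01 L) where
  carrier := {s | IsSmoothForm F L s ∧ CompactSuppIn V s}
  zero_mem' := by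
    refine ⟨fun x₀ => ⟨0, contMDiffAt_const, ?_⟩, CompactSuppIn.zero V⟩
    simp
  add_mem' := by
    rintro s t ⟨h1, h2⟩ ⟨k1, k2⟩
    refine ⟨fun x₀ => ?_, h2.add k2⟩
    obtain ⟨c, hc, hc'⟩ := h1 x₀
    obtain ⟨d, hd, hd'⟩ := k1 x₀
    refine ⟨c + d, hc.add hd, ?_⟩
    filter_upwards [hc', hd'] with x h k v
    simp [h v, k v]
  smul_mem' := by
    rintro a s ⟨h1, h2⟩
    refine ⟨fun x₀ => ?_, h2.mono_supp ?_⟩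
    · obtain ⟨c, hc, hc'⟩ := h1 x₀
      have h : ContMDiff 𝓘(ℝ, F) 𝓘(ℝ, F) ∞ (fun y : F => a • y) := by
        apply ContDiff.contMDiff
        fun_prop
      refine ⟨fun x => a • c x, by simpa [Function.comp_def] using h.contMDiffAt.comp x₀ hc, ?_⟩
      filter_upwards [hc'] with x h v
      simp [h v, smul_comm a]
    · intro x hx
      refine subset_closure fun hx' => hx ?_
      simp [hx']

/-- The Dolbeault operator of `L` on sections: the antilinear part of the derivative, computed in
a holomorphic local trivialisation. -/
def dbarSection (s : ∀ x, L x) : Form01 L := fun x =>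
  ((trivializationAt F L x).symmₗ ℂ x).comp
    (antilinearPart (realDeriv (fun y => (trivializationAt F L x).linearMapAt ℂ y (s y)) x))

variable {F L}

theorem chart_differentiableAt {g : X → F} {x₀ : X}
    (hg : ContMDiffAt 𝓘(ℝ, ℂ) 𝓘(ℝ, F) ∞ g x₀) :
    ContDiffAt ℝ ∞ (fun z => g ((chartAt ℂ x₀).symm z)) (chartAt ℂ x₀ x₀) := by
  have := hg.2
  simpa [ContDiffWithinAtProp, Function.comp_def, chartAt_self_eq, contDiffWithinAt_univ] using this

theorem mfderiv_eq_fderiv {g : X → F} {x₀ : X}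
    (hg : ContMDiffAt 𝓘(ℝ, ℂ) 𝓘(ℝ, F) ∞ g x₀) :
    realDeriv g x₀ = fderiv ℝ (fun z => g ((chartAt ℂ x₀).symm z)) (chartAt ℂ x₀ x₀) := by
  unfold realDeriv
  rw [(hg.mdifferentiableAt (by simp)).mfderiv]
  simp [writtenInExtChartAt, Function.comp_def, fderivWithin_univ, chartAt_self_eq]

theorem dbarSection_smooth [IsManifold 𝓘(ℂ, ℂ) ω X] [ContMDiffVectorBundle ω F L 𝓘(ℂ, ℂ)]
    {s : ∀ x, L x} (hs : IsSmoothSection F L s) : IsSmoothForm F L (dbarSection F L s) := by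
  intro x₀
  set φ := chartAt ℂ x₀ with hφ
  set e := trivializationAt F L x₀ with he
  set G : ℂ → F := fun z => e.linearMapAt ℂ (φ.symm z) (s (φ.symm z)) with hG
  have hG0 : ContDiffAt ℝ ∞ G (φ x₀) := chart_differentiableAt (hs x₀)
  have hcont : ContinuousAt φ x₀ := φ.continuousAt (mem_chart_source ℂ x₀)
  refine ⟨fun x => antilinearPart (fderiv ℝ G (φ x)) 1, ?_, ?_⟩
  · have h1 : ContDiffAt ℝ ∞ (fun z => antilinearPart (fderiv ℝ G z) 1) (φ x₀) := by
      have h2 : ContDiffAt ℝ ∞ (fderiv ℝ G) (φ x₀) := hG0.fderiv_right (by simp)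
      simp only [antilinearPart, LinearMap.coe_mk, AddHom.coe_mk]
      fun_prop
    have h3 : ContMDiffAt 𝓘(ℝ, ℂ) 𝓘(ℝ, ℂ) ∞ φ x₀ := by
      refine ⟨hcont.continuousWithinAt, ?_⟩
      have : (fun z => φ (φ.symm z)) =ᶠ[𝓝 (φ x₀)] fun z => z := by
        filter_upwards [φ.open_target.mem_nhds (φ.map_source (mem_chart_source ℂ x₀))] with z hz
        exact φ.right_inv hz
      have h4 : ContDiffAt ℝ ∞ (fun z => φ (φ.symm z)) (φ x₀) := contDiffAt_id.congr_of_eventuallyEq this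
      simpa [ContDiffWithinAtProp, Function.comp_def, chartAt_self_eq, contDiffWithinAt_univ] using h4
    exact h1.contMDiffAt.comp x₀ h3
  · have hd : ∀ᶠ x in 𝓝 x₀, DifferentiableAt ℝ G (φ x) := by
      have h1 : ∀ᶠ z in 𝓝 (φ x₀), ContDiffAt ℝ 1 G z :=
        (hG0.of_le (by norm_num)).eventually (by norm_num)
      filter_upwards [hcont.eventually h1] with x hx
      exact hx.differentiableAt (by norm_num)
    filter_upwards [hd, φ.open_source.mem_nhds (mem_chart_source ℂ x₀),
      e.open_baseSet.mem_nhds (mem_baseSet_trivializationAt F L x₀)] with x hdx hxφ hxe v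
    set ψ := chartAt ℂ x with hψ
    set e' := trivializationAt F L x with he'
    have hxe' : x ∈ e'.baseSet := mem_baseSet_trivializationAt F L x
    have hxψ : x ∈ ψ.source := mem_chart_source ℂ x
    -- the change of trivialisation and the change of coordinate
    have hT : DifferentiableAt ℂ (fun z => (e'.coordChangeL ℂ e (ψ.symm z) : F →L[ℂ] F)) (ψ x) := by
      have h1 := (contMDiffAt_coordChangeL (n := ω) (IB := 𝓘(ℂ, ℂ)) (e := e') (e' := e) hxe' hxe).2
      have h2 : ContDiffAt ℂ ω (fun z => (e'.coordChangeL ℂ e (ψ.symm z) : F →L[ℂ] F)) (ψ x) := by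
        simpa [ContDiffWithinAtProp, Function.comp_def, chartAt_self_eq, contDiffWithinAt_univ] using h1
      exact h2.differentiableAt (by simp)
    have hτ' : MDifferentiableAt 𝓘(ℂ, ℂ) 𝓘(ℂ, ℂ) φ x :=
      mdifferentiableAt_atlas (chart_mem_atlas ℂ x₀) hxφ
    have hτm : coordDeriv φ x = fderiv ℂ (fun z => φ (ψ.symm z)) (ψ x) := by
      unfold coordDeriv
      rw [hτ'.mfderiv]
      simp [writtenInExtChartAt, Function.comp_def, fderivWithin_univ, hψ, chartAt_self_eq]
    have hτ : DifferentiableAt ℂ (fun z => φ (ψ.symm z)) (ψ x) := by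
      have := hτ'.2
      simpa [DifferentiableWithinAtProp, Function.comp_def, chartAt_self_eq, differentiableWithinAt_univ] using this
    -- the two expressions of the section
    have hψc : ContinuousAt ψ.symm (ψ x) := ψ.symm.continuousAt (ψ.map_source hxψ)
    have hmem : ∀ᶠ z in 𝓝 (ψ x), ψ.symm z ∈ φ.source ∩ (e'.baseSet ∩ e.baseSet) := by
      refine hψc.eventually_mem ?_
      rw [ψ.left_inv hxψ]
      exact (φ.open_source.inter (e'.open_baseSet.inter e.open_baseSet)).mem_nhds
        ⟨hxφ, hxe', hxe⟩
    have hgs := hs x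
    have hgd : DifferentiableAt ℝ (fun z => e'.linearMapAt ℂ (ψ.symm z) (s (ψ.symm z))) (ψ x) :=
      (chart_differentiableAt hgs).differentiableAt (by simp)
    have hEq : (fun z => G (φ (ψ.symm z))) =ᶠ[𝓝 (ψ x)]
        fun z => (e'.coordChangeL ℂ e (ψ.symm z) : F →L[ℂ] F)
          (e'.linearMapAt ℂ (ψ.symm z) (s (ψ.symm z))) := by
      filter_upwards [hmem] with z hz
      simp only [hG]
      rw [φ.left_inv hz.1]
      change _ = e'.coordChangeL ℂ e (ψ.symm z) _
      rw [e'.coordChangeL_apply e hz.2, e'.coe_linearMapAt_of_mem hz.2.1,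
        e.coe_linearMapAt_of_mem hz.2.2, e'.symm_apply_apply_mk hz.2.1]
    have hx' : ψ.symm (ψ x) = x := ψ.left_inv hxψ
    have k1 := antilinearPart_comp (G := G) hτ (by rw [hx']; exact hdx) v
    have k2 := antilinearPart_smul hT hgd v
    rw [hEq.fderiv_eq, k2] at k1
    simp only [hx'] at k1
    rw [hτm]
    refine Eq.trans ?_ k1
    have k3 : dbarSection F L s x v = e'.symmₗ ℂ x
        (antilinearPart (fderiv ℝ (fun z => e'.linearMapAt ℂ (ψ.symm z) (s (ψ.symm z))) (ψ x)) v) := by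
      unfold dbarSection
      rw [mfderiv_eq_fderiv hgs]
      rfl
    rw [k3]
    change _ = e'.coordChangeL ℂ e x _
    rw [e'.coordChangeL_apply e ⟨hxe', hxe⟩, e.coe_linearMapAt_of_mem hxe, e'.symmₗ_apply hxe']

theorem dbarSection_supp (s : ∀ x, L x) :
    {x | dbarSection F L s x ≠ 0} ⊆ closure {x | s x ≠ 0} := by
  intro x hx
  by_contra hc
  refine hx ?_
  have h0 : (fun y => (trivializationAt F L x).linearMapAt ℂ y (s y)) =ᶠ[𝓝 x] fun _ => (0 : F) := by
    filter_upwards [isClosed_closure.isOpen_compl.mem_nhds hc] with y hy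
    have : s y = 0 := by
      by_contra h
      exact hy (subset_closure h)
    simp [this]
  have h1 : realDeriv (fun y => (trivializationAt F L x).linearMapAt ℂ y (s y)) x = 0 := by
    unfold realDeriv
    rw [h0.mfderiv_eq, mfderiv_const]
    rfl
  unfold dbarSection
  rw [h1]
  ext
  simp [antilinearPart]

variable (F L)

/-- The Dolbeault differential `Ω^{0,0}_c(V, L) → Ω^{0,1}_c(V, L)`. -/
def dbar [IsManifold 𝓘(ℂ, ℂ) ω X] [ContMDiffVectorBundle ω F L 𝓘(ℂ, ℂ)] (V : Set X) :
    Omega0 F L V →ₗ[ℂ] Omega1 F L V where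
  toFun s := ⟨dbarSection F L s.1, dbarSection_smooth s.2.1, s.2.2.mono_supp (dbarSection_supp _)⟩
  map_add' s t := by
    apply Subtype.ext
    funext x
    have h1 := mfderiv_eq_fderiv (s.2.1 x)
    have h2 := mfderiv_eq_fderiv (t.2.1 x)
    have h3 := mfderiv_eq_fderiv ((s + t).2.1 x)
    have d1 := (chart_differentiableAt (s.2.1 x)).differentiableAt (n := ∞) (by simp)
    have d2 := (chart_differentiableAt (t.2.1 x)).differentiableAt (n := ∞) (by simp)
    simp only [Submodule.coe_add, Pi.add_apply, map_add] at h3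
    have h4 := fderiv_fun_add d1 d2
    rw [h4, ← h1, ← h2] at h3
    apply LinearMap.ext
    intro v
    simp only [dbarSection, Submodule.coe_add, Pi.add_apply, LinearMap.comp_apply,
      LinearMap.add_apply, map_add, h3]
    rw [← map_add]
    congr 1
    simp only [antilinearPart, LinearMap.coe_mk, AddHom.coe_mk, _root_.add_apply, smul_add]
    abel
  map_smul' a s := by
    apply Subtype.ext
    funext x
    have h1 := mfderiv_eq_fderiv (s.2.1 x)
    have h3 := mfderiv_eq_fderiv ((a • s).2.1 x)
    have d1 := (chart_differentiableAt (s.2.1 x)).differentiableAt (n := ∞) (by simp)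
    simp only [Submodule.coe_smul, Pi.smul_apply, map_smul] at h3
    have h4 := fderiv_fun_const_smul d1 a
    rw [h4, ← h1] at h3
    apply LinearMap.ext
    intro v
    simp only [dbarSection, Submodule.coe_smul, Pi.smul_apply, LinearMap.comp_apply,
      LinearMap.smul_apply, map_smul, h3, RingHom.id_apply]
    rw [← map_smul]
    congr 1
    simp only [antilinearPart, LinearMap.coe_mk, AddHom.coe_mk, _root_.smul_apply, smul_add,
      smul_smul]
    congr 2 <;> ring

end Dolbeault

/-! ## Twisted local Lie algebras -/

section LieData

variable (F : Type u) [NormedAddCommGroup F] [NormedSpace ℂ F]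
  {X : Type u} [TopologicalSpace X] [ChartedSpace ℂ X] [IsManifold 𝓘(ℂ, ℂ) ω X]
  (L : X → Type u) [TopologicalSpace (TotalSpace F L)] [∀ x, AddCommGroup (L x)]
  [∀ x, Module ℂ (L x)] [∀ x, TopologicalSpace (L x)] [FiberBundle F L] [VectorBundle ℂ F L]
  [ContMDiffVectorBundle ω F L 𝓘(ℂ, ℂ)]

/-- The structure of a precosheaf of DG Lie algebras on `V ↦ Ω^{0,•}_c(V, L)`. As the complex lives
in degrees `0` and `1`, the bracket is given by its components `[a, b]` and `[a, η]` for `a, b` of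
degree `0` and `η` of degree `1`; by graded antisymmetry `[η, a] = -[a, η]`, and the bracket
of two elements of degree `1` vanishes. -/
structure DGLieBracket where
  br₀ : ∀ V : TopologicalSpace.Opens X,
    Omega0 F L (V : Set X) →ₗ[ℂ] Omega0 F L (V : Set X) →ₗ[ℂ] Omega0 F L (V : Set X)
  br₁ : ∀ V : TopologicalSpace.Opens X,
    Omega0 F L (V : Set X) →ₗ[ℂ] Omega1 F L (V : Set X) →ₗ[ℂ] Omega1 F L (V : Set X)
  antisymm : ∀ V a b, br₀ V a b = -br₀ V b a
  jacobi₀ : ∀ V a b c, br₀ V a (br₀ V b c) = br₀ V (br₀ V a b) c + br₀ V b (br₀ V a c)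
  jacobi₁ : ∀ V a b η, br₁ V a (br₁ V b η) = br₁ V (br₀ V a b) η + br₁ V b (br₁ V a η)
  leibniz : ∀ (V : TopologicalSpace.Opens X) a b, dbar F L (V : Set X) (br₀ V a b) =
    -br₁ V b (dbar F L (V : Set X) a) + br₁ V a (dbar F L (V : Set X) b)
  ext₀ : ∀ V V' : TopologicalSpace.Opens X, V ≤ V' → ∀ a b a' b', a.1 = a'.1 → b.1 = b'.1 →
    (br₀ V a b).1 = (br₀ V' a' b').1
  ext₁ : ∀ V V' : TopologicalSpace.Opens X, V ≤ V' → ∀ a η a' η', a.1 = a'.1 → η.1 = η'.1 →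
    (br₁ V a η).1 = (br₁ V' a' η').1

variable {F L} in
/-- A `2`-cocycle of the DG Lie algebras `Ω^{0,•}_c(V, L)`, of degree such that
`[a, b] + α(a, b) 𝟏` is homogeneous for `𝟏` of degree `1`: its only components are
`α(a, η) = -α(η, a)` with `a` of degree `0` and `η` of degree `1`. -/
structure TwoCocycle (b : DGLieBracket F L) where
  α : ∀ V : TopologicalSpace.Opens X,
    Omega0 F L (V : Set X) →ₗ[ℂ] Omega1 F L (V : Set X) →ₗ[ℂ] ℂ
  closed : ∀ (V : TopologicalSpace.Opens X) a a', -α V a' (dbar F L (V : Set X) a) + α V a (dbar F L (V : Set X) a') = 0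
  cocycle : ∀ V a a' η, α V a (b.br₁ V a' η) = α V (b.br₀ V a a') η + α V a' (b.br₁ V a η)

end LieData

/-! ## Pointed DG vector spaces -/

/-- A pointed DG vector space: a cochain complex of complex vector spaces with a degree `1` map
from `ℂ` with values in the cocycles. -/
structure PointedComplex where
  cx : CochainComplex (ModuleCat.{u} ℂ) ℤ
  unit : ℂ →ₗ[ℂ] cx.X 1
  unit_closed : ∀ c, (cx.d 1 2).hom (unit c) = 0

/-- Morphisms of pointed DG vector spaces. -/
structure PointedComplex.Hom (A B : PointedComplex.{u}) where
  map : A.cx ⟶ B.cx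
  map_unit : ∀ c, (map.f 1).hom (A.unit c) = B.unit c

/-- A strong deformation retract of pointed DG vector spaces, with `A` the retract of `B`. The
degree `-1` map `h` is given by its components. Note that `f ≫ g` is `g ∘ f`. -/
structure StrongDeformationRetract (A B : PointedComplex.{u}) where
  i : A.Hom B
  p : B.Hom A
  h : ∀ m n : ℤ, B.cx.X m ⟶ B.cx.X n
  h_degree : ∀ m n, n + 1 ≠ m → h m n = 0
  p_i : i.map ≫ p.map = 𝟙 A.cx
  homotopy : ∀ n, (p.map ≫ i.map).f n - 𝟙 (B.cx.X n) =
    -(h n (n - 1) ≫ B.cx.d (n - 1) n + B.cx.d n (n + 1) ≫ h (n + 1) n)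
  p_h : ∀ m n, h m n ≫ p.map.f n = 0
  h_i : ∀ m n, i.map.f m ≫ h m n = 0
  h_h : ∀ l m n, h l m ≫ h m n = 0

section TwoTerm

variable {A B : Type u} [AddCommGroup A] [Module ℂ A] [AddCommGroup B] [Module ℂ B]

variable (A B) in
/-- The components of the complex `A ⟶ B` in degrees `0` and `1`. -/
def twoTermX : ℤ → ModuleCat.{u} ℂ
  | .ofNat 0 => ModuleCat.of ℂ A
  | .ofNat 1 => ModuleCat.of ℂ B
  | _ => ModuleCat.of ℂ PUnit.{u + 1}

/-- The differential of the complex `A ⟶ B` in degrees `0` and `1`. -/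
def twoTermD (d : A →ₗ[ℂ] B) : ∀ m n : ℤ, twoTermX A B m ⟶ twoTermX A B n
  | .ofNat 0, .ofNat 1 => ModuleCat.ofHom d
  | _, _ => 0

theorem twoTermD_eq_zero (d : A →ₗ[ℂ] B) (m n : ℤ) (h : ¬(m = 0 ∧ n = 1)) : twoTermD d m n = 0 := by
  rcases m with (_ | m) | m
  · rcases n with (_ | _ | n) | n
    · rfl
    · exact absurd ⟨rfl, rfl⟩ h
    · rfl
    · rfl
  · rfl
  · rfl

/-- The complex `A ⟶ B` in degrees `0` and `1`. -/
def twoTerm (d : A →ₗ[ℂ] B) : CochainComplex (ModuleCat.{u} ℂ) ℤ where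
  X := twoTermX A B
  d := twoTermD d
  shape m n hmn := by
    refine twoTermD_eq_zero d m n fun h => hmn ?_
    change m + 1 = n
    omega
  d_comp_d' l m n h1 h2 := by
    by_cases hm : m = 1
    · rw [twoTermD_eq_zero d m n fun h => by omega, Limits.comp_zero]
    · rw [twoTermD_eq_zero d l m fun h => hm h.2, Limits.zero_comp]

end TwoTerm

/-! ## Germs at infinity, and the maps between germs and `(0,1)`-forms on the plane

A `(0,1)`-form `w dλ̄` on an open subset of `ℂ` is represented by its coefficient `w`. -/

/-- `f` is holomorphic at the point `x` of the Riemann sphere. -/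
def SphereHolAt (f : OnePoint ℂ → ℂ) (x : OnePoint ℂ) : Prop :=
  (∀ z : ℂ, x = z → AnalyticAt ℂ (fun w : ℂ => f w) z) ∧
  (x = OnePoint.infty →
    AnalyticAt ℂ (fun w : ℂ => f (if w = 0 then OnePoint.infty else ((w⁻¹ : ℂ) : OnePoint ℂ))) 0)

/-- The complement of `S` in the Riemann sphere. -/
def sphereCompl (S : Set ℂ) : Set (OnePoint ℂ) := ((fun z : ℂ => (z : OnePoint ℂ)) '' S)ᶜ

/-- `f` represents a germ at `sphereCompl S`: it is holomorphic on the open neighbourhood `Δ` of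
`sphereCompl S` and vanishes at infinity. The values of `f` outside `Δ` are irrelevant. -/
structure IsGermRep (S : Set ℂ) (f : OnePoint ℂ → ℂ) (Δ : Set (OnePoint ℂ)) : Prop where
  isOpen : IsOpen Δ
  subset : sphereCompl S ⊆ Δ
  hol : ∀ x ∈ Δ, SphereHolAt f x
  vanish : f OnePoint.infty = 0

/-- The space `𝒪_∞(Sᶜ)` of germs at `sphereCompl S` of holomorphic functions that vanish at
infinity. -/
def OInfty (S : Set ℂ) : Submodule ℂ (Filter.Germ (𝓝ˢ (sphereCompl S)) ℂ) where
  carrier := {g | ∃ f Δ, IsGermRep S f Δ ∧ g = (f : Filter.Germ (𝓝ˢ (sphereCompl S)) ℂ)}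
  zero_mem' := by
    refine ⟨0, univ, ⟨isOpen_univ, subset_univ _, fun x _ => ⟨fun z _ => ?_, fun _ => ?_⟩, rfl⟩, rfl⟩
    · exact analyticAt_const
    · exact analyticAt_const
  add_mem' := by
    rintro _ _ ⟨f, Δ, hf, rfl⟩ ⟨g, Δ', hg, rfl⟩
    refine ⟨f + g, Δ ∩ Δ', ⟨hf.isOpen.inter hg.isOpen, subset_inter hf.subset hg.subset,
      fun x hx => ⟨fun z hz => ?_, fun h => ?_⟩, ?_⟩, rfl⟩
    · exact ((hf.hol x hx.1).1 z hz).add ((hg.hol x hx.2).1 z hz)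
    · exact ((hf.hol x hx.1).2 h).add ((hg.hol x hx.2).2 h)
    · simp [hf.vanish, hg.vanish]
  smul_mem' := by
    rintro c _ ⟨f, Δ, hf, rfl⟩
    refine ⟨c • f, Δ, ⟨hf.isOpen, hf.subset, fun x hx => ⟨fun z hz => ?_, fun h => ?_⟩, ?_⟩, rfl⟩
    · exact analyticAt_const.mul ((hf.hol x hx).1 z hz)
    · exact analyticAt_const.mul ((hf.hol x hx).2 h)
    · simp [hf.vanish]

/-- `Ω^{0,1}_c(W)` for `W ⊆ ℂ`, in terms of the coefficient of `dλ̄`. -/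
def PlaneForm (W : Set ℂ) : Submodule ℂ (ℂ → ℂ) where
  carrier := {w | ContDiff ℝ ∞ w ∧ HasCompactSupport w ∧ tsupport w ⊆ W}
  zero_mem' := ⟨contDiff_const, HasCompactSupport.zero, by simp [tsupport]⟩
  add_mem' := by
    rintro v w ⟨h1, h2, h3⟩ ⟨k1, k2, k3⟩
    exact ⟨h1.add k1, h2.add k2, (tsupport_add v w).trans (union_subset h3 k3)⟩
  smul_mem' := by
    rintro c w ⟨h1, h2, h3⟩
    have hs : Function.support (c • w) ⊆ Function.support w := fun x hx hx' => hx (by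
      simp [hx'])
    exact ⟨contDiff_const.smul h1, h2.mono hs, (closure_mono hs).trans h3⟩

/-- The coefficient of `∂̄ρ` with respect to `dλ̄`. -/
def planeDbar (ρ : ℂ → ℂ) (z : ℂ) : ℂ := antilinearPart (fderiv ℝ ρ z) 1

/-- The function `ω^↓(λ) = (1 / 2πi) ∫ dμ ∧ ω / (μ - λ)` for `ω = w dμ̄`; here `dμ ∧ dμ̄ = -2i dx ∧ dy`
for `μ = x + i y`. -/
def cauchyTransform (w : ℂ → ℂ) (l : ℂ) : ℂ :=
  (2 * Real.pi * Complex.I)⁻¹ * ∫ μ : ℂ, (-2 * Complex.I) * (w μ / (μ - l))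

/-- Extension of a function on the plane to the Riemann sphere by the value `0` at infinity. -/
def extendZero (f : ℂ → ℂ) (x : OnePoint ℂ) : ℂ := x.elim 0 f

/-- The germ `g` is the germ `[ω^↓]` for `ω = w dλ̄`. -/
def IsDownGerm {W : Set ℂ} (w : ℂ → ℂ) (g : OInfty W) : Prop :=
  (g : Filter.Germ (𝓝ˢ (sphereCompl W)) ℂ) = (extendZero (cauchyTransform w) : OnePoint ℂ → ℂ)

/-- The choices on which `⌈·⌉` depends: a basis of the space of germs, for each basis element a
representative `rep` with its domain `Δ`, and a smooth bump function `ρ` with compact support in `W`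
that is `1` on a neighbourhood of the complement of `Δ`. -/
structure LiftChoice (W : Set ℂ) where
  ι : Type
  basis : Module.Basis ι ℂ (OInfty W)
  rep : ι → OnePoint ℂ → ℂ
  Δ : ι → Set (OnePoint ℂ)
  isGermRep : ∀ b, IsGermRep W (rep b) (Δ b)
  germ_eq : ∀ b, (basis b : Filter.Germ (𝓝ˢ (sphereCompl W)) ℂ) = (rep b : OnePoint ℂ → ℂ)
  ρ : ι → ℂ → ℂ
  ρ_smooth : ∀ b, ContDiff ℝ ∞ (ρ b)
  ρ_compact : ∀ b, HasCompactSupport (ρ b)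
  ρ_supp : ∀ b, tsupport (ρ b) ⊆ W
  ρ_one : ∀ b, ∀ᶠ z in 𝓝ˢ {z : ℂ | (z : OnePoint ℂ) ∉ Δ b}, ρ b z = 1

theorem planeDbar_of_eventuallyEq {ρ : ℂ → ℂ} {z c : ℂ} (h : ρ =ᶠ[𝓝 z] fun _ => c) :
    planeDbar ρ z = 0 := by
  have : fderiv ℝ ρ z = 0 := by rw [h.fderiv_eq]; simp
  simp [planeDbar, this, antilinearPart]

theorem planeDbar_contDiff {ρ : ℂ → ℂ} (h : ContDiff ℝ ∞ ρ) : ContDiff ℝ ∞ (planeDbar ρ) := by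
  have h2 : ContDiff ℝ ∞ (fderiv ℝ ρ) := h.fderiv_right (by simp)
  unfold planeDbar
  simp only [antilinearPart, LinearMap.coe_mk, AddHom.coe_mk]
  fun_prop

theorem LiftChoice.mem_planeForm {W : Set ℂ} (c : LiftChoice W) (b : c.ι) :
    (fun z : ℂ => -(c.rep b z * planeDbar (c.ρ b) z)) ∈ PlaneForm W := by
  have hsupp : Function.support (fun z : ℂ => -(c.rep b z * planeDbar (c.ρ b) z)) ⊆
      tsupport (c.ρ b) := by
    intro z hz
    by_contra hc
    refine hz ?_
    have : planeDbar (c.ρ b) z = 0 := by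
      refine planeDbar_of_eventuallyEq (c := 0) ?_
      filter_upwards [(isClosed_tsupport _).isOpen_compl.mem_nhds hc] with y hy
      exact image_eq_zero_of_notMem_tsupport hy
    simp [this]
  have hcl := closure_minimal hsupp (isClosed_tsupport _)
  refine ⟨?_, (c.ρ_compact b).of_isClosed_subset isClosed_closure hcl, hcl.trans (c.ρ_supp b)⟩
  rw [contDiff_iff_contDiffAt]
  intro z
  by_cases hz : (z : OnePoint ℂ) ∈ c.Δ b
  · have h1 : ContDiffAt ℝ ∞ (fun w : ℂ => c.rep b w) z :=
      ((((c.isGermRep b).hol _ hz).1 z rfl).contDiffAt (n := ∞)).restrict_scalars ℝ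
    exact (h1.mul (planeDbar_contDiff (c.ρ_smooth b)).contDiffAt).neg
  · have h1 : ∀ᶠ y in 𝓝 z, c.ρ b y = 1 :=
      (c.ρ_one b).filter_mono (nhds_le_nhdsSet (by simpa using hz))
    refine (contDiffAt_const (c := (0 : ℂ))).congr_of_eventuallyEq ?_
    filter_upwards [h1.eventually_nhds] with y hy
    have : planeDbar (c.ρ b) y = 0 := planeDbar_of_eventuallyEq (c := 1) hy
    simp [this]

/-- The linear map `[f] ↦ ⌈f⌉`, given by `⌈f⌉ = - f ∂̄ρ_f` on the elements of the chosen basis. -/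
def LiftChoice.lift {W : Set ℂ} (c : LiftChoice W) : OInfty W →ₗ[ℂ] PlaneForm W :=
  c.basis.constr ℂ fun b => ⟨fun z : ℂ => -(c.rep b z * planeDbar (c.ρ b) z), c.mem_planeForm b⟩

/-! ## Holomorphic coordinates -/

section Coordinates

variable (F : Type u) [NormedAddCommGroup F] [NormedSpace ℂ F]
  {X : Type u} [TopologicalSpace X] [ChartedSpace ℂ X]

variable (X) in
/-- A local holomorphic coordinate, defined on the open subset `chart.source`. -/
structure HolCoord where
  chart : OpenPartialHomeomorph X ℂ
  mem : chart ∈ IsManifold.maximalAtlas 𝓘(ℂ, ℂ) ω X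

/-- Bounded holomorphic coordinates `ξ_j : W_j → ℂ` on the connected components of `V`. -/
structure BoundedCoords (V : Set X) where
  m : ℕ
  m_eq : m = 1 ∨ m = 2
  coord : Fin m → HolCoord X
  connected : ∀ j, _root_.IsConnected (coord j).chart.source
  disjoint : Pairwise fun j k => Disjoint (coord j).chart.source (coord k).chart.source
  iUnion_eq : ⋃ j, (coord j).chart.source = V
  bounded : ∀ j, Bornology.IsBounded (coord j).chart.target

/-- The image `ξ_j(W_j)`. -/
abbrev BoundedCoords.image {V : Set X} (ξ : BoundedCoords V) (j : Fin ξ.m) : Set ℂ :=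
  (ξ.coord j).chart.target

variable (L : X → Type u) [TopologicalSpace (TotalSpace F L)] [∀ x, AddCommGroup (L x)]
  [∀ x, Module ℂ (L x)] [∀ x, TopologicalSpace (L x)] [FiberBundle F L] [VectorBundle ℂ F L]

/-- Holomorphic trivialisations of `L` over all coordinate charts `ξ : W → ℂ`, with finite-dimensional
fibres `𝔞_ξ` (`fib ξ`), together with isomorphisms `(·)_ξ` (`iso ξ`) from a fixed vector space `𝔞`
onto the `𝔞_ξ`. The map `triv ξ x` is the restriction of `W × 𝔞_ξ ≅ L|_W` to the fibres over
`x ∈ W`; its values for `x ∉ W` are irrelevant. -/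
structure CoordTrivialization (𝔞 : Type u) [AddCommGroup 𝔞] [Module ℂ 𝔞] where
  fib : HolCoord X → Type u
  [addCommGroup : ∀ ξ, AddCommGroup (fib ξ)]
  [module : ∀ ξ, Module ℂ (fib ξ)]
  [finiteDimensional : ∀ ξ, FiniteDimensional ℂ (fib ξ)]
  triv : ∀ (ξ : HolCoord X) (x : X), fib ξ →ₗ[ℂ] L x
  bijective : ∀ ξ, ∀ x ∈ ξ.chart.source, Function.Bijective (triv ξ x)
  holomorphic : ∀ ξ (a : fib ξ), ContMDiffOn 𝓘(ℂ, ℂ) (𝓘(ℂ, ℂ).prod 𝓘(ℂ, F)) ω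
    (fun x => TotalSpace.mk' F x (triv ξ x a)) ξ.chart.source
  iso : ∀ ξ, 𝔞 ≃ₗ[ℂ] fib ξ

attribute [instance] CoordTrivialization.addCommGroup CoordTrivialization.module
  CoordTrivialization.finiteDimensional

variable {F L} {𝔞 : Type u} [AddCommGroup 𝔞] [Module ℂ 𝔞]

open Classical in
/-- The section `a_ξ ⊗ ξ^* g` of `L`, for a function `g` on `ξ(W)`, extended by zero outside the
domain `W` of `ξ`. -/
def tensorSection (T : CoordTrivialization F L 𝔞) (ξ : HolCoord X) (a : 𝔞) (g : ℂ → ℂ) (x : X) :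
    L x :=
  if x ∈ ξ.chart.source then g (ξ.chart x) • T.triv ξ x (T.iso ξ a) else 0

open Classical in
/-- The `L`-valued `(0,1)`-form `a_ξ ⊗ ξ^*(w dλ̄)`, extended by zero outside the domain of `ξ`. -/
def tensorForm (T : CoordTrivialization F L 𝔞) (ξ : HolCoord X) (a : 𝔞) (w : ℂ → ℂ) : Form01 L :=
  fun x =>
    { toFun := fun v => if x ∈ ξ.chart.source then
        (w (ξ.chart x) * conj (coordDeriv ξ.chart x v)) • T.triv ξ x (T.iso ξ a) else 0
      map_add' := by
        intro v v'
        split_ifs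
        · rw [map_add, map_add, mul_add, add_smul]
        · simp
      map_smul' := by
        intro c v
        split_ifs
        · rw [map_smul, smul_eq_mul, map_mul, smul_smul]
          congr 1
          ring
        · simp }

end Coordinates

/-! ## The strong deformation retract -/

section Retract

variable {F : Type u} [NormedAddCommGroup F] [NormedSpace ℂ F]
  {X : Type u} [TopologicalSpace X] [ChartedSpace ℂ X] [IsManifold 𝓘(ℂ, ℂ) ω X]
  {L : X → Type u} [TopologicalSpace (TotalSpace F L)] [∀ x, AddCommGroup (L x)]
  [∀ x, Module ℂ (L x)] [∀ x, TopologicalSpace (L x)] [FiberBundle F L] [VectorBundle ℂ F L]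
  [ContMDiffVectorBundle ω F L 𝓘(ℂ, ℂ)]

/-- The pointed DG vector space `Ω^{0,•}_c(V, L) ⊕ ℂ 𝟏`, with `𝟏` of degree `1`, which underlies the
central extension of `Ω^{0,•}_c(V, L)` by the cocycle `α`. The cocycle and the bracket enter only in
the Lie bracket of that central extension, not in the DG vector space. -/
def twistedComplex {b : DGLieBracket F L} (_α : TwoCocycle b) (V : Set X) : PointedComplex.{u} where
  cx := twoTerm (A := Omega0 F L V) (B := Omega1 F L V × ℂ)
    ((LinearMap.inl ℂ (Omega1 F L V) ℂ).comp (dbar F L V))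
  unit := LinearMap.inr ℂ (Omega1 F L V) ℂ
  unit_closed := fun _ => rfl

variable {V : Set X} (𝔞 : Type u) [AddCommGroup 𝔞] [Module ℂ 𝔞]

/-- The vector space `⨁_j 𝔞 ⊗ 𝒪_∞(ξ_j(W_j)ᶜ) ⊕ ℂ`. -/
abbrev GermSpace (ξ : BoundedCoords V) : Type u := (∀ j, 𝔞 ⊗[ℂ] OInfty (ξ.image j)) × ℂ

/-- The pointed DG vector space given by `GermSpace` in degree `1`. -/
def germComplex (ξ : BoundedCoords V) : PointedComplex.{u} where
  cx := twoTerm (A := PUnit.{u + 1}) (B := GermSpace 𝔞 ξ) 0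
  unit := LinearMap.inr ℂ (∀ j, 𝔞 ⊗[ℂ] OInfty (ξ.image j)) ℂ
  unit_closed := fun _ => rfl

variable {𝔞} (T : CoordTrivialization F L 𝔞) (ξ : BoundedCoords V)
  (c : ∀ j, LiftChoice (ξ.image j)) {b : DGLieBracket F L} {α : TwoCocycle b}

/-- The map `i` is the one with `(a_j ⊗ [f_j])_j ↦ ∑_j (a_j)_{ξ_j} ⊗ ξ_j^* ⌈f_j⌉` and `a ↦ a 𝟏`. -/
def IsInclusion (i : (germComplex 𝔞 ξ).Hom (twistedComplex α V)) : Prop :=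
  let i₁ : GermSpace 𝔞 ξ →ₗ[ℂ] Omega1 F L V × ℂ := (i.map.f 1).hom
  (∀ j (a : 𝔞) (f : OInfty (ξ.image j)),
    (i₁ (Pi.single j (a ⊗ₜ f), 0)).1.1 = tensorForm T (ξ.coord j) a ((c j).lift f).1 ∧
    (i₁ (Pi.single j (a ⊗ₜ f), 0)).2 = 0) ∧
  ∀ z : ℂ, i₁ (0, z) = (0, z)

/-- The map `p` is the one with
`∑_j (a_j)_{ξ_j} ⊗ ω_j ↦ (a_j ⊗ [((ξ_j⁻¹)^* ω_j)^↓])_j` and `a 𝟏 ↦ a`; a form `ω_j` on the domain of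
`ξ_j` is written as `ξ_j^*(w dλ̄)`. -/
def IsProjection (p : (twistedComplex α V).Hom (germComplex 𝔞 ξ)) : Prop :=
  let p₁ : Omega1 F L V × ℂ →ₗ[ℂ] GermSpace 𝔞 ξ := (p.map.f 1).hom
  (∀ j (a : 𝔞) (w : PlaneForm (ξ.image j)) (s : Omega1 F L V),
    s.1 = tensorForm T (ξ.coord j) a w.1 →
    ∃ g : OInfty (ξ.image j), IsDownGerm w.1 g ∧ p₁ (s, 0) = (Pi.single j (a ⊗ₜ g), 0)) ∧
  ∀ z : ℂ, p₁ (0, z) = (0, z)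

/-- The map `h` is the one with `∑_j (a_j)_{ξ_j} ⊗ ω_j ↦
∑_j (a_j)_{ξ_j} ⊗ ξ_j^* ((ξ_j⁻¹)^* ω_j - ⌈((ξ_j⁻¹)^* ω_j)^↓⌉)^↓` and `a 𝟏 ↦ 0`. -/
def IsContraction
    (h : ∀ m n : ℤ, (twistedComplex α V).cx.X m ⟶ (twistedComplex α V).cx.X n) : Prop :=
  let h₁ : Omega1 F L V × ℂ →ₗ[ℂ] Omega0 F L V := (h 1 0).hom
  (∀ j (a : 𝔞) (w : PlaneForm (ξ.image j)) (s : Omega1 F L V),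
    s.1 = tensorForm T (ξ.coord j) a w.1 →
    ∃ g : OInfty (ξ.image j), IsDownGerm w.1 g ∧
      (h₁ (s, 0)).1 = tensorSection T (ξ.coord j) a (cauchyTransform (w - (c j).lift g).1)) ∧
  ∀ z : ℂ, h₁ (0, z) = 0

end Retract

/-- The pushforward to the surface: the sections over `U ⊆ M` are the sections over the preimage of
`U` in the orientation double. -/
def pushforwardComplex [HasGroupoid M conformalGroupoid]
    {F : Type u} [NormedAddCommGroup F] [NormedSpace ℂ F]
    {L : Double M → Type u} [TopologicalSpace (TotalSpace F L)] [∀ x, AddCommGroup (L x)]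
    [∀ x, Module ℂ (L x)] [∀ x, TopologicalSpace (L x)] [FiberBundle F L] [VectorBundle ℂ F L]
    [ContMDiffVectorBundle ω F L 𝓘(ℂ, ℂ)] {b : DGLieBracket F L} (α : TwoCocycle b) (U : Set M) :
    PointedComplex.{u} :=
  twistedComplex α (Double.proj ⁻¹' U)

end CFT

end


/-!
The Cauchy transform inverts `∂̄` on compactly supported functions in the plane. Hence, for a
bounded open `W ⊆ ℂ` and a compactly supported form `ω` on `W`, the germ of `ω^↓` at `Wᶜ` vanishes
exactly when `ω^↓` is compactly supported in `W`, and then `ω^↓` is the only compactly supported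
primitive of `ω`. For a germ `f` the function `(1 - ρ) f` decays at infinity and satisfies
`∂̄ ((1 - ρ) f) = -f ∂̄ρ`, so it is the Cauchy transform of `⌈f⌉`, and `⌈f⌉^↓` has germ `f`. This
makes `⌈·⌉`, `↓` and `ω ↦ (ω - ⌈ω^↓⌉)^↓` a strong deformation retract of
`∂̄ : Ω^0_c(W) → Ω^{0,1}_c(W)` onto `𝒪_∞(Wᶜ)`. Such retracts survive tensoring with `𝔞`, products
over the components, and the direct sum with `ℂ 𝟏`, and the frame trivialisations transport the
result to the sections and forms over the union of the coordinate domains.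
-/

noncomputable section

namespace CFT

/-! ## The Cauchy transform in the plane -/

section CauchyTransform

open MeasureTheory
open scoped Convolution

theorem locallyIntegrable_inv : LocallyIntegrable (fun z : ℂ => z⁻¹) :=
  locallyIntegrable_of_norm_le_rpow (C := 1) (α := 1) (by simp) (by simp)
    (Eventually.of_forall fun z => by simp [Real.rpow_neg_one])
    measurable_inv.aestronglyMeasurable

/-- The kernel `1 / (π t)`, convolution with which is the Cauchy transform. -/
def cauchyKernel (t : ℂ) : ℂ := (Real.pi : ℂ)⁻¹ * t⁻¹

theorem locallyIntegrable_cauchyKernel : LocallyIntegrable cauchyKernel :=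
  locallyIntegrable_inv.smul ((Real.pi : ℂ)⁻¹)

theorem cauchyTransform_eq_convolution (w : ℂ → ℂ) :
    cauchyTransform w = cauchyKernel ⋆[ContinuousLinearMap.mul ℝ ℂ, volume] w := by
  funext l
  change _ = ∫ t : ℂ, cauchyKernel t * w (l - t)
  unfold cauchyTransform cauchyKernel
  rw [← integral_sub_left_eq_self _ volume l, ← integral_const_mul]
  congr 1
  funext t
  rcases eq_or_ne t 0 with rfl | ht
  · simp
  · rw [show l - t - l = -t by ring]
    field_simp [Complex.I_ne_zero]

theorem cauchyTransform_apply (w : ℂ → ℂ) (l : ℂ) :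
    cauchyTransform w l = ∫ t : ℂ, cauchyKernel t * w (l - t) :=
  congrFun (cauchyTransform_eq_convolution w) l

theorem contDiff_cauchyTransform {n : ℕ∞} {w : ℂ → ℂ} (hw : ContDiff ℝ n w)
    (hc : HasCompactSupport w) : ContDiff ℝ n (cauchyTransform w) := by
  rw [cauchyTransform_eq_convolution]
  exact hc.contDiff_convolution_right _ locallyIntegrable_cauchyKernel hw

theorem integrable_cauchyKernel_mul {w : ℂ → ℂ} (hw : Continuous w) (hc : HasCompactSupport w)
    (l : ℂ) : Integrable fun t => cauchyKernel t * w (l - t) :=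
  hc.convolutionExists_right (ContinuousLinearMap.mul ℝ ℂ) locallyIntegrable_cauchyKernel hw l

theorem cauchyTransform_add {v w : ℂ → ℂ} (hv : Continuous v) (hv' : HasCompactSupport v)
    (hw : Continuous w) (hw' : HasCompactSupport w) :
    cauchyTransform (v + w) = cauchyTransform v + cauchyTransform w := by
  funext l
  rw [Pi.add_apply, cauchyTransform_apply, cauchyTransform_apply, cauchyTransform_apply,
    ← integral_add (integrable_cauchyKernel_mul hv hv' l) (integrable_cauchyKernel_mul hw hw' l)]
  simp only [Pi.add_apply, mul_add]

theorem cauchyTransform_smul (c : ℂ) (w : ℂ → ℂ) :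
    cauchyTransform (c • w) = c • cauchyTransform w := by
  funext l
  rw [Pi.smul_apply, cauchyTransform_apply, cauchyTransform_apply, smul_eq_mul,
    ← integral_const_mul]
  simp only [Pi.smul_apply, smul_eq_mul, mul_left_comm]

theorem tendsto_cauchyTransform_cocompact {w : ℂ → ℂ} (hw : Continuous w)
    (hc : HasCompactSupport w) : Tendsto (cauchyTransform w) (cocompact ℂ) (𝓝 0) := by
  obtain ⟨R, hR⟩ := hc.isCompact.isBounded.subset_closedBall (0 : ℂ)
  have hi : Integrable w := hw.integrable_of_hasCompactSupport hc
  have hbound : ∀ l : ℂ, R < ‖l‖ → ‖cauchyTransform w l‖ ≤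
      ‖(2 * Real.pi * Complex.I)⁻¹‖ * (2 * ((∫ μ, ‖w μ‖) / (‖l‖ - R))) := by
    intro l hl
    have : 0 < ‖l‖ - R := by linarith
    unfold cauchyTransform
    rw [norm_mul, integral_const_mul, norm_mul, show ‖(-2 * Complex.I : ℂ)‖ = 2 by simp]
    gcongr
    rw [← integral_div]
    refine norm_integral_le_of_norm_le (hi.norm.div_const _) (Eventually.of_forall fun μ => ?_)
    by_cases hμ : w μ = 0
    · simp [hμ]
    · have hμR : ‖μ‖ ≤ R := by simpa using hR (subset_tsupport w hμ)
      have hdist : ‖l‖ - R ≤ ‖μ - l‖ := by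
        linarith [norm_sub_norm_le l μ, norm_sub_rev l μ]
      rw [norm_div]
      gcongr
  have hfar : ∀ᶠ l in cocompact ℂ, R < ‖l‖ :=
    (tendsto_norm_cocompact_atTop).eventually (eventually_gt_atTop R)
  refine squeeze_zero_norm' (hfar.mono hbound) ?_
  have hlim : Tendsto (fun l : ℂ => (∫ μ, ‖w μ‖) / (‖l‖ - R)) (cocompact ℂ) (𝓝 0) :=
    Tendsto.const_div_atTop (tendsto_atTop_add_const_right _ (-R) tendsto_norm_cocompact_atTop) _
  simpa using (hlim.const_mul 2).const_mul ‖(2 * Real.pi * Complex.I : ℂ)⁻¹‖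

end CauchyTransform

section PlaneDbar

open MeasureTheory

theorem planeDbar_apply (u : ℂ → ℂ) (z : ℂ) :
    planeDbar u z = (1 / 2 : ℂ) * (fderiv ℝ u z 1 + Complex.I * fderiv ℝ u z Complex.I) := by
  simp [planeDbar, antilinearPart]

theorem planeDbar_add {u v : ℂ → ℂ} (hu : Differentiable ℝ u) (hv : Differentiable ℝ v) :
    planeDbar (u + v) = planeDbar u + planeDbar v := by
  funext z
  simp only [Pi.add_apply, planeDbar_apply, fderiv_add (hu z) (hv z), _root_.add_apply]
  ring

theorem planeDbar_smul {u : ℂ → ℂ} (hu : Differentiable ℝ u) (a : ℂ) :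
    planeDbar (a • u) = a • planeDbar u := by
  funext z
  simp only [Pi.smul_apply, planeDbar_apply, fderiv_const_smul (hu z), _root_.smul_apply,
    smul_eq_mul]
  ring

theorem planeDbar_const_sub (u : ℂ → ℂ) (a z : ℂ) :
    planeDbar (fun y => a - u y) z = -planeDbar u z := by
  simp only [planeDbar_apply, fderiv_const_sub, _root_.neg_apply]
  ring

theorem planeDbar_mul_of_differentiableAt {f g : ℂ → ℂ} {z : ℂ} (hf : DifferentiableAt ℂ f z)
    (hg : DifferentiableAt ℝ g z) :
    planeDbar (fun y => f y * g y) z = f z * planeDbar g z := by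
  have hCR := (differentiableAt_complex_iff_differentiableAt_real.1 hf).2
  rw [planeDbar_apply, planeDbar_apply, fderiv_fun_mul (hf.restrictScalars ℝ) hg]
  simp only [_root_.add_apply, _root_.smul_apply, smul_eq_mul, hCR]
  linear_combination (1 / 2 * g z * fderiv ℝ f z 1) * Complex.I_mul_I

theorem differentiableAt_of_planeDbar_eq_zero {u : ℂ → ℂ} {z : ℂ} (hu : DifferentiableAt ℝ u z)
    (h : planeDbar u z = 0) : DifferentiableAt ℂ u z := by
  refine differentiableAt_complex_iff_differentiableAt_real.2 ⟨hu, ?_⟩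
  rw [planeDbar_apply] at h
  rw [smul_eq_mul]
  linear_combination (-2 * Complex.I) * h + fderiv ℝ u z Complex.I * Complex.I_mul_I

theorem planeDbar_const_sub_comp {u : ℂ → ℂ} {l t : ℂ} (hu : DifferentiableAt ℝ u (l - t)) :
    planeDbar (fun s => u (l - s)) t = -planeDbar u (l - t) := by
  have h : HasFDerivAt (fun s => u (l - s))
      ((fderiv ℝ u (l - t)).comp (-ContinuousLinearMap.id ℝ ℂ)) t :=
    hu.hasFDerivAt.comp t ((hasFDerivAt_id t).const_sub l)
  rw [planeDbar_apply, planeDbar_apply, h.fderiv]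
  simp only [ContinuousLinearMap.comp_apply, _root_.neg_apply, ContinuousLinearMap.id_apply,
    map_neg]
  ring

theorem support_planeDbar_subset (u : ℂ → ℂ) :
    Function.support (planeDbar u) ⊆ Function.support (fderiv ℝ u) :=
  fun z hz hz' => hz (by simp [planeDbar_apply, hz'])

theorem hasCompactSupport_planeDbar {u : ℂ → ℂ} (hc : HasCompactSupport u) :
    HasCompactSupport (planeDbar u) :=
  (hc.fderiv ℝ).mono (support_planeDbar_subset u)

theorem tsupport_planeDbar_subset (u : ℂ → ℂ) : tsupport (planeDbar u) ⊆ tsupport u :=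
  (closure_mono (support_planeDbar_subset u)).trans (tsupport_fderiv_subset ℝ)

theorem fderiv_cauchyTransform {w : ℂ → ℂ} (hw : ContDiff ℝ 1 w) (hc : HasCompactSupport w)
    (l v : ℂ) : fderiv ℝ (cauchyTransform w) l v =
      ∫ t : ℂ, cauchyKernel t * fderiv ℝ w (l - t) v := by
  have h := hc.hasFDerivAt_convolution_right (ContinuousLinearMap.mul ℝ ℂ)
    locallyIntegrable_cauchyKernel hw l
  rw [← cauchyTransform_eq_convolution] at h
  have hi := (hc.fderiv ℝ).convolutionExists_right
    ((ContinuousLinearMap.mul ℝ ℂ).precompR ℂ) (μ := volume)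
    locallyIntegrable_cauchyKernel (hw.continuous_fderiv one_ne_zero) l
  rw [h.fderiv, convolution, ContinuousLinearMap.integral_apply hi]
  rfl

theorem planeDbar_cauchyTransform_comm {w : ℂ → ℂ} (hw : ContDiff ℝ 1 w)
    (hc : HasCompactSupport w) :
    planeDbar (cauchyTransform w) = cauchyTransform (planeDbar w) := by
  funext l
  have hi : ∀ v : ℂ, Integrable fun t => cauchyKernel t * fderiv ℝ w (l - t) v := fun v =>
    integrable_cauchyKernel_mul (w := fun z => fderiv ℝ w z v)
      ((hw.continuous_fderiv one_ne_zero).clm_apply continuous_const) (hc.fderiv_apply ℝ v) l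
  rw [planeDbar_apply, fderiv_cauchyTransform hw hc, fderiv_cauchyTransform hw hc,
    cauchyTransform_apply, ← integral_const_mul, ← integral_add (hi _) ((hi _).const_mul _),
    ← integral_const_mul]
  congr 1
  funext t
  rw [planeDbar_apply]
  ring

end PlaneDbar

section CauchyPompeiu

open MeasureTheory

theorem hasDerivAt_circleMap_radius (r θ : ℝ) :
    HasDerivAt (fun s : ℝ => circleMap 0 s θ) (circleMap 0 1 θ) r := by
  simpa [circleMap] using
    (Complex.ofRealCLM.hasDerivAt (x := r)).mul_const (Complex.exp (θ * Complex.I))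

theorem isClosedEmbedding_circleMap_radius (θ : ℝ) :
    IsClosedEmbedding fun r : ℝ => circleMap 0 r θ := by
  refine (Isometry.of_dist_eq fun r s => ?_).isClosedEmbedding
  rw [dist_eq_norm, dist_eq_norm, circleMap_zero, circleMap_zero, ← sub_mul, norm_mul,
    Complex.norm_exp_ofReal_mul_I, mul_one, ← Complex.ofReal_sub, Complex.norm_real]

theorem integrableOn_polarCoord_target {E : Type*} [NormedAddCommGroup E] {h : ℝ × ℝ → E}
    (hh : Continuous h) {R : ℝ} (hR : ∀ p : ℝ × ℝ, R < p.1 → h p = 0) :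
    IntegrableOn h polarCoord.target := by
  have hbox : IntegrableOn h (Icc 0 R ×ˢ Icc (-Real.pi) Real.pi) :=
    hh.continuousOn.integrableOn_compact (isCompact_Icc.prod isCompact_Icc)
  refine hbox.of_forall_sdiff_eq_zero polarCoord.open_target.measurableSet ?_
  rintro p ⟨⟨hp1, hp2⟩, hp⟩
  exact hR p (not_le.1 fun hle => hp ⟨⟨(mem_Ioi.1 hp1).le, hle⟩, hp2.1.le, hp2.2.le⟩)

section Polar

variable {E : Type*} [NormedAddCommGroup E] [NormedSpace ℝ E] {g : ℂ → E}

theorem continuous_fderiv_circleMap_apply (hg : ContDiff ℝ 1 g) {v : ℝ → ℂ} (hv : Continuous v) :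
    Continuous fun p : ℝ × ℝ => fderiv ℝ g (circleMap 0 p.1 p.2) (v p.2) := by
  have hpolar : Continuous fun p : ℝ × ℝ => circleMap 0 p.1 p.2 := by
    simp only [circleMap_zero]
    fun_prop
  exact ((hg.continuous_fderiv one_ne_zero).comp hpolar).clm_apply (hv.comp continuous_snd)

theorem integrableOn_fderiv_circleMap_apply (hg : ContDiff ℝ 1 g) (hc : HasCompactSupport g)
    {v : ℝ → ℂ} (hv : Continuous v) :
    IntegrableOn (fun p : ℝ × ℝ => fderiv ℝ g (circleMap 0 p.1 p.2) (v p.2))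
      polarCoord.target := by
  obtain ⟨R, hR⟩ := (hc.fderiv ℝ).isCompact.isBounded.subset_closedBall (0 : ℂ)
  refine integrableOn_polarCoord_target (continuous_fderiv_circleMap_apply hg hv) (R := R)
    fun p hp => ?_
  rw [image_eq_zero_of_notMem_tsupport (f := fderiv ℝ g) fun hz => ?_, _root_.zero_apply]
  have hle := mem_closedBall_zero_iff.1 (hR hz)
  rw [norm_circleMap_zero] at hle
  exact (hp.trans_le (le_abs_self _)).not_ge hle

theorem integral_Ioi_fderiv_circleMap [CompleteSpace E] (hg : ContDiff ℝ 1 g)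
    (hc : HasCompactSupport g) (θ : ℝ) :
    ∫ r in Ioi (0 : ℝ), fderiv ℝ g (circleMap 0 r θ) (circleMap 0 1 θ) = -g 0 := by
  have hderiv : ∀ r : ℝ, deriv (fun s : ℝ => g (circleMap 0 s θ)) r =
      fderiv ℝ g (circleMap 0 r θ) (circleMap 0 1 θ) := fun r =>
    (((hg.differentiable one_ne_zero _).hasFDerivAt).comp_hasDerivAt r
      (hasDerivAt_circleMap_radius r θ)).deriv
  have hsmooth : ContDiff ℝ 1 fun s : ℝ => g (circleMap 0 s θ) := by
    refine hg.comp ?_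
    simp only [circleMap_zero]
    exact Complex.ofRealCLM.contDiff.mul contDiff_const
  have h := HasCompactSupport.integral_Ioi_deriv_eq hsmooth
    (hc.comp_isClosedEmbedding (isClosedEmbedding_circleMap_radius θ)) 0
  simpa [hderiv] using h

theorem integral_fderiv_circleMap [CompleteSpace E] (hg : ContDiff ℝ 1 g) {r : ℝ} (hr : r ≠ 0) :
    ∫ θ in -Real.pi..Real.pi, fderiv ℝ g (circleMap 0 r θ) (circleMap 0 1 θ * Complex.I) = 0 := by
  have hderiv : ∀ θ : ℝ, HasDerivAt (fun θ : ℝ => g (circleMap 0 r θ))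
      (r • fderiv ℝ g (circleMap 0 r θ) (circleMap 0 1 θ * Complex.I)) θ := fun θ => by
    refine (((hg.differentiable one_ne_zero _).hasFDerivAt).comp_hasDerivAt θ
      (hasDerivAt_circleMap 0 r θ)).congr_deriv ?_
    rw [← map_smul, Complex.real_smul, ← mul_assoc]
    simp [circleMap]
  have hcont : Continuous fun θ : ℝ =>
      r • fderiv ℝ g (circleMap 0 r θ) (circleMap 0 1 θ * Complex.I) :=
    ((continuous_fderiv_circleMap_apply hg (v := fun θ => circleMap 0 1 θ * Complex.I)
      (by fun_prop)).comp (Continuous.prodMk_right r)).const_smul r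
  have h := intervalIntegral.integral_eq_sub_of_hasDerivAt (a := -Real.pi) (b := Real.pi)
    (fun θ _ => hderiv θ) (hcont.intervalIntegrable _ _)
  have hends : circleMap 0 r Real.pi = circleMap 0 r (-Real.pi) := by simp [circleMap]
  rw [intervalIntegral.integral_smul, hends, sub_self] at h
  exact (smul_eq_zero.1 h).resolve_left hr

theorem integral_polarCoord_target_fderiv_radial [CompleteSpace E] (hg : ContDiff ℝ 1 g)
    (hc : HasCompactSupport g) :
    ∫ p in polarCoord.target, fderiv ℝ g (circleMap 0 p.1 p.2) (circleMap 0 1 p.2) =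
      -((2 * Real.pi) • g 0) := by
  have hi := integrableOn_fderiv_circleMap_apply hg hc (continuous_circleMap 0 1)
  rw [polarCoord_target, Measure.volume_eq_prod] at hi ⊢
  rw [setIntegral_prod _ hi, integral_integral_swap
    (f := fun r θ => fderiv ℝ g (circleMap 0 r θ) (circleMap 0 1 θ))
    (by rw [Measure.prod_restrict]; exact hi)]
  simp only [integral_Ioi_fderiv_circleMap hg hc, setIntegral_const, Measure.real,
    Real.volume_Ioo, sub_neg_eq_add, ← two_mul, smul_neg]
  rw [ENNReal.toReal_ofReal Real.two_pi_pos.le]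

theorem integral_polarCoord_target_fderiv_angular [CompleteSpace E] (hg : ContDiff ℝ 1 g)
    (hc : HasCompactSupport g) :
    ∫ p in polarCoord.target,
      fderiv ℝ g (circleMap 0 p.1 p.2) (circleMap 0 1 p.2 * Complex.I) = 0 := by
  have hi := integrableOn_fderiv_circleMap_apply hg hc
    (v := fun θ => circleMap 0 1 θ * Complex.I) (by fun_prop)
  rw [polarCoord_target, Measure.volume_eq_prod] at hi ⊢
  rw [setIntegral_prod _ hi]
  refine setIntegral_eq_zero_of_forall_eq_zero fun r hr => ?_
  rw [← integral_Ioc_eq_integral_Ioo,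
    ← intervalIntegral.integral_of_le (by linarith [Real.pi_pos])]
  exact integral_fderiv_circleMap hg (ne_of_gt hr)

end Polar

theorem smul_inv_mul_planeDbar_circleMap (g : ℂ → ℂ) {r : ℝ} (hr : r ≠ 0) (θ : ℝ) :
    r • ((circleMap 0 r θ)⁻¹ * planeDbar g (circleMap 0 r θ)) =
      (1 / 2 : ℂ) * (fderiv ℝ g (circleMap 0 r θ) (circleMap 0 1 θ) +
        Complex.I * fderiv ℝ g (circleMap 0 r θ) (circleMap 0 1 θ * Complex.I)) := by
  have hinv : r • (circleMap 0 r θ)⁻¹ = conj (circleMap 0 1 θ) := by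
    rw [circleMap_zero_inv, conj_circleMap_zero, Complex.real_smul, circleMap_zero,
      circleMap_zero, ← mul_assoc]
    simp [hr]
  rw [← smul_mul_assoc, hinv, planeDbar, ← smul_eq_mul (conj _), ← antilinearPart_eq,
    mul_comm _ Complex.I]
  rfl

theorem integral_inv_mul_planeDbar {g : ℂ → ℂ} (hg : ContDiff ℝ 1 g) (hc : HasCompactSupport g) :
    ∫ t : ℂ, t⁻¹ * planeDbar g t = -(Real.pi * g 0) := by
  have hradial := integrableOn_fderiv_circleMap_apply hg hc (continuous_circleMap 0 1)
  have hangular := integrableOn_fderiv_circleMap_apply hg hc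
    (v := fun θ => circleMap 0 1 θ * Complex.I) (by fun_prop)
  have hpolar : ∀ p ∈ polarCoord.target, p.1 • ((Complex.polarCoord.symm p)⁻¹ *
      planeDbar g (Complex.polarCoord.symm p)) =
        (1 / 2 : ℂ) * (fderiv ℝ g (circleMap 0 p.1 p.2) (circleMap 0 1 p.2) +
          Complex.I * fderiv ℝ g (circleMap 0 p.1 p.2) (circleMap 0 1 p.2 * Complex.I)) :=
    fun p hp => by
      rw [show Complex.polarCoord.symm p = circleMap 0 p.1 p.2 by
        simp [circleMap_zero, Complex.exp_mul_I]]
      exact smul_inv_mul_planeDbar_circleMap g (ne_of_gt hp.1) p.2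
  rw [← Complex.integral_comp_polarCoord_symm,
    setIntegral_congr_fun polarCoord.open_target.measurableSet hpolar, integral_const_mul,
    integral_add hradial (hangular.const_mul _), integral_const_mul,
    integral_polarCoord_target_fderiv_radial hg hc, integral_polarCoord_target_fderiv_angular hg hc]
  simp only [Complex.real_smul, Complex.ofReal_mul, Complex.ofReal_ofNat]
  ring

theorem cauchyTransform_planeDbar {u : ℂ → ℂ} (hu : ContDiff ℝ 1 u) (hc : HasCompactSupport u) :
    cauchyTransform (planeDbar u) = u := by
  funext l
  have h := integral_inv_mul_planeDbar (hu.comp (contDiff_const.sub contDiff_id))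
    (hc.comp_homeomorph (Homeomorph.subLeft l))
  simp only [Function.comp_def, id, planeDbar_const_sub_comp (hu.differentiable one_ne_zero _),
    sub_zero, mul_neg, integral_neg, neg_inj] at h
  simp only [cauchyTransform_apply, cauchyKernel, mul_assoc, integral_const_mul, h]
  rw [inv_mul_cancel_left₀ (by exact_mod_cast Real.pi_ne_zero)]

theorem planeDbar_cauchyTransform {w : ℂ → ℂ} (hw : ContDiff ℝ 1 w) (hc : HasCompactSupport w) :
    planeDbar (cauchyTransform w) = w := by
  rw [planeDbar_cauchyTransform_comm hw hc, cauchyTransform_planeDbar hw hc]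

theorem differentiable_cauchyTransform {w : ℂ → ℂ} (hw : ContDiff ℝ 1 w)
    (hc : HasCompactSupport w) : Differentiable ℝ (cauchyTransform w) :=
  (contDiff_cauchyTransform hw hc).differentiable one_ne_zero

/- The difference of two solutions of `∂̄u = w` that vanish at infinity is entire, hence `0` by
Liouville's theorem. -/
theorem cauchyTransform_eq_of_planeDbar_eq {u w : ℂ → ℂ} (hw : ContDiff ℝ 1 w)
    (hc : HasCompactSupport w) (hu : Differentiable ℝ u) (hu0 : Tendsto u (cocompact ℂ) (𝓝 0))
    (h : planeDbar u = w) : cauchyTransform w = u := by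
  have hC := differentiable_cauchyTransform hw hc
  have hdbar : planeDbar (cauchyTransform w + (-1 : ℂ) • u) = 0 := by
    rw [planeDbar_add hC (hu.const_smul _), planeDbar_smul hu, planeDbar_cauchyTransform hw hc, h,
      neg_one_smul, add_neg_cancel]
  have hentire : Differentiable ℂ (cauchyTransform w + (-1 : ℂ) • u) := fun z =>
    differentiableAt_of_planeDbar_eq_zero (hC.add (hu.const_smul _) z) (congrFun hdbar z)
  have hlim : Tendsto (cauchyTransform w + (-1 : ℂ) • u) (cocompact ℂ) (𝓝 0) := by
    have h0 := (tendsto_cauchyTransform_cocompact hw.continuous hc).add (hu0.const_smul (-1 : ℂ))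
    rwa [smul_zero, add_zero] at h0
  funext z
  have hz := hentire.apply_eq_of_tendsto_cocompact z hlim
  simpa [← sub_eq_add_neg, sub_eq_zero] using hz

theorem analyticAt_cauchyTransform {w : ℂ → ℂ} (hw : ContDiff ℝ 1 w) (hc : HasCompactSupport w)
    {z : ℂ} (hz : z ∉ tsupport w) : AnalyticAt ℂ (cauchyTransform w) z := by
  rw [Complex.analyticAt_iff_eventually_differentiableAt]
  filter_upwards [(isClosed_tsupport w).isOpen_compl.mem_nhds hz] with y hy
  refine differentiableAt_of_planeDbar_eq_zero (differentiable_cauchyTransform hw hc y) ?_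
  rw [planeDbar_cauchyTransform hw hc]
  exact image_eq_zero_of_notMem_tsupport hy

end CauchyPompeiu

/-! ## Two-term retracts -/

section TwoTermRetract

/-- A strong deformation retract of the two-term complex `d : A → B` onto a module `G` placed in
degree `1`, with inclusion `i`, projection `p` and contraction `h`. The remaining identities
`p d = 0` and `h i = 0` follow. -/
structure IsTwoTermRetract {R A B G : Type*} [CommRing R] [AddCommGroup A] [AddCommGroup B]
    [AddCommGroup G] [Module R A] [Module R B] [Module R G] (d : A →ₗ[R] B) (i : G →ₗ[R] B)
    (p : B →ₗ[R] G) (h : B →ₗ[R] A) : Prop where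
  proj_comp_incl : p ∘ₗ i = LinearMap.id
  diff_comp_contr : d ∘ₗ h = LinearMap.id - i ∘ₗ p
  contr_comp_diff : h ∘ₗ d = LinearMap.id

namespace IsTwoTermRetract

variable {R A B G : Type*} [CommRing R] [AddCommGroup A] [AddCommGroup B] [AddCommGroup G]
  [Module R A] [Module R B] [Module R G] {d : A →ₗ[R] B} {i : G →ₗ[R] B} {p : B →ₗ[R] G}
  {h : B →ₗ[R] A}

theorem proj_incl (H : IsTwoTermRetract d i p h) (x : G) : p (i x) = x :=
  LinearMap.congr_fun H.proj_comp_incl x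

theorem diff_contr (H : IsTwoTermRetract d i p h) (y : B) : d (h y) = y - i (p y) :=
  LinearMap.congr_fun H.diff_comp_contr y

theorem contr_diff (H : IsTwoTermRetract d i p h) (x : A) : h (d x) = x :=
  LinearMap.congr_fun H.contr_comp_diff x

theorem proj_diff (H : IsTwoTermRetract d i p h) (x : A) : p (d x) = 0 := by
  have hip : i (p (d x)) = 0 := by
    rw [← sub_eq_self (a := d x), ← H.diff_contr, H.contr_diff]
  rw [← H.proj_incl (p (d x)), hip, map_zero]

theorem contr_incl (H : IsTwoTermRetract d i p h) (x : G) : h (i x) = 0 := by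
  have hdh : d (h (i x)) = 0 := by rw [H.diff_contr, H.proj_incl, sub_self]
  rw [← H.contr_diff (h (i x)), hdh, map_zero]

theorem lTensor (H : IsTwoTermRetract d i p h) (M : Type*) [AddCommGroup M] [Module R M] :
    IsTwoTermRetract (d.lTensor M) (i.lTensor M) (p.lTensor M) (h.lTensor M) where
  proj_comp_incl := by rw [← LinearMap.lTensor_comp, H.proj_comp_incl, LinearMap.lTensor_id]
  diff_comp_contr := by
    rw [← LinearMap.lTensor_comp, H.diff_comp_contr, LinearMap.lTensor_sub, LinearMap.lTensor_id,
      LinearMap.lTensor_comp]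
  contr_comp_diff := by rw [← LinearMap.lTensor_comp, H.contr_comp_diff, LinearMap.lTensor_id]

theorem piMap {J : Type*} {A B G : J → Type*} [∀ j, AddCommGroup (A j)]
    [∀ j, AddCommGroup (B j)] [∀ j, AddCommGroup (G j)] [∀ j, Module R (A j)]
    [∀ j, Module R (B j)] [∀ j, Module R (G j)] {d : ∀ j, A j →ₗ[R] B j}
    {i : ∀ j, G j →ₗ[R] B j} {p : ∀ j, B j →ₗ[R] G j} {h : ∀ j, B j →ₗ[R] A j}
    (H : ∀ j, IsTwoTermRetract (d j) (i j) (p j) (h j)) :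
    IsTwoTermRetract (LinearMap.piMap d) (LinearMap.piMap i) (LinearMap.piMap p)
      (LinearMap.piMap h) where
  proj_comp_incl := LinearMap.ext fun x => funext fun j => (H j).proj_incl (x j)
  diff_comp_contr := LinearMap.ext fun y => funext fun j => (H j).diff_contr (y j)
  contr_comp_diff := LinearMap.ext fun x => funext fun j => (H j).contr_diff (x j)

theorem prodRight (H : IsTwoTermRetract d i p h) (M : Type*) [AddCommGroup M] [Module R M] :
    IsTwoTermRetract (LinearMap.inl R B M ∘ₗ d) (i.prodMap (LinearMap.id : M →ₗ[R] M))
      (p.prodMap LinearMap.id) (h ∘ₗ LinearMap.fst R B M) where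
  proj_comp_incl := by
    rw [LinearMap.prodMap_comp, H.proj_comp_incl, LinearMap.id_comp, LinearMap.prodMap_id]
  diff_comp_contr := LinearMap.ext fun y => Prod.ext (by simp [H.diff_contr]) (by simp)
  contr_comp_diff := LinearMap.ext fun x => by simp [H.contr_diff]

theorem congr (H : IsTwoTermRetract d i p h) {A' B' : Type*} [AddCommGroup A'] [AddCommGroup B']
    [Module R A'] [Module R B'] {d' : A' →ₗ[R] B'} (e₀ : A ≃ₗ[R] A') (e₁ : B ≃ₗ[R] B')
    (hd : ∀ x, d' (e₀ x) = e₁ (d x)) :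
    IsTwoTermRetract d' (e₁ ∘ₗ i) (p ∘ₗ e₁.symm) (e₀ ∘ₗ h ∘ₗ e₁.symm) where
  proj_comp_incl := LinearMap.ext fun x => by simp [H.proj_incl]
  diff_comp_contr := LinearMap.ext fun y => by simp [hd, H.diff_contr]
  contr_comp_diff := LinearMap.ext fun x => by
    obtain ⟨x, rfl⟩ := e₀.surjective x
    simp [hd, H.contr_diff]

end IsTwoTermRetract

end TwoTermRetract

/-! ## The retract on the plane -/

section PlaneRetract

theorem extendZero_coe (f : ℂ → ℂ) (z : ℂ) : extendZero f (z : OnePoint ℂ) = f z := rfl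

theorem extendZero_infty (f : ℂ → ℂ) : extendZero f OnePoint.infty = 0 := rfl

theorem extendZero_comp_coe {f : OnePoint ℂ → ℂ} (h : f OnePoint.infty = 0) :
    extendZero (fun z : ℂ => f z) = f := by
  funext x
  cases x with
  | infty => exact h.symm
  | coe z => rfl

theorem extendZero_add (f g : ℂ → ℂ) : extendZero (f + g) = extendZero f + extendZero g := by
  funext x
  cases x with
  | infty => simp [extendZero_infty]
  | coe z => rfl

theorem extendZero_smul (c : ℂ) (f : ℂ → ℂ) : extendZero (c • f) = c • extendZero f := by
  funext x
  cases x with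
  | infty => simp [extendZero_infty]
  | coe z => rfl

theorem isOpen_sphereCompl {K : Set ℂ} (hK : IsCompact K) : IsOpen (sphereCompl K) :=
  (hK.image OnePoint.continuous_coe).isClosed.isOpen_compl

theorem coe_mem_sphereCompl {S : Set ℂ} {z : ℂ} : (z : OnePoint ℂ) ∈ sphereCompl S ↔ z ∉ S :=
  not_congr OnePoint.coe_injective.mem_set_image

theorem infty_mem_sphereCompl (S : Set ℂ) : OnePoint.infty ∈ sphereCompl S :=
  OnePoint.infty_notMem_image_coe

theorem sphereHolAt_infty_of_tendsto {f : ℂ → ℂ} (h0 : Tendsto f (cocompact ℂ) (𝓝 0))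
    (hd : ∀ᶠ z in cocompact ℂ, DifferentiableAt ℂ f z) :
    SphereHolAt (extendZero f) OnePoint.infty := by
  refine ⟨fun z hz => absurd hz (OnePoint.infty_ne_coe z), fun _ => ?_⟩
  have hinv : Tendsto (fun w : ℂ => w⁻¹) (𝓝[≠] 0) (cocompact ℂ) := by
    rw [← Metric.cobounded_eq_cocompact]
    exact tendsto_inv₀_nhdsNE_zero
  have heq : ∀ w : ℂ, w ≠ 0 → extendZero f
      (if w = 0 then OnePoint.infty else ((w⁻¹ : ℂ) : OnePoint ℂ)) = f w⁻¹ := fun w hw => by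
    rw [if_neg hw, extendZero_coe]
  refine Complex.analyticAt_of_differentiable_on_punctured_nhds_of_continuousAt ?_ ?_
  · filter_upwards [hinv.eventually hd, self_mem_nhdsWithin] with w hw (hw0 : w ≠ 0)
    refine (hw.comp w (differentiableAt_inv hw0)).congr_of_eventuallyEq ?_
    filter_upwards [isOpen_ne.mem_nhds hw0] with y hy
    exact heq y hy
  · rw [continuousAt_iff_punctured_nhds]
    simp only [if_true, extendZero_infty]
    refine (h0.comp hinv).congr' ?_
    filter_upwards [self_mem_nhdsWithin] with w hw
    exact (heq w hw).symm

theorem tendsto_cocompact_of_sphereHolAt {f : OnePoint ℂ → ℂ} (h : SphereHolAt f OnePoint.infty)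
    (h0 : f OnePoint.infty = 0) : Tendsto (fun z : ℂ => f z) (cocompact ℂ) (𝓝 0) := by
  have hc := (h.2 rfl).continuousAt.tendsto
  simp only [if_true, h0] at hc
  have hinv : Tendsto (fun w : ℂ => w⁻¹) (cocompact ℂ) (𝓝 0) := by
    rw [← Metric.cobounded_eq_cocompact]
    exact tendsto_inv₀_cobounded
  refine (hc.comp hinv).congr' ?_
  filter_upwards [(isCompact_singleton (x := (0 : ℂ))).compl_mem_cocompact] with z (hz : z ≠ 0)
  simp [hz]

/-- The germ at `sphereCompl W` of the extension by zero of a function on the plane. -/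
def sphereGerm (W : Set ℂ) (u : ℂ → ℂ) : Filter.Germ (𝓝ˢ (sphereCompl W)) ℂ :=
  (extendZero u : OnePoint ℂ → ℂ)

variable {W : Set ℂ}

theorem sphereGerm_add (u v : ℂ → ℂ) : sphereGerm W (u + v) = sphereGerm W u + sphereGerm W v := by
  rw [sphereGerm, extendZero_add]
  rfl

theorem sphereGerm_smul (a : ℂ) (u : ℂ → ℂ) : sphereGerm W (a • u) = a • sphereGerm W u := by
  rw [sphereGerm, extendZero_smul]
  rfl

theorem sphereGerm_eq_zero {u : ℂ → ℂ} (hc : HasCompactSupport u) (hs : tsupport u ⊆ W) :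
    sphereGerm W u = 0 := by
  refine Filter.Germ.coe_eq.2 (mem_of_superset ((isOpen_sphereCompl hc).mem_nhdsSet.2
    (compl_subset_compl.2 (image_mono hs))) fun x hx => ?_)
  cases x with
  | infty => rfl
  | coe z => exact image_eq_zero_of_notMem_tsupport (f := u) (coe_mem_sphereCompl.1 hx)

theorem hasCompactSupport_of_sphereGerm_eq_zero {u : ℂ → ℂ} (h : sphereGerm W u = 0) :
    HasCompactSupport u ∧ tsupport u ⊆ W := by
  obtain ⟨O, hO, hWO, hzero⟩ := mem_nhdsSet_iff_exists.1 (Filter.Germ.coe_eq.1 h)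
  have hrange : Oᶜ ⊆ range ((↑) : ℂ → OnePoint ℂ) := fun x hx => by
    cases x with
    | infty => exact absurd (hWO (infty_mem_sphereCompl W)) hx
    | coe z => exact ⟨z, rfl⟩
  have hK : IsCompact ((fun z : ℂ => (z : OnePoint ℂ)) ⁻¹' Oᶜ) :=
    (OnePoint.isOpenEmbedding_coe.isInducing.isCompact_preimage_iff hrange).2
      hO.isClosed_compl.isCompact
  have hsub : tsupport u ⊆ (fun z : ℂ => (z : OnePoint ℂ)) ⁻¹' Oᶜ :=
    closure_minimal (fun z hz hzO => hz (hzero hzO)) hK.isClosed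
  exact ⟨hK.of_isClosed_subset isClosed_closure hsub, fun z hz =>
    by_contra fun hzW => hsub hz (hWO (coe_mem_sphereCompl.2 hzW))⟩

theorem isGermRep_cauchyTransform {w : ℂ → ℂ} (hw : ContDiff ℝ 1 w) (hc : HasCompactSupport w)
    (hs : tsupport w ⊆ W) :
    IsGermRep W (extendZero (cauchyTransform w)) (sphereCompl (tsupport w)) where
  isOpen := isOpen_sphereCompl hc
  subset := compl_subset_compl.2 (image_mono hs)
  vanish := rfl
  hol x hx := by
    cases x with
    | infty =>
      refine sphereHolAt_infty_of_tendsto (tendsto_cauchyTransform_cocompact hw.continuous hc) ?_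
      filter_upwards [hc.isCompact.compl_mem_cocompact] with z hz
      exact (analyticAt_cauchyTransform hw hc hz).differentiableAt
    | coe z =>
      refine ⟨fun y hy => ?_, fun h => absurd h (OnePoint.coe_ne_infty z)⟩
      obtain rfl : z = y := OnePoint.coe_injective hy
      exact analyticAt_cauchyTransform hw hc (coe_mem_sphereCompl.1 hx)

theorem contDiff_one_of_mem_planeForm {w : ℂ → ℂ} (hw : w ∈ PlaneForm W) : ContDiff ℝ 1 w :=
  hw.1.of_le (by simp)

variable (W) in
/-- The map `ω ↦ [ω^↓]`. -/
def down : PlaneForm W →ₗ[ℂ] OInfty W where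
  toFun w := ⟨sphereGerm W (cauchyTransform w.1), _, _,
    isGermRep_cauchyTransform (contDiff_one_of_mem_planeForm w.2) w.2.2.1 w.2.2.2, rfl⟩
  map_add' v w := Subtype.ext <| (congrArg (sphereGerm W) (cauchyTransform_add
    v.2.1.continuous v.2.2.1 w.2.1.continuous w.2.2.1)).trans (sphereGerm_add _ _)
  map_smul' a w := Subtype.ext <|
    (congrArg (sphereGerm W) (cauchyTransform_smul a w.1)).trans (sphereGerm_smul _ _)

theorem coe_down (w : PlaneForm W) : (down W w).1 = sphereGerm W (cauchyTransform w.1) := rfl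

theorem isDownGerm_down (w : PlaneForm W) : IsDownGerm w.1 (down W w) := rfl

variable (W) in
/-- The operator `∂̄ : Ω^0_c(W) → Ω^{0,1}_c(W)`; both spaces are represented by `PlaneForm W`. -/
def planeDbarMap : PlaneForm W →ₗ[ℂ] PlaneForm W where
  toFun u := ⟨planeDbar u.1, planeDbar_contDiff u.2.1, hasCompactSupport_planeDbar u.2.2.1,
    (tsupport_planeDbar_subset _).trans u.2.2.2⟩
  map_add' u v := Subtype.ext <|
    planeDbar_add (u.2.1.differentiable (by simp)) (v.2.1.differentiable (by simp))
  map_smul' a u := Subtype.ext <| planeDbar_smul (u.2.1.differentiable (by simp)) a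

theorem coe_planeDbarMap (u : PlaneForm W) : (planeDbarMap W u).1 = planeDbar u.1 := rfl

theorem down_planeDbarMap (u : PlaneForm W) : down W (planeDbarMap W u) = 0 := by
  refine Subtype.ext ?_
  rw [coe_down, coe_planeDbarMap,
    cauchyTransform_planeDbar (contDiff_one_of_mem_planeForm u.2) u.2.2.1]
  exact sphereGerm_eq_zero u.2.2.1 u.2.2.2

namespace LiftChoice

variable (c : LiftChoice W)

theorem coe_lift_basis (b : c.ι) :
    (c.lift (c.basis b)).1 = fun z : ℂ => -(c.rep b z * planeDbar (c.ρ b) z) := by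
  simp [lift]

theorem analyticAt_rep {b : c.ι} {z : ℂ} (hz : (z : OnePoint ℂ) ∈ c.Δ b) :
    AnalyticAt ℂ (fun w : ℂ => c.rep b w) z :=
  ((c.isGermRep b).hol z hz).1 z rfl

theorem eventually_ρ_eq_one {b : c.ι} {z : ℂ} (hz : (z : OnePoint ℂ) ∉ c.Δ b) :
    ∀ᶠ y in 𝓝 z, c.ρ b y = 1 :=
  (c.ρ_one b).filter_mono (nhds_le_nhdsSet (by simpa using hz))

theorem eventually_rep_mul_one_sub_ρ_eq_zero {b : c.ι} {z : ℂ} (hz : (z : OnePoint ℂ) ∉ c.Δ b) :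
    (fun y : ℂ => c.rep b y * (1 - c.ρ b y)) =ᶠ[𝓝 z] fun _ => 0 := by
  filter_upwards [c.eventually_ρ_eq_one hz] with y hy
  rw [hy, sub_self, mul_zero]

theorem differentiable_ρ (b : c.ι) : Differentiable ℝ (c.ρ b) :=
  (c.ρ_smooth b).differentiable (by simp)

theorem differentiable_rep_mul_one_sub_ρ (b : c.ι) :
    Differentiable ℝ fun z : ℂ => c.rep b z * (1 - c.ρ b z) := fun z => by
  by_cases hz : (z : OnePoint ℂ) ∈ c.Δ b
  · exact ((c.analyticAt_rep hz).differentiableAt.restrictScalars ℝ).mul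
      ((c.differentiable_ρ b z).const_sub 1)
  · exact (differentiableAt_const _).congr_of_eventuallyEq
      (c.eventually_rep_mul_one_sub_ρ_eq_zero hz)

theorem tendsto_rep_mul_one_sub_ρ (b : c.ι) :
    Tendsto (fun z : ℂ => c.rep b z * (1 - c.ρ b z)) (cocompact ℂ) (𝓝 0) := by
  have hinf : OnePoint.infty ∈ c.Δ b := (c.isGermRep b).subset (infty_mem_sphereCompl W)
  refine (tendsto_cocompact_of_sphereHolAt ((c.isGermRep b).hol _ hinf)
    (c.isGermRep b).vanish).congr' ?_
  filter_upwards [(c.ρ_compact b).isCompact.compl_mem_cocompact] with z hz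
  rw [image_eq_zero_of_notMem_tsupport hz, sub_zero, mul_one]

theorem planeDbar_rep_mul_one_sub_ρ (b : c.ι) :
    planeDbar (fun z : ℂ => c.rep b z * (1 - c.ρ b z)) = (c.lift (c.basis b)).1 := by
  rw [c.coe_lift_basis]
  funext z
  by_cases hz : (z : OnePoint ℂ) ∈ c.Δ b
  · rw [planeDbar_mul_of_differentiableAt (c.analyticAt_rep hz).differentiableAt
      ((c.differentiable_ρ b z).const_sub 1), planeDbar_const_sub, mul_neg]
  · rw [planeDbar_of_eventuallyEq (c.eventually_rep_mul_one_sub_ρ_eq_zero hz),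
      planeDbar_of_eventuallyEq (c.eventually_ρ_eq_one hz), mul_zero, neg_zero]

theorem cauchyTransform_lift_basis (b : c.ι) :
    cauchyTransform (c.lift (c.basis b)).1 = fun z : ℂ => c.rep b z * (1 - c.ρ b z) :=
  cauchyTransform_eq_of_planeDbar_eq (contDiff_one_of_mem_planeForm (c.lift (c.basis b)).2)
    (c.lift (c.basis b)).2.2.1 (c.differentiable_rep_mul_one_sub_ρ b)
    (c.tendsto_rep_mul_one_sub_ρ b) (c.planeDbar_rep_mul_one_sub_ρ b)

theorem down_lift (f : OInfty W) : down W (c.lift f) = f := by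
  suffices down W ∘ₗ c.lift = LinearMap.id from LinearMap.congr_fun this f
  refine c.basis.ext fun b => Subtype.ext ?_
  have hbasis : sphereGerm W (fun z : ℂ => c.rep b z) = (c.basis b).1 := by
    rw [sphereGerm, extendZero_comp_coe (c.isGermRep b).vanish, c.germ_eq]
  have hbump : sphereGerm W (fun z : ℂ => c.rep b z * c.ρ b z) = 0 :=
    sphereGerm_eq_zero (c.ρ_compact b).mul_left (tsupport_mul_subset_right.trans (c.ρ_supp b))
  have hsplit : (fun z : ℂ => c.rep b z) =
      (fun z : ℂ => c.rep b z * (1 - c.ρ b z)) + fun z : ℂ => c.rep b z * c.ρ b z := by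
    funext z
    simp only [Pi.add_apply]
    ring
  rw [LinearMap.comp_apply, coe_down, c.cauchyTransform_lift_basis, LinearMap.id_apply, ← hbasis,
    hsplit, sphereGerm_add, hbump, add_zero]

theorem sphereGerm_cauchyTransform_sub_lift (w : PlaneForm W) :
    sphereGerm W (cauchyTransform (w - c.lift (down W w)).1) = 0 := by
  rw [← coe_down, map_sub, c.down_lift, sub_self, Submodule.coe_zero]

/-- The map `ω ↦ (ω - ⌈ω^↓⌉)^↓`. -/
def contraction : PlaneForm W →ₗ[ℂ] PlaneForm W where
  toFun w := ⟨cauchyTransform (w - c.lift (down W w)).1,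
    contDiff_cauchyTransform (w - c.lift (down W w)).2.1 (w - c.lift (down W w)).2.2.1,
    hasCompactSupport_of_sphereGerm_eq_zero (c.sphereGerm_cauchyTransform_sub_lift w)⟩
  map_add' v w := Subtype.ext <| by
    change cauchyTransform _ = cauchyTransform _ + cauchyTransform _
    rw [← cauchyTransform_add (v - c.lift (down W v)).2.1.continuous
      (v - c.lift (down W v)).2.2.1 (w - c.lift (down W w)).2.1.continuous
      (w - c.lift (down W w)).2.2.1, ← Submodule.coe_add, map_add, map_add, add_sub_add_comm]
  map_smul' a w := Subtype.ext <| by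
    change cauchyTransform _ = a • cauchyTransform _
    rw [map_smul, map_smul, ← smul_sub, Submodule.coe_smul, cauchyTransform_smul]

theorem coe_contraction (w : PlaneForm W) :
    (c.contraction w).1 = cauchyTransform (w - c.lift (down W w)).1 := rfl

theorem isTwoTermRetract :
    IsTwoTermRetract (planeDbarMap W) c.lift (down W) c.contraction where
  proj_comp_incl := LinearMap.ext c.down_lift
  diff_comp_contr := LinearMap.ext fun w => Subtype.ext <|
    planeDbar_cauchyTransform (contDiff_one_of_mem_planeForm (w - c.lift (down W w)).2)
      (w - c.lift (down W w)).2.2.1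
  contr_comp_diff := LinearMap.ext fun u => Subtype.ext <| by
    rw [LinearMap.comp_apply, LinearMap.id_apply, coe_contraction, down_planeDbarMap, map_zero,
      sub_zero, coe_planeDbarMap,
      cauchyTransform_planeDbar (contDiff_one_of_mem_planeForm u.2) u.2.2.1]

end LiftChoice

end PlaneRetract

/-! ## Calculus in holomorphic coordinates -/

section Coordinates

theorem contDiffGroupoid_complex_le_real :
    contDiffGroupoid ω 𝓘(ℂ, ℂ) ≤ contDiffGroupoid ∞ 𝓘(ℝ, ℂ) := by
  rw [StructureGroupoid.le_iff]
  intro e he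
  rw [contDiffGroupoid, mem_groupoid_of_pregroupoid] at he ⊢
  have smooth_of_analytic : ∀ {f : ℂ → ℂ} {s : Set ℂ},
      (contDiffPregroupoid ω 𝓘(ℂ, ℂ)).property f s →
        (contDiffPregroupoid ∞ 𝓘(ℝ, ℂ)).property f s := by
    intro f s hf
    have analytic : ContDiffOn ℂ ω f (s ∩ univ) := by simpa [contDiffPregroupoid] using hf
    have smooth : ContDiffOn ℝ ∞ f (s ∩ univ) := (analytic.restrict_scalars ℝ).of_le le_top
    simpa [contDiffPregroupoid] using smooth
  exact ⟨smooth_of_analytic he.1, smooth_of_analytic he.2⟩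

variable {F : Type u} [NormedAddCommGroup F] [NormedSpace ℂ F]
  {X : Type u} [TopologicalSpace X] [ChartedSpace ℂ X]

variable (X) in
theorem isManifold_real [IsManifold 𝓘(ℂ, ℂ) ω X] : IsManifold 𝓘(ℝ, ℂ) ∞ X := by
  have hX : HasGroupoid X (contDiffGroupoid ω 𝓘(ℂ, ℂ)) := inferInstance
  have := hasGroupoid_of_le hX contDiffGroupoid_complex_le_real
  exact IsManifold.mk' _ _ _

/-- The preferred chart at a point, as a holomorphic coordinate. -/
def holChartAt [IsManifold 𝓘(ℂ, ℂ) ω X] (x₀ : X) : HolCoord X :=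
  ⟨chartAt ℂ x₀, IsManifold.chart_mem_maximalAtlas x₀⟩

namespace HolCoord

theorem mem_maximalAtlas_real (ξ : HolCoord X) :
    ξ.chart ∈ IsManifold.maximalAtlas 𝓘(ℝ, ℂ) ∞ X :=
  StructureGroupoid.maximalAtlas_mono contDiffGroupoid_complex_le_real ξ.mem

theorem eventually_mem (ξ : HolCoord X) {x : X} (hx : x ∈ ξ.chart.source) :
    ∀ᶠ y in 𝓝 x, y ∈ ξ.chart.source :=
  ξ.chart.open_source.mem_nhds hx

theorem eventuallyEq_comp_symm_comp {E : Type*} (ξ : HolCoord X) {x : X}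
    (hx : x ∈ ξ.chart.source) (g : X → E) :
    g =ᶠ[𝓝 x] (fun z => g (ξ.chart.symm z)) ∘ ξ.chart := by
  filter_upwards [ξ.eventually_mem hx] with y hy
  simp [ξ.chart.left_inv hy]

theorem tendsto_symm (ξ : HolCoord X) {x : X} (hx : x ∈ ξ.chart.source) :
    Tendsto ξ.chart.symm (𝓝 (ξ.chart x)) (𝓝 x) := by
  have h := ξ.chart.symm.continuousAt (x := ξ.chart x) (ξ.chart.map_source hx)
  rwa [ContinuousAt, ξ.chart.left_inv hx] at h

theorem eventually_symm_mem (ξ : HolCoord X) {x : X} (hx : x ∈ ξ.chart.source) {s : Set X}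
    (hs : s ∈ 𝓝 x) :
    ∀ᶠ z in 𝓝 (ξ.chart x),
      z ∈ ξ.chart.target ∧ ξ.chart.symm z ∈ ξ.chart.source ∧ ξ.chart.symm z ∈ s := by
  filter_upwards [ξ.chart.open_target.mem_nhds (ξ.chart.map_source hx),
    (ξ.tendsto_symm hx).eventually_mem hs] with z hz hzs
  exact ⟨hz, ξ.chart.map_target hz, hzs⟩

theorem contMDiffAt_iff [IsManifold 𝓘(ℂ, ℂ) ω X] (ξ : HolCoord X) {x : X}
    (hx : x ∈ ξ.chart.source) {g : X → F} :
    ContMDiffAt 𝓘(ℝ, ℂ) 𝓘(ℝ, F) ∞ g x ↔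
      ContDiffAt ℝ ∞ (fun z => g (ξ.chart.symm z)) (ξ.chart x) := by
  have := isManifold_real X
  constructor
  · intro hg
    have hsymm :=
      contMDiffAt_symm_of_mem_maximalAtlas ξ.mem_maximalAtlas_real (ξ.chart.map_source hx)
    exact (ContMDiffAt.comp (ξ.chart x) (by rwa [ξ.chart.left_inv hx]) hsymm).contDiffAt
  · intro hg
    have hξ := contMDiffAt_of_mem_maximalAtlas ξ.mem_maximalAtlas_real hx
    exact (ContMDiffAt.comp x hg.contMDiffAt hξ).congr_of_eventuallyEq
      (ξ.eventuallyEq_comp_symm_comp hx g)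

theorem contDiffAt_comp_symm {E : Type*} [NormedAddCommGroup E] [NormedSpace ℂ E]
    (ξ : HolCoord X) {x : X} (hx : x ∈ ξ.chart.source) {g : X → E}
    (hg : ContMDiffAt 𝓘(ℂ, ℂ) 𝓘(ℂ, E) ω g x) :
    ContDiffAt ℂ ω (fun z => g (ξ.chart.symm z)) (ξ.chart x) := by
  have hsymm := contMDiffAt_symm_of_mem_maximalAtlas ξ.mem (ξ.chart.map_source hx)
  exact (ContMDiffAt.comp (ξ.chart x) (by rwa [ξ.chart.left_inv hx]) hsymm).contDiffAt

theorem mdifferentiableAt (ξ : HolCoord X) {x : X} (hx : x ∈ ξ.chart.source) :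
    MDifferentiableAt 𝓘(ℂ, ℂ) 𝓘(ℂ, ℂ) ξ.chart x :=
  (contMDiffAt_of_mem_maximalAtlas ξ.mem hx).mdifferentiableAt (by simp)

theorem coordDeriv_ne_zero (ξ : HolCoord X) {x : X} (hx : x ∈ ξ.chart.source) :
    coordDeriv ξ.chart x 1 ≠ 0 := by
  have hξ : ξ.chart.MDifferentiable 𝓘(ℂ, ℂ) 𝓘(ℂ, ℂ) :=
    ⟨(contMDiffOn_of_mem_maximalAtlas ξ.mem).mdifferentiableOn (by simp),
      (contMDiffOn_symm_of_mem_maximalAtlas ξ.mem).mdifferentiableOn (by simp)⟩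
  intro h
  exact one_ne_zero (α := ℂ)
    (hξ.mfderiv_injective hx (h.trans (map_zero (coordDeriv ξ.chart x)).symm))

theorem coordDeriv_eq (ξ : HolCoord X) {x : X} (hx : x ∈ ξ.chart.source) {φ : X → ℂ}
    (hφ : DifferentiableAt ℂ (fun z => φ (ξ.chart.symm z)) (ξ.chart x)) (v : ℂ) :
    coordDeriv φ x v =
      deriv (fun z => φ (ξ.chart.symm z)) (ξ.chart x) * coordDeriv ξ.chart x v := by
  have chain : coordDeriv φ x = (fderiv ℂ (fun z => φ (ξ.chart.symm z)) (ξ.chart x)).comp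
      (coordDeriv ξ.chart x) := by
    have hcomp := hφ.hasFDerivAt.hasMFDerivAt.comp x (ξ.mdifferentiableAt hx).hasMFDerivAt
    exact (hcomp.congr_of_eventuallyEq (ξ.eventuallyEq_comp_symm_comp hx φ)).mfderiv
  rw [chain, ContinuousLinearMap.comp_apply, fderiv_eq_deriv_mul]

theorem contDiffAt_transition (ξ η : HolCoord X) {x : X} (hξ : x ∈ ξ.chart.source)
    (hη : x ∈ η.chart.source) :
    ContDiffAt ℂ ω (fun z => ξ.chart (η.chart.symm z)) (η.chart x) :=
  η.contDiffAt_comp_symm hη (contMDiffAt_of_mem_maximalAtlas ξ.mem hξ)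

theorem contDiffAt_conj_deriv_transition (ξ η : HolCoord X) {x : X} (hξ : x ∈ ξ.chart.source)
    (hη : x ∈ η.chart.source) :
    ContDiffAt ℝ ∞ (fun z => conj (deriv (fun z => ξ.chart (η.chart.symm z)) z)) (η.chart x) := by
  have h := (ξ.contDiffAt_transition η hξ hη).analyticAt.deriv
  exact Complex.conjCLE.contDiff.contDiffAt.comp _ ((h.contDiffAt (n := ∞)).restrict_scalars ℝ)

theorem eventually_coordDeriv_eq (ξ η : HolCoord X) {x₀ : X} (hξ : x₀ ∈ ξ.chart.source)
    (hη : x₀ ∈ η.chart.source) : ∀ᶠ x in 𝓝 x₀, ∀ v, coordDeriv ξ.chart x v =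
      deriv (fun z => ξ.chart (η.chart.symm z)) (η.chart x) * coordDeriv η.chart x v := by
  filter_upwards [ξ.eventually_mem hξ, η.eventually_mem hη] with x hxξ hxη v
  exact η.coordDeriv_eq hxη ((ξ.contDiffAt_transition η hxξ hxη).differentiableAt (by simp)) v

end HolCoord

theorem coordDeriv_apply (φ : X → ℂ) (x : X) (v : ℂ) :
    coordDeriv φ x v = v * coordDeriv φ x 1 := by
  simpa using (coordDeriv φ x).map_smul v 1

theorem hasMFDerivAt_coordDeriv {φ : X → ℂ} {x : X}
    (h : MDifferentiableAt 𝓘(ℂ, ℂ) 𝓘(ℂ, ℂ) φ x) :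
    HasMFDerivAt 𝓘(ℝ, ℂ) 𝓘(ℝ, ℂ) φ x ((coordDeriv φ x).restrictScalars ℝ) :=
  ⟨h.hasMFDerivAt.1, h.hasMFDerivAt.2.restrictScalars ℝ⟩

namespace HolCoord

theorem realDeriv_eq (ξ : HolCoord X) {x : X} (hx : x ∈ ξ.chart.source) {g : X → F}
    (hg : DifferentiableAt ℝ (fun z => g (ξ.chart.symm z)) (ξ.chart x)) :
    realDeriv g x = (fderiv ℝ (fun z => g (ξ.chart.symm z)) (ξ.chart x)).comp
      ((coordDeriv ξ.chart x).restrictScalars ℝ) := by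
  have hcomp :=
    hg.hasFDerivAt.hasMFDerivAt.comp x (hasMFDerivAt_coordDeriv (ξ.mdifferentiableAt hx))
  exact (hcomp.congr_of_eventuallyEq (ξ.eventuallyEq_comp_symm_comp hx g)).mfderiv

theorem antilinearPart_realDeriv (ξ : HolCoord X) {x : X} (hx : x ∈ ξ.chart.source)
    {g : X → F} (hg : DifferentiableAt ℝ (fun z => g (ξ.chart.symm z)) (ξ.chart x)) (v : ℂ) :
    antilinearPart (realDeriv g x) v = conj (coordDeriv ξ.chart x v) •
      antilinearPart (fderiv ℝ (fun z => g (ξ.chart.symm z)) (ξ.chart x)) 1 := by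
  have map_I_mul : coordDeriv ξ.chart x (Complex.I * v) =
      Complex.I * coordDeriv ξ.chart x v := by
    simpa using (coordDeriv ξ.chart x).map_smul Complex.I v
  rw [← antilinearPart_eq, ξ.realDeriv_eq hx hg]
  simp only [antilinearPart, LinearMap.coe_mk, AddHom.coe_mk, ContinuousLinearMap.comp_apply,
    ContinuousLinearMap.coe_restrictScalars', map_I_mul]

end HolCoord

theorem antilinearPart_fderiv_smul {f : ℂ → ℂ} {τ : ℂ → F} {z : ℂ} (hf : DifferentiableAt ℝ f z)
    (hτ : DifferentiableAt ℂ τ z) :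
    antilinearPart (fderiv ℝ (fun y => f y • τ y) z) 1 = planeDbar f z • τ z := by
  have cauchyRiemann := (differentiableAt_complex_iff_differentiableAt_real.1 hτ).2
  rw [fderiv_fun_smul hf (hτ.restrictScalars ℝ), planeDbar_apply]
  simp only [antilinearPart, LinearMap.coe_mk, AddHom.coe_mk, _root_.add_apply, mul_one,
    _root_.smul_apply, ContinuousLinearMap.smulRight_apply, cauchyRiemann, smul_add, smul_smul]
  match_scalars
  · linear_combination (1 / 2 * f z) * Complex.I_mul_I
  · ring

end Coordinates

/-! ## The double is Hausdorff -/

section DoubleHausdorff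

variable {M : Type u} [TopologicalSpace M] [ChartedSpace HalfPlane M]
  [HasGroupoid M conformalGroupoid]

theorem source_chartAt_double (x : Double M) :
    (chartAt ℂ x).source = Double.proj ⁻¹' (chartAt HalfPlane x.proj).source := rfl

theorem proj_eq_symm_fold_chartAt {x y : Double M} (hy : y ∈ (chartAt ℂ x).source) :
    y.proj = (chartAt HalfPlane x.proj).symm (fold (chartAt ℂ x y)) := by
  conv_lhs => rw [← (chartAt ℂ x).left_inv hy]
  rfl

theorem continuous_doubleProj : Continuous (Double.proj : Double M → M) := by
  rw [continuous_iff_continuousAt]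
  intro x
  have hx : x ∈ (chartAt ℂ x).source := mem_chart_source ℂ x
  have hcont :
      ContinuousAt (fun y => (chartAt HalfPlane x.proj).symm (fold (chartAt ℂ x y))) x := by
    refine ContinuousAt.comp (g := (chartAt HalfPlane x.proj).symm) ?_
      (continuous_fold.continuousAt.comp ((chartAt ℂ x).continuousAt hx))
    exact (chartAt HalfPlane x.proj).symm.continuousAt ((chartAt ℂ x).map_source hx)
  refine hcont.congr ?_
  filter_upwards [(chartAt ℂ x).open_source.mem_nhds hx] with y hy
  exact (proj_eq_symm_fold_chartAt hy).symm

instance [T2Space M] : T2Space (Double M) where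
  t2 x y hxy := by
    by_cases hproj : x.proj = y.proj
    -- The chart of the double at `x` contains the whole fibre through `x`.
    · have hx : x ∈ (chartAt ℂ x).source := mem_chart_source ℂ x
      have hy : y ∈ (chartAt ℂ x).source := by
        rw [source_chartAt_double, mem_preimage, ← hproj]
        exact mem_chart_source HalfPlane x.proj
      obtain ⟨u, v, hu, hv, hxu, hyv, huv⟩ :=
        t2_separation fun h => hxy ((chartAt ℂ x).injOn hx hy h)
      exact ⟨_, _, (chartAt ℂ x).isOpen_inter_preimage hu, (chartAt ℂ x).isOpen_inter_preimage hv,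
        ⟨hx, hxu⟩, ⟨hy, hyv⟩, (huv.preimage _).mono inter_subset_right inter_subset_right⟩
    · obtain ⟨u, v, hu, hv, hxu, hyv, huv⟩ := t2_separation hproj
      exact ⟨_, _, hu.preimage continuous_doubleProj, hv.preimage continuous_doubleProj, hxu, hyv,
        huv.preimage _⟩

end DoubleHausdorff

/-! ## Sections and forms over the domain of a coordinate -/

section LocalSections

theorem baseSet_trivializationAt_mem_nhds {B : Type*} [TopologicalSpace B] (F : Type*)
    [TopologicalSpace F] (E : B → Type*) [TopologicalSpace (TotalSpace F E)]
    [∀ b, TopologicalSpace (E b)] [FiberBundle F E] (b : B) :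
    (trivializationAt F E b).baseSet ∈ 𝓝 b :=
  (trivializationAt F E b).open_baseSet.mem_nhds (mem_baseSet_trivializationAt F E b)

variable {F : Type u} [NormedAddCommGroup F] [NormedSpace ℂ F]
  {X : Type u} [TopologicalSpace X] [ChartedSpace ℂ X]
  {L : X → Type u} [TopologicalSpace (TotalSpace F L)] [∀ x, AddCommGroup (L x)]
  [∀ x, Module ℂ (L x)] [∀ x, TopologicalSpace (L x)] [FiberBundle F L]
  {𝔞 : Type u} [AddCommGroup 𝔞] [Module ℂ 𝔞] (T : CoordTrivialization F L 𝔞) (ξ : HolCoord X)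

/-- The section `a_ξ`, without the cut-off by zero outside the domain of `ξ`. -/
def frameSection (a : 𝔞) (x : X) : L x := T.triv ξ x (T.iso ξ a)

theorem tensorSection_of_mem {a : 𝔞} {g : ℂ → ℂ} {x : X} (hx : x ∈ ξ.chart.source) :
    tensorSection T ξ a g x = g (ξ.chart x) • frameSection T ξ a x := if_pos hx

theorem tensorSection_of_notMem {a : 𝔞} {g : ℂ → ℂ} {x : X} (hx : x ∉ ξ.chart.source) :
    tensorSection T ξ a g x = 0 := if_neg hx

theorem tensorSection_add_left (a a' : 𝔞) (g : ℂ → ℂ) (x : X) :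
    tensorSection T ξ (a + a') g x = tensorSection T ξ a g x + tensorSection T ξ a' g x := by
  by_cases hx : x ∈ ξ.chart.source
  · simp only [tensorSection_of_mem T ξ hx, frameSection, map_add, smul_add]
  · simp only [tensorSection_of_notMem T ξ hx, add_zero]

theorem tensorSection_smul_left (c : ℂ) (a : 𝔞) (g : ℂ → ℂ) (x : X) :
    tensorSection T ξ (c • a) g x = c • tensorSection T ξ a g x := by
  by_cases hx : x ∈ ξ.chart.source
  · simp only [tensorSection_of_mem T ξ hx, frameSection, map_smul, smul_comm c]
  · simp only [tensorSection_of_notMem T ξ hx, smul_zero]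

theorem tensorSection_add_right (a : 𝔞) (g g' : ℂ → ℂ) (x : X) :
    tensorSection T ξ a (g + g') x = tensorSection T ξ a g x + tensorSection T ξ a g' x := by
  by_cases hx : x ∈ ξ.chart.source
  · simp only [tensorSection_of_mem T ξ hx, Pi.add_apply, add_smul]
  · simp only [tensorSection_of_notMem T ξ hx, add_zero]

theorem tensorSection_smul_right (c : ℂ) (a : 𝔞) (g : ℂ → ℂ) (x : X) :
    tensorSection T ξ a (c • g) x = c • tensorSection T ξ a g x := by
  by_cases hx : x ∈ ξ.chart.source
  · simp only [tensorSection_of_mem T ξ hx, Pi.smul_apply, smul_eq_mul, mul_smul]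
  · simp only [tensorSection_of_notMem T ξ hx, smul_zero]

theorem tensorForm_apply (a : 𝔞) (w : ℂ → ℂ) (x : X) (v : ℂ) :
    tensorForm T ξ a w x v = conj (coordDeriv ξ.chart x v) • tensorSection T ξ a w x := by
  classical
  change (if x ∈ ξ.chart.source then
    (w (ξ.chart x) * conj (coordDeriv ξ.chart x v)) • T.triv ξ x (T.iso ξ a) else 0) = _
  by_cases hx : x ∈ ξ.chart.source
  · rw [if_pos hx, tensorSection_of_mem T ξ hx, smul_smul, mul_comm]
    rfl
  · rw [if_neg hx, tensorSection_of_notMem T ξ hx, smul_zero]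

theorem tensorForm_eq_zero {a : 𝔞} {w : ℂ → ℂ} {x : X} (hx : tensorSection T ξ a w x = 0) :
    tensorForm T ξ a w x = 0 := by
  refine LinearMap.ext fun v => ?_
  rw [tensorForm_apply, hx, smul_zero, LinearMap.zero_apply]

theorem tensorForm_add_left (a a' : 𝔞) (w : ℂ → ℂ) (x : X) :
    tensorForm T ξ (a + a') w x = tensorForm T ξ a w x + tensorForm T ξ a' w x :=
  LinearMap.ext fun v => by
    simp only [LinearMap.add_apply, tensorForm_apply, tensorSection_add_left, smul_add]

theorem tensorForm_smul_left (c : ℂ) (a : 𝔞) (w : ℂ → ℂ) (x : X) :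
    tensorForm T ξ (c • a) w x = c • tensorForm T ξ a w x :=
  LinearMap.ext fun v => by
    simp only [LinearMap.smul_apply, tensorForm_apply, tensorSection_smul_left, smul_comm c]

theorem tensorForm_add_right (a : 𝔞) (w w' : ℂ → ℂ) (x : X) :
    tensorForm T ξ a (w + w') x = tensorForm T ξ a w x + tensorForm T ξ a w' x :=
  LinearMap.ext fun v => by
    simp only [LinearMap.add_apply, tensorForm_apply, tensorSection_add_right, smul_add]

theorem tensorForm_smul_right (c : ℂ) (a : 𝔞) (w : ℂ → ℂ) (x : X) :
    tensorForm T ξ a (c • w) x = c • tensorForm T ξ a w x :=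
  LinearMap.ext fun v => by
    simp only [LinearMap.smul_apply, tensorForm_apply, tensorSection_smul_right, smul_comm c]

theorem mem_image_tsupport_of_tensorSection_ne_zero {a : 𝔞} {g : ℂ → ℂ} {x : X}
    (hx : tensorSection T ξ a g x ≠ 0) : x ∈ ξ.chart.symm '' tsupport g := by
  by_cases hsource : x ∈ ξ.chart.source
  · refine ⟨ξ.chart x, subset_tsupport g fun h => hx ?_, ξ.chart.left_inv hsource⟩
    rw [tensorSection_of_mem T ξ hsource, h, zero_smul]
  · exact absurd (tensorSection_of_notMem T ξ hsource) hx

theorem compactSuppIn_tensorSection [T2Space X] {V : Set X} (hV : ξ.chart.source ⊆ V) (a : 𝔞)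
    {g : ℂ → ℂ} (hg : g ∈ PlaneForm ξ.chart.target) : CompactSuppIn V (tensorSection T ξ a g) := by
  have hK : IsCompact (ξ.chart.symm '' tsupport g) :=
    hg.2.1.isCompact.image_of_continuousOn (ξ.chart.continuousOn_symm.mono hg.2.2)
  have hsupp : closure {x | tensorSection T ξ a g x ≠ 0} ⊆ ξ.chart.symm '' tsupport g :=
    closure_minimal (fun _ => mem_image_tsupport_of_tensorSection_ne_zero T ξ) hK.isClosed
  refine ⟨hK.of_isClosed_subset isClosed_closure hsupp, hsupp.trans ?_⟩
  rintro _ ⟨z, hz, rfl⟩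
  exact hV (ξ.chart.map_target (hg.2.2 hz))

theorem eventually_tensorSection_eq_zero [T2Space X] {a : 𝔞} {g : ℂ → ℂ}
    (hg : g ∈ PlaneForm ξ.chart.target) {x₀ : X} (hx₀ : x₀ ∉ ξ.chart.source) :
    ∀ᶠ x in 𝓝 x₀, tensorSection T ξ a g x = 0 := by
  have hsupp := (compactSuppIn_tensorSection T ξ subset_rfl a hg).2
  filter_upwards [isClosed_closure.isOpen_compl.mem_nhds fun h => hx₀ (hsupp h)] with x hx
  by_contra hne
  exact hx (subset_closure hne)

variable [VectorBundle ℂ F L]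

variable (F) in
/-- The expression of a section in the coordinate `ξ` and the preferred trivialisation at `x₀`. -/
def localRep (ξ : HolCoord X) (x₀ : X) (s : ∀ x, L x) (z : ℂ) : F :=
  (trivializationAt F L x₀).linearMapAt ℂ (ξ.chart.symm z) (s (ξ.chart.symm z))

theorem localRep_chart {ξ : HolCoord X} {x : X} (hx : x ∈ ξ.chart.source) (x₀ : X)
    (s : ∀ x, L x) :
    localRep F ξ x₀ s (ξ.chart x) = (trivializationAt F L x₀).linearMapAt ℂ x (s x) := by
  rw [localRep, ξ.chart.left_inv hx]

theorem dbarSection_apply_of_mem {ξ : HolCoord X} {x : X} (hx : x ∈ ξ.chart.source) {s : ∀ x, L x}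
    (hs : DifferentiableAt ℝ (localRep F ξ x s) (ξ.chart x)) (v : ℂ) :
    dbarSection F L s x v = conj (coordDeriv ξ.chart x v) •
      (trivializationAt F L x).symmₗ ℂ x
        (antilinearPart (fderiv ℝ (localRep F ξ x s) (ξ.chart x)) 1) := by
  rw [dbarSection, LinearMap.comp_apply, ξ.antilinearPart_realDeriv hx hs, map_smul]
  rfl

theorem contDiffAt_localRep_frameSection {x₀ : X} (hx₀ : x₀ ∈ ξ.chart.source) (a : 𝔞) :
    ContDiffAt ℂ ω (localRep F ξ x₀ (frameSection T ξ a)) (ξ.chart x₀) := by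
  have hframe := (T.holomorphic ξ (T.iso ξ a)).contMDiffAt (ξ.chart.open_source.mem_nhds hx₀)
  refine (ξ.contDiffAt_comp_symm hx₀ ((contMDiffAt_section x₀).1 hframe)).congr_of_eventuallyEq ?_
  filter_upwards [ξ.eventually_symm_mem hx₀ (baseSet_trivializationAt_mem_nhds F L x₀)]
    with z ⟨_, _, hbase⟩
  rw [localRep, frameSection, (trivializationAt F L x₀).coe_linearMapAt_of_mem hbase]

theorem localRep_tensorSection {x₀ : X} (hx₀ : x₀ ∈ ξ.chart.source) (a : 𝔞) (g : ℂ → ℂ) :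
    localRep F ξ x₀ (tensorSection T ξ a g) =ᶠ[𝓝 (ξ.chart x₀)]
      fun z => g z • localRep F ξ x₀ (frameSection T ξ a) z := by
  filter_upwards [ξ.eventually_symm_mem hx₀ (baseSet_trivializationAt_mem_nhds F L x₀)]
    with z ⟨htarget, hsource, _⟩
  rw [localRep, localRep, tensorSection_of_mem T ξ hsource, map_smul, ξ.chart.right_inv htarget]

theorem contDiffAt_localRep_tensorSection {x₀ : X} (hx₀ : x₀ ∈ ξ.chart.source) (a : 𝔞)
    {g : ℂ → ℂ} (hg : ContDiff ℝ ∞ g) :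
    ContDiffAt ℝ ∞ (localRep F ξ x₀ (tensorSection T ξ a g)) (ξ.chart x₀) :=
  (hg.contDiffAt.smul (((contDiffAt_localRep_frameSection T ξ hx₀ a).restrict_scalars ℝ).of_le
    le_top)).congr_of_eventuallyEq (localRep_tensorSection T ξ hx₀ a g)

variable [T2Space X]

theorem dbarSection_tensorSection (a : 𝔞) {g : ℂ → ℂ} (hg : g ∈ PlaneForm ξ.chart.target) :
    dbarSection F L (tensorSection T ξ a g) = tensorForm T ξ a (planeDbar g) := by
  funext x
  by_cases hx : x ∈ ξ.chart.source
  · refine LinearMap.ext fun v => ?_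
    rw [dbarSection_apply_of_mem hx
        ((contDiffAt_localRep_tensorSection T ξ hx a hg.1).differentiableAt (by simp)),
      (localRep_tensorSection T ξ hx a g).fderiv_eq,
      antilinearPart_fderiv_smul (hg.1.differentiable (by simp) _)
        ((contDiffAt_localRep_frameSection T ξ hx a).differentiableAt (by simp)),
      localRep_chart hx, map_smul,
      (trivializationAt F L x).symmₗ_linearMapAt (mem_baseSet_trivializationAt F L x),
      tensorForm_apply, tensorSection_of_mem T ξ hx]
  · have hdbar : dbarSection F L (tensorSection T ξ a g) x = 0 := by
      by_contra hne
      exact hx ((compactSuppIn_tensorSection T ξ subset_rfl a hg).2 (dbarSection_supp _ hne))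
    rw [hdbar, tensorForm_eq_zero T ξ (tensorSection_of_notMem T ξ hx)]

variable [IsManifold 𝓘(ℂ, ℂ) ω X]

theorem tensorSection_mem_Omega0 {V : Set X} (hV : ξ.chart.source ⊆ V) (a : 𝔞) {g : ℂ → ℂ}
    (hg : g ∈ PlaneForm ξ.chart.target) : tensorSection T ξ a g ∈ Omega0 F L V := by
  refine ⟨fun x₀ => ?_, compactSuppIn_tensorSection T ξ hV a hg⟩
  by_cases hx₀ : x₀ ∈ ξ.chart.source
  · exact (ξ.contMDiffAt_iff hx₀).2 (contDiffAt_localRep_tensorSection T ξ hx₀ a hg.1)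
  · refine (contMDiffAt_const (c := (0 : F))).congr_of_eventuallyEq ?_
    filter_upwards [eventually_tensorSection_eq_zero T ξ (a := a) hg hx₀] with x hx
    rw [hx, map_zero]

theorem tensorForm_mem_Omega1 {V : Set X} (hV : ξ.chart.source ⊆ V) (a : 𝔞) {w : ℂ → ℂ}
    (hw : w ∈ PlaneForm ξ.chart.target) : tensorForm T ξ a w ∈ Omega1 F L V := by
  obtain ⟨hsmooth, hsupp⟩ := tensorSection_mem_Omega0 T ξ hV a hw
  refine ⟨fun x₀ => ?_, hsupp.mono_supp fun x hx =>
    subset_closure fun h => hx (tensorForm_eq_zero T ξ h)⟩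
  by_cases hx₀ : x₀ ∈ ξ.chart.source
  · set η := holChartAt x₀
    have hx₀η : x₀ ∈ η.chart.source := mem_chart_source ℂ x₀
    refine ⟨fun x => conj (deriv (fun z => ξ.chart (η.chart.symm z)) (η.chart x)) •
      (trivializationAt F L x₀).linearMapAt ℂ x (tensorSection T ξ a w x), ?_, ?_⟩
    · rw [η.contMDiffAt_iff hx₀η]
      refine ((ξ.contDiffAt_conj_deriv_transition η hx₀ hx₀η).smul
        ((η.contMDiffAt_iff hx₀η).1 (hsmooth x₀))).congr_of_eventuallyEq ?_
      filter_upwards [η.chart.open_target.mem_nhds (η.chart.map_source hx₀η)] with z hz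
      rw [η.chart.right_inv hz]
      rfl
    · filter_upwards [ξ.eventually_coordDeriv_eq η hx₀ hx₀η] with x hx v
      rw [tensorForm_apply, map_smul, hx, map_mul, mul_comm, mul_smul]
      rfl
  · refine ⟨0, contMDiffAt_const, ?_⟩
    filter_upwards [eventually_tensorSection_eq_zero T ξ (a := a) hw hx₀] with x hx v
    rw [tensorForm_eq_zero T ξ hx, LinearMap.zero_apply, map_zero, Pi.zero_apply, smul_zero]

end LocalSections

/-! ## Coefficients with respect to a frame -/

theorem mem_planeForm_of_support_subset {K W : Set ℂ} (hK : IsCompact K) (hKW : K ⊆ W)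
    {g : ℂ → ℂ} (hsupp : Function.support g ⊆ K) (hg : ∀ z ∈ K, ContDiffAt ℝ ∞ g z) :
    g ∈ PlaneForm W := by
  have htsupp : tsupport g ⊆ K := closure_minimal hsupp hK.isClosed
  refine ⟨contDiff_iff_contDiffAt.2 fun z => ?_,
    hK.of_isClosed_subset (isClosed_tsupport g) htsupp, htsupp.trans hKW⟩
  by_cases hz : z ∈ K
  · exact hg z hz
  · refine (contDiffAt_const (c := (0 : ℂ))).congr_of_eventuallyEq ?_
    filter_upwards [hK.isClosed.isOpen_compl.mem_nhds hz] with y hy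
    exact Function.notMem_support.1 fun h => hy (hsupp h)

section Coefficients

variable {X : Type u} [TopologicalSpace X] [ChartedSpace ℂ X]
  {L : X → Type u} [∀ x, AddCommGroup (L x)] [∀ x, Module ℂ (L x)]

/-- The coefficient `c` of a form `s = c dξ̄`, as a section over the domain of `ξ`. -/
def formCoeff (ξ : HolCoord X) (s : Form01 L) (x : X) : L x :=
  s x (coordDeriv ξ.chart x 1)⁻¹

theorem conj_coordDeriv_smul_formCoeff (ξ : HolCoord X) (s : Form01 L) {x : X}
    (hx : x ∈ ξ.chart.source) (v : ℂ) :
    conj (coordDeriv ξ.chart x v) • formCoeff ξ s x = s x v := by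
  rw [formCoeff, ← LinearMap.map_smulₛₗ, smul_eq_mul, coordDeriv_apply, mul_assoc,
    mul_inv_cancel₀ (ξ.coordDeriv_ne_zero hx), mul_one]

variable {F : Type u} [NormedAddCommGroup F] [NormedSpace ℂ F]
  [TopologicalSpace (TotalSpace F L)] [∀ x, TopologicalSpace (L x)] [FiberBundle F L]

theorem contDiffAt_localRep_formCoeff [VectorBundle ℂ F L] [IsManifold 𝓘(ℂ, ℂ) ω X]
    (ξ : HolCoord X) {s : Form01 L} (hs : IsSmoothForm F L s) {x₀ : X}
    (hx₀ : x₀ ∈ ξ.chart.source) :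
    ContDiffAt ℝ ∞ (localRep F ξ x₀ (formCoeff ξ s)) (ξ.chart x₀) := by
  obtain ⟨c, hc, hsc⟩ := hs x₀
  set η := holChartAt x₀
  have hx₀η : x₀ ∈ η.chart.source := mem_chart_source ℂ x₀
  refine ((η.contDiffAt_conj_deriv_transition ξ hx₀η hx₀).smul
    ((ξ.contMDiffAt_iff hx₀).1 hc)).congr_of_eventuallyEq ?_
  filter_upwards [ξ.eventually_symm_mem hx₀
    (hsc.and (η.eventually_coordDeriv_eq ξ hx₀η hx₀))] with z ⟨htarget, hsource, hform, hderiv⟩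
  have hconj : coordDeriv η.chart (ξ.chart.symm z) (coordDeriv ξ.chart (ξ.chart.symm z) 1)⁻¹ =
      deriv (fun z => η.chart (ξ.chart.symm z)) z := by
    rw [hderiv, coordDeriv_apply ξ.chart _ (_)⁻¹,
      inv_mul_cancel₀ (ξ.coordDeriv_ne_zero hsource), mul_one, ξ.chart.right_inv htarget]
  rw [localRep, formCoeff, hform]
  exact congrArg (fun d => conj d • c (ξ.chart.symm z)) hconj

variable {𝔞 : Type u} [AddCommGroup 𝔞] [Module ℂ 𝔞] (T : CoordTrivialization F L 𝔞)
  (ξ : HolCoord X)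

/-- The isomorphism `𝔞 → 𝔞_ξ → L_x`. -/
def frameEquiv {x : X} (hx : x ∈ ξ.chart.source) : 𝔞 ≃ₗ[ℂ] L x :=
  (T.iso ξ).trans (LinearEquiv.ofBijective (T.triv ξ x) (T.bijective ξ x hx))

theorem frameEquiv_apply {x : X} (hx : x ∈ ξ.chart.source) (a : 𝔞) :
    frameEquiv T ξ hx a = frameSection T ξ a x := rfl

variable {ι : Type*} [Fintype ι] (e : Module.Basis ι ℂ 𝔞)

open Classical in
/-- The coefficients, in the coordinate `ξ`, of a section with respect to the frame `(e k)_ξ` given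
by a basis `e` of `𝔞`. -/
def frameCoeff (s : ∀ x, L x) (k : ι) (z : ℂ) : ℂ :=
  if hz : z ∈ ξ.chart.target then
    e.equivFun ((frameEquiv T ξ (ξ.chart.map_target hz)).symm (s (ξ.chart.symm z))) k
  else 0

theorem frameCoeff_of_mem (s : ∀ x, L x) (k : ι) {z : ℂ} (hz : z ∈ ξ.chart.target) :
    frameCoeff T ξ e s k z =
      e.equivFun ((frameEquiv T ξ (ξ.chart.map_target hz)).symm (s (ξ.chart.symm z))) k :=
  dif_pos hz

theorem sum_tensorSection_frameCoeff (s : ∀ x, L x) {x : X} (hx : x ∈ ξ.chart.source) :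
    ∑ k, tensorSection T ξ (e k) (frameCoeff T ξ e s k) x = s x := by
  obtain ⟨z, hz, rfl⟩ : ∃ z ∈ ξ.chart.target, ξ.chart.symm z = x :=
    ⟨ξ.chart x, ξ.chart.map_source hx, ξ.chart.left_inv hx⟩
  simp only [tensorSection_of_mem T ξ hx, ξ.chart.right_inv hz, frameCoeff_of_mem T ξ e s _ hz,
    ← frameEquiv_apply T ξ hx, ← map_smul]
  rw [← map_sum, e.sum_equivFun, LinearEquiv.apply_symm_apply]

theorem support_frameCoeff_subset {s : ∀ x, L x} {K : Set X}
    (hs : ∀ x ∈ ξ.chart.source, x ∉ K → s x = 0) (k : ι) :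
    Function.support (frameCoeff T ξ e s k) ⊆ ξ.chart '' K := by
  intro z hz
  by_cases hzt : z ∈ ξ.chart.target
  · refine ⟨ξ.chart.symm z, ?_, ξ.chart.right_inv hzt⟩
    by_contra hK
    refine hz ?_
    rw [frameCoeff_of_mem T ξ e s k hzt, hs _ (ξ.chart.map_target hzt) hK, map_zero, map_zero,
      Pi.zero_apply]
  · exact absurd (dif_neg hzt) hz

variable [VectorBundle ℂ F L]

/-- The frame `(e k)_ξ`, read in the coordinate `ξ` and the preferred trivialisation at `x₀`, as a
linear map `ℂ^ι → F`. -/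
def frameMap (x₀ : X) (z : ℂ) : (ι → ℂ) →L[ℂ] F :=
  ∑ k, (ContinuousLinearMap.proj (R := ℂ) (φ := fun _ : ι => ℂ) k).smulRight
    (localRep F ξ x₀ (frameSection T ξ (e k)) z)

theorem contDiffAt_frameMap {x₀ : X} (hx₀ : x₀ ∈ ξ.chart.source) :
    ContDiffAt ℂ ω (frameMap T ξ e x₀) (ξ.chart x₀) := by
  unfold frameMap
  exact ContDiffAt.sum fun k _ =>
    contDiffAt_const.smulRight (contDiffAt_localRep_frameSection T ξ hx₀ (e k))

theorem frameMap_apply {x₀ : X} {z : ℂ} (hz : ξ.chart.symm z ∈ ξ.chart.source) (v : ι → ℂ) :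
    frameMap T ξ e x₀ z v = (trivializationAt F L x₀).linearMapAt ℂ (ξ.chart.symm z)
      (frameEquiv T ξ hz (e.equivFun.symm v)) := by
  rw [Module.Basis.equivFun_symm_apply, map_sum, map_sum]
  simp [frameMap, localRep, frameEquiv_apply]

theorem isInvertible_frameMap {x₀ : X} {z : ℂ} (hz : ξ.chart.symm z ∈ ξ.chart.source)
    (hbase : ξ.chart.symm z ∈ (trivializationAt F L x₀).baseSet) :
    (frameMap T ξ e x₀ z).IsInvertible := by
  let E : (ι → ℂ) ≃ₗ[ℂ] F := (e.equivFun.symm.trans (frameEquiv T ξ hz)).trans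
    ((trivializationAt F L x₀).linearEquivAt ℂ _ hbase)
  have : FiniteDimensional ℂ F := E.finiteDimensional
  refine ⟨E.toContinuousLinearEquiv, ContinuousLinearMap.ext fun v => ?_⟩
  rw [frameMap_apply T ξ e hz, (trivializationAt F L x₀).linearMapAt_def_of_mem hbase]
  rfl

theorem frameCoeff_eq_inverse_frameMap (s : ∀ x, L x) {x₀ : X} {z : ℂ} (hz : z ∈ ξ.chart.target)
    (hbase : ξ.chart.symm z ∈ (trivializationAt F L x₀).baseSet) (k : ι) :
    frameCoeff T ξ e s k z = (frameMap T ξ e x₀ z).inverse (localRep F ξ x₀ s z) k := by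
  have hsource := ξ.chart.map_target hz
  rw [frameCoeff_of_mem T ξ e s k hz]
  refine congrFun (Eq.symm ?_) k
  rw [(isInvertible_frameMap T ξ e hsource hbase).inverse_apply_eq, frameMap_apply T ξ e hsource,
    LinearEquiv.symm_apply_apply, LinearEquiv.apply_symm_apply]
  rfl

theorem contDiffAt_frameCoeff {s : ∀ x, L x} {x₀ : X} (hx₀ : x₀ ∈ ξ.chart.source)
    (hs : ContDiffAt ℝ ∞ (localRep F ξ x₀ s) (ξ.chart x₀)) (k : ι) :
    ContDiffAt ℝ ∞ (frameCoeff T ξ e s k) (ξ.chart x₀) := by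
  have hnear := ξ.eventually_symm_mem hx₀ (baseSet_trivializationAt_mem_nhds F L x₀)
  have inverse_analytic :
      ContDiffAt ℂ ω (fun z => (frameMap T ξ e x₀ z).inverse) (ξ.chart x₀) := by
    obtain ⟨E, hE⟩ :=
      isInvertible_frameMap T ξ e hnear.self_of_nhds.2.1 hnear.self_of_nhds.2.2
    refine ContDiffAt.comp (g := ContinuousLinearMap.inverse) _ ?_ (contDiffAt_frameMap T ξ e hx₀)
    rw [← hE]
    exact contDiffAt_map_inverse E
  have inverse_smooth : ContDiffAt ℝ ∞
      (fun z => ((frameMap T ξ e x₀ z).inverse).restrictScalars ℝ) (ξ.chart x₀) :=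
    (ContinuousLinearMap.restrictScalarsL ℂ F (ι → ℂ) ℝ ℝ).contDiff.contDiffAt.comp (ξ.chart x₀)
      ((inverse_analytic.restrict_scalars ℝ).of_le le_top)
  refine (contDiffAt_pi.1 (inverse_smooth.clm_apply hs) k).congr_of_eventuallyEq ?_
  filter_upwards [hnear] with z ⟨htarget, _, hbase⟩
  exact frameCoeff_eq_inverse_frameMap T ξ e s htarget hbase k

theorem frameCoeff_mem_planeForm {s : ∀ x, L x}
    (hs : ∀ x ∈ ξ.chart.source, ContDiffAt ℝ ∞ (localRep F ξ x s) (ξ.chart x))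
    {K : Set X} (hK : IsCompact K) (hKs : K ⊆ ξ.chart.source)
    (hsupp : ∀ x ∈ ξ.chart.source, x ∉ K → s x = 0) (k : ι) :
    frameCoeff T ξ e s k ∈ PlaneForm ξ.chart.target := by
  refine mem_planeForm_of_support_subset
    (hK.image_of_continuousOn (ξ.chart.continuousOn.mono hKs)) ?_
    (support_frameCoeff_subset T ξ e hsupp k) ?_
  · rintro _ ⟨x, hx, rfl⟩
    exact ξ.chart.map_source (hKs hx)
  · rintro _ ⟨x, hx, rfl⟩
    exact contDiffAt_frameCoeff T ξ e (hKs hx) (hs x (hKs hx)) k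

end Coefficients

/-! ## Tensors as sections and forms -/

section TensorMaps

variable {F : Type u} [NormedAddCommGroup F] [NormedSpace ℂ F]
  {X : Type u} [TopologicalSpace X] [ChartedSpace ℂ X] [IsManifold 𝓘(ℂ, ℂ) ω X] [T2Space X]
  {L : X → Type u} [TopologicalSpace (TotalSpace F L)] [∀ x, AddCommGroup (L x)]
  [∀ x, Module ℂ (L x)] [∀ x, TopologicalSpace (L x)] [FiberBundle F L] [VectorBundle ℂ F L]
  {𝔞 : Type u} [AddCommGroup 𝔞] [Module ℂ 𝔞]
  (T : CoordTrivialization F L 𝔞) (ξ : HolCoord X) {V : Set X} (hV : ξ.chart.source ⊆ V)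

/-- The linear map `a ⊗ g ↦ a_ξ ⊗ ξ^* g`. -/
def sectionMap : 𝔞 ⊗[ℂ] PlaneForm ξ.chart.target →ₗ[ℂ] Omega0 F L V :=
  TensorProduct.lift (LinearMap.mk₂ ℂ
    (fun a g => ⟨tensorSection T ξ a g.1, tensorSection_mem_Omega0 T ξ hV a g.2⟩)
    (fun a a' g => Subtype.ext (funext (tensorSection_add_left T ξ a a' g.1)))
    (fun c a g => Subtype.ext (funext (tensorSection_smul_left T ξ c a g.1)))
    (fun a g g' => Subtype.ext (funext (tensorSection_add_right T ξ a g.1 g'.1)))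
    (fun c a g => Subtype.ext (funext (tensorSection_smul_right T ξ c a g.1))))

/-- The linear map `a ⊗ w ↦ a_ξ ⊗ ξ^* (w dλ̄)`. -/
def formMap : 𝔞 ⊗[ℂ] PlaneForm ξ.chart.target →ₗ[ℂ] Omega1 F L V :=
  TensorProduct.lift (LinearMap.mk₂ ℂ
    (fun a w => ⟨tensorForm T ξ a w.1, tensorForm_mem_Omega1 T ξ hV a w.2⟩)
    (fun a a' w => Subtype.ext (funext (tensorForm_add_left T ξ a a' w.1)))
    (fun c a w => Subtype.ext (funext (tensorForm_smul_left T ξ c a w.1)))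
    (fun a w w' => Subtype.ext (funext (tensorForm_add_right T ξ a w.1 w'.1)))
    (fun c a w => Subtype.ext (funext (tensorForm_smul_right T ξ c a w.1))))

theorem sectionMap_tmul (a : 𝔞) (g : PlaneForm ξ.chart.target) :
    (sectionMap T ξ hV (a ⊗ₜ g)).1 = tensorSection T ξ a g.1 := rfl

theorem formMap_tmul (a : 𝔞) (w : PlaneForm ξ.chart.target) :
    (formMap T ξ hV (a ⊗ₜ w)).1 = tensorForm T ξ a w.1 := rfl

theorem formMap_apply (t : 𝔞 ⊗[ℂ] PlaneForm ξ.chart.target) (x : X) (v : ℂ) :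
    (formMap T ξ hV t).1 x v = conj (coordDeriv ξ.chart x v) • (sectionMap T ξ hV t).1 x := by
  induction t using TensorProduct.induction_on with
  | zero => simp
  | tmul a w => rw [formMap_tmul, sectionMap_tmul, tensorForm_apply]
  | add s t hs ht =>
    rw [map_add, map_add]
    change (formMap T ξ hV s).1 x v + (formMap T ξ hV t).1 x v =
      _ • ((sectionMap T ξ hV s).1 x + (sectionMap T ξ hV t).1 x)
    rw [hs, ht, smul_add]

theorem sectionMap_of_notMem (t : 𝔞 ⊗[ℂ] PlaneForm ξ.chart.target) {x : X}
    (hx : x ∉ ξ.chart.source) : (sectionMap T ξ hV t).1 x = 0 := by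
  induction t using TensorProduct.induction_on with
  | zero => simp
  | tmul a w => exact tensorSection_of_notMem T ξ hx
  | add s t hs ht =>
    rw [map_add]
    change (sectionMap T ξ hV s).1 x + (sectionMap T ξ hV t).1 x = 0
    rw [hs, ht, add_zero]

theorem sectionMap_sum_tmul {ι : Type*} [Fintype ι] (a : ι → 𝔞)
    (g : ι → PlaneForm ξ.chart.target) (x : X) :
    (sectionMap T ξ hV (∑ k, a k ⊗ₜ g k)).1 x = ∑ k, tensorSection T ξ (a k) (g k).1 x := by
  rw [map_sum, Submodule.coe_sum, Finset.sum_apply]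
  rfl

theorem dbar_sectionMap [ContMDiffVectorBundle ω F L 𝓘(ℂ, ℂ)]
    (t : 𝔞 ⊗[ℂ] PlaneForm ξ.chart.target) :
    dbar F L V (sectionMap T ξ hV t) =
      formMap T ξ hV ((planeDbarMap ξ.chart.target).lTensor 𝔞 t) := by
  induction t using TensorProduct.induction_on with
  | zero => simp only [map_zero]
  | tmul a g =>
    apply Subtype.ext
    rw [LinearMap.lTensor_tmul, formMap_tmul]
    exact dbarSection_tensorSection T ξ a g.2
  | add s t hs ht => simp only [map_add, hs, ht]

variable [FiniteDimensional ℂ 𝔞]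

theorem eq_zero_of_sectionMap_eq_zero {t : 𝔞 ⊗[ℂ] PlaneForm ξ.chart.target}
    (ht : ∀ x ∈ ξ.chart.source, (sectionMap T ξ hV t).1 x = 0) : t = 0 := by
  let e := Module.finBasis ℂ 𝔞
  obtain ⟨g, rfl⟩ := TensorProduct.eq_repr_basis_left e t
  rw [Finsupp.sum_fintype _ _ fun k => TensorProduct.tmul_zero _ _] at ht ⊢
  have hg : ∀ k, g k = 0 := by
    refine fun k => Subtype.ext (funext fun z => ?_)
    by_cases hz : z ∈ ξ.chart.target
    · have hx := ξ.chart.map_target hz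
      have hsum := ht _ hx
      simp only [sectionMap_sum_tmul, tensorSection_of_mem T ξ hx, ξ.chart.right_inv hz,
        ← frameEquiv_apply T ξ hx, ← map_smul] at hsum
      rw [← map_sum, LinearEquiv.map_eq_zero_iff] at hsum
      exact Fintype.linearIndependent_iff.1 e.linearIndependent (fun k => (g k).1 z) hsum k
    · exact image_eq_zero_of_notMem_tsupport fun h => hz ((g k).2.2.2 h)
  simp only [hg, TensorProduct.tmul_zero, Finset.sum_const_zero]

theorem exists_sectionMap_eq {s : ∀ x, L x}
    (hs : ∀ x ∈ ξ.chart.source, ContDiffAt ℝ ∞ (localRep F ξ x s) (ξ.chart x))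
    {K : Set X} (hK : IsCompact K) (hKs : K ⊆ ξ.chart.source)
    (hsupp : ∀ x ∈ ξ.chart.source, x ∉ K → s x = 0) :
    ∃ t : 𝔞 ⊗[ℂ] PlaneForm ξ.chart.target,
      ∀ x ∈ ξ.chart.source, (sectionMap T ξ hV t).1 x = s x := by
  let e := Module.finBasis ℂ 𝔞
  refine ⟨∑ k, e k ⊗ₜ ⟨frameCoeff T ξ e s k, frameCoeff_mem_planeForm T ξ e hs hK hKs hsupp k⟩,
    fun x hx => ?_⟩
  rw [sectionMap_sum_tmul]
  exact sum_tensorSection_frameCoeff T ξ e s hx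

end TensorMaps

/-! ## Sections and forms over a union of coordinate domains -/

namespace BoundedCoords

variable {X : Type u} [TopologicalSpace X] [ChartedSpace ℂ X] {V : Set X} (ξ : BoundedCoords V)

theorem source_subset (j : Fin ξ.m) : (ξ.coord j).chart.source ⊆ V :=
  (subset_iUnion (fun j => (ξ.coord j).chart.source) j).trans_eq ξ.iUnion_eq

theorem exists_mem {x : X} (hx : x ∈ V) : ∃ j, x ∈ (ξ.coord j).chart.source :=
  mem_iUnion.1 (ξ.iUnion_eq.symm ▸ hx)

theorem notMem_of_ne {x : X} {j k : Fin ξ.m} (hx : x ∈ (ξ.coord j).chart.source) (hkj : k ≠ j) :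
    x ∉ (ξ.coord k).chart.source := fun hk =>
  (ξ.disjoint hkj).le_bot ⟨hk, hx⟩

theorem isCompact_inter_source {K : Set X} (hK : IsCompact K) (hKV : K ⊆ V) (j : Fin ξ.m) :
    IsCompact (K ∩ (ξ.coord j).chart.source) := by
  have inter_eq_diff : K ∩ (ξ.coord j).chart.source =
      K \ ⋃ k ∈ {k | k ≠ j}, (ξ.coord k).chart.source := by
    ext x
    simp only [mem_inter_iff, Set.mem_sdiff, mem_iUnion, mem_ofPred_eq, exists_prop, not_exists,
      not_and]
    refine and_congr_right fun hx => ⟨fun hj k hkj => ξ.notMem_of_ne hj hkj, fun h => ?_⟩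
    obtain ⟨k, hk⟩ := ξ.exists_mem (hKV hx)
    by_cases hkj : k = j
    · exact hkj ▸ hk
    · exact absurd hk (h k hkj)
  rw [inter_eq_diff]
  exact hK.diff (isOpen_biUnion fun k _ => (ξ.coord k).chart.open_source)

end BoundedCoords

theorem CompactSuppIn.eq_zero_of_notMem {X : Type u} [TopologicalSpace X] {V : Set X}
    {E : X → Type u} [∀ x, Zero (E x)] {s : ∀ x, E x} (hs : CompactSuppIn V s) {x : X}
    (hx : x ∉ V) : s x = 0 := by
  by_contra hne
  exact hx (hs.2 (subset_closure hne))

section Global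

variable {F : Type u} [NormedAddCommGroup F] [NormedSpace ℂ F]
  {X : Type u} [TopologicalSpace X] [ChartedSpace ℂ X] [IsManifold 𝓘(ℂ, ℂ) ω X] [T2Space X]
  {L : X → Type u} [TopologicalSpace (TotalSpace F L)] [∀ x, AddCommGroup (L x)]
  [∀ x, Module ℂ (L x)] [∀ x, TopologicalSpace (L x)] [FiberBundle F L] [VectorBundle ℂ F L]
  {𝔞 : Type u} [AddCommGroup 𝔞] [Module ℂ 𝔞] {V : Set X} (ξ : BoundedCoords V)
  (T : CoordTrivialization F L 𝔞)

/-- The sum over the coordinate domains of the maps `a ⊗ g ↦ a_ξ ⊗ ξ^* g`. -/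
def totalSection : (∀ j, 𝔞 ⊗[ℂ] PlaneForm (ξ.image j)) →ₗ[ℂ] Omega0 F L V :=
  LinearMap.lsum ℂ _ ℂ fun j => sectionMap T (ξ.coord j) (ξ.source_subset j)

/-- The sum over the coordinate domains of the maps `a ⊗ w ↦ a_ξ ⊗ ξ^* (w dλ̄)`. -/
def totalForm : (∀ j, 𝔞 ⊗[ℂ] PlaneForm (ξ.image j)) →ₗ[ℂ] Omega1 F L V :=
  LinearMap.lsum ℂ _ ℂ fun j => formMap T (ξ.coord j) (ξ.source_subset j)

theorem totalSection_single (j : Fin ξ.m) (a : 𝔞) (g : PlaneForm (ξ.image j)) :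
    (totalSection ξ T (Pi.single j (a ⊗ₜ g))).1 = tensorSection T (ξ.coord j) a g.1 := by
  rw [totalSection, LinearMap.lsum_piSingle, sectionMap_tmul]

theorem totalForm_single (j : Fin ξ.m) (a : 𝔞) (w : PlaneForm (ξ.image j)) :
    (totalForm ξ T (Pi.single j (a ⊗ₜ w))).1 = tensorForm T (ξ.coord j) a w.1 := by
  rw [totalForm, LinearMap.lsum_piSingle, formMap_tmul]

variable (t : ∀ j, 𝔞 ⊗[ℂ] PlaneForm (ξ.image j))

theorem totalSection_of_mem {x : X} {j : Fin ξ.m} (hx : x ∈ (ξ.coord j).chart.source) :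
    (totalSection ξ T t).1 x = (sectionMap T (ξ.coord j) (ξ.source_subset j) (t j)).1 x := by
  rw [totalSection, LinearMap.lsum_apply, LinearMap.sum_apply, Submodule.coe_sum, Finset.sum_apply]
  exact Fintype.sum_eq_single j fun k hk =>
    sectionMap_of_notMem T _ (ξ.source_subset k) _ (ξ.notMem_of_ne hx hk)

theorem totalForm_of_mem {x : X} {j : Fin ξ.m} (hx : x ∈ (ξ.coord j).chart.source) (v : ℂ) :
    (totalForm ξ T t).1 x v =
      conj (coordDeriv (ξ.coord j).chart x v) • (totalSection ξ T t).1 x := by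
  rw [totalSection_of_mem ξ T t hx, ← formMap_apply, totalForm, LinearMap.lsum_apply,
    LinearMap.sum_apply, Submodule.coe_sum, Finset.sum_apply, LinearMap.sum_apply]
  refine Fintype.sum_eq_single j fun k hk => ?_
  change (formMap T (ξ.coord k) (ξ.source_subset k) (t k)).1 x v = 0
  rw [formMap_apply, sectionMap_of_notMem T _ _ _ (ξ.notMem_of_ne hx hk), smul_zero]

theorem dbar_totalSection [ContMDiffVectorBundle ω F L 𝓘(ℂ, ℂ)] :
    dbar F L V (totalSection ξ T t) =
      totalForm ξ T (LinearMap.piMap (fun j => (planeDbarMap (ξ.image j)).lTensor 𝔞) t) := by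
  simp only [totalSection, totalForm, LinearMap.lsum_apply, LinearMap.sum_apply,
    LinearMap.comp_apply, LinearMap.proj_apply, map_sum, dbar_sectionMap]
  rfl

variable [FiniteDimensional ℂ 𝔞]

theorem totalSection_injective : Function.Injective (totalSection ξ T) := by
  refine (injective_iff_map_eq_zero _).2 fun t ht => funext fun j => ?_
  refine eq_zero_of_sectionMap_eq_zero T (ξ.coord j) (ξ.source_subset j) fun x hx => ?_
  rw [← totalSection_of_mem ξ T t hx, ht]
  rfl

theorem totalForm_injective : Function.Injective (totalForm ξ T) := by
  refine (injective_iff_map_eq_zero _).2 fun t ht => ?_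
  refine (injective_iff_map_eq_zero _).1 (totalSection_injective ξ T) t ?_
  refine Subtype.ext (funext fun x => ?_)
  by_cases hx : x ∈ V
  · obtain ⟨j, hj⟩ := ξ.exists_mem hx
    have hsmul := totalForm_of_mem ξ T t hj 1
    rw [ht] at hsmul
    exact (smul_eq_zero.1 hsmul.symm).resolve_left
      ((map_ne_zero _).2 ((ξ.coord j).coordDeriv_ne_zero hj))
  · exact (totalSection ξ T t).2.2.eq_zero_of_notMem hx

theorem exists_totalSection_eq {s : Fin ξ.m → ∀ x, L x}
    (hs : ∀ j, ∀ x ∈ (ξ.coord j).chart.source,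
      ContDiffAt ℝ ∞ (localRep F (ξ.coord j) x (s j)) ((ξ.coord j).chart x))
    {K : Set X} (hK : IsCompact K) (hKV : K ⊆ V) (hsupp : ∀ j, ∀ x ∉ K, s j x = 0) :
    ∃ t, ∀ j, ∀ x ∈ (ξ.coord j).chart.source, (totalSection ξ T t).1 x = s j x := by
  choose t ht using fun j => exists_sectionMap_eq T (ξ.coord j) (ξ.source_subset j) (hs j)
    (ξ.isCompact_inter_source hK hKV j) inter_subset_right
    fun x hx hxK => hsupp j x fun h => hxK ⟨h, hx⟩
  exact ⟨t, fun j x hx => (totalSection_of_mem ξ T t hx).trans (ht j x hx)⟩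

theorem totalSection_surjective : Function.Surjective (totalSection ξ T) := by
  intro s
  obtain ⟨t, ht⟩ := exists_totalSection_eq ξ T (s := fun _ => s.1)
    (fun j x hx => ((ξ.coord j).contMDiffAt_iff hx).1 (s.2.1 x)) s.2.2.1 s.2.2.2
    fun _ x hx => by_contra fun hne => hx (subset_closure hne)
  refine ⟨t, Subtype.ext (funext fun x => ?_)⟩
  by_cases hx : x ∈ V
  · obtain ⟨j, hj⟩ := ξ.exists_mem hx
    exact ht j x hj
  · rw [s.2.2.eq_zero_of_notMem hx, (totalSection ξ T t).2.2.eq_zero_of_notMem hx]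

theorem totalForm_surjective : Function.Surjective (totalForm ξ T) := by
  intro s
  have formCoeff_eq_zero : ∀ (j : Fin ξ.m), ∀ x ∉ closure {x | s.1 x ≠ 0},
      formCoeff (ξ.coord j) s.1 x = 0 := fun j x hx => by
    have hsx : s.1 x = 0 := by_contra fun hne => hx (subset_closure hne)
    rw [formCoeff, hsx, LinearMap.zero_apply]
  obtain ⟨t, ht⟩ := exists_totalSection_eq ξ T
    (fun j x hx => contDiffAt_localRep_formCoeff (ξ.coord j) s.2.1 hx) s.2.2.1 s.2.2.2
    formCoeff_eq_zero
  refine ⟨t, Subtype.ext (funext fun x => LinearMap.ext fun v => ?_)⟩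
  by_cases hx : x ∈ V
  · obtain ⟨j, hj⟩ := ξ.exists_mem hx
    rw [totalForm_of_mem ξ T t hj, ht j x hj, conj_coordDeriv_smul_formCoeff _ _ hj]
  · rw [s.2.2.eq_zero_of_notMem hx, (totalForm ξ T t).2.2.eq_zero_of_notMem hx]

/-- The identification of `⨁_j 𝔞 ⊗ Ω⁰_c(ξ_j(W_j))` with the sections over `V`. -/
def sectionEquiv : (∀ j, 𝔞 ⊗[ℂ] PlaneForm (ξ.image j)) ≃ₗ[ℂ] Omega0 F L V :=
  LinearEquiv.ofBijective (totalSection ξ T)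
    ⟨totalSection_injective ξ T, totalSection_surjective ξ T⟩

/-- The identification of `⨁_j 𝔞 ⊗ Ω^{0,1}_c(ξ_j(W_j))` with the `(0,1)`-forms over `V`. -/
def formEquiv : (∀ j, 𝔞 ⊗[ℂ] PlaneForm (ξ.image j)) ≃ₗ[ℂ] Omega1 F L V :=
  LinearEquiv.ofBijective (totalForm ξ T) ⟨totalForm_injective ξ T, totalForm_surjective ξ T⟩

end Global

/-! ## Retracts of two-term complexes -/

section TwoTermMaps

variable {A B A' B' : Type u} [AddCommGroup A] [Module ℂ A] [AddCommGroup B] [Module ℂ B]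
  [AddCommGroup A'] [Module ℂ A'] [AddCommGroup B'] [Module ℂ B']

/-- The components of the chain map of two-term complexes given by `f₀` in degree `0` and `f₁` in
degree `1`. -/
def twoTermF (f₀ : A →ₗ[ℂ] A') (f₁ : B →ₗ[ℂ] B') : ∀ n : ℤ, twoTermX A B n ⟶ twoTermX A' B' n
  | .ofNat 0 => ModuleCat.ofHom f₀
  | .ofNat 1 => ModuleCat.ofHom f₁
  | .ofNat (_ + 2) => 0
  | .negSucc _ => 0

/-- The chain map of two-term complexes given by `f₀` in degree `0` and `f₁` in degree `1`. -/
def twoTermMap {d : A →ₗ[ℂ] B} {d' : A' →ₗ[ℂ] B'} (f₀ : A →ₗ[ℂ] A') (f₁ : B →ₗ[ℂ] B')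
    (h : d' ∘ₗ f₀ = f₁ ∘ₗ d) : twoTerm d ⟶ twoTerm d' where
  f := twoTermF f₀ f₁
  comm' m n _ := by
    change twoTermF f₀ f₁ m ≫ twoTermD d' m n = twoTermD d m n ≫ twoTermF f₀ f₁ n
    by_cases hmn : m = 0 ∧ n = 1
    · obtain ⟨rfl, rfl⟩ := hmn
      exact congrArg ModuleCat.ofHom h
    · rw [twoTermD_eq_zero d m n hmn, twoTermD_eq_zero d' m n hmn, Limits.comp_zero,
        Limits.zero_comp]

/-- The components of the degree `-1` map given by `h`. -/
def twoTermH (h : B →ₗ[ℂ] A) : ∀ m n : ℤ, twoTermX A B m ⟶ twoTermX A B n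
  | .ofNat 1, .ofNat 0 => ModuleCat.ofHom h
  | _, _ => 0

theorem twoTermH_eq_zero (h : B →ₗ[ℂ] A) (m n : ℤ) (hmn : ¬(m = 1 ∧ n = 0)) :
    twoTermH h m n = 0 := by
  rcases m with (_ | _ | m) | m
  · rfl
  · rcases n with (_ | n) | n
    · exact absurd ⟨rfl, rfl⟩ hmn
    · rfl
    · rfl
  · rfl
  · rfl

theorem twoTermH_comp_twoTermH (h : B →ₗ[ℂ] A) (l m n : ℤ) :
    twoTermH h l m ≫ twoTermH h m n = 0 := by
  by_cases hlm : l = 1 ∧ m = 0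
  · rw [twoTermH_eq_zero h m n fun h => by omega, Limits.comp_zero]
  · rw [twoTermH_eq_zero h l m hlm, Limits.zero_comp]

theorem isZero_twoTermX {n : ℤ} (h0 : n ≠ 0) (h1 : n ≠ 1) : Limits.IsZero (twoTermX A B n) := by
  have isZero_punit := ModuleCat.isZero_of_subsingleton (ModuleCat.of ℂ PUnit.{u + 1})
  rcases n with (_ | _ | n) | n
  · exact absurd rfl h0
  · exact absurd rfl h1
  · exact isZero_punit
  · exact isZero_punit

theorem isZero_twoTermX_of_subsingleton [Subsingleton A] {n : ℤ} (h1 : n ≠ 1) :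
    Limits.IsZero (twoTermX A B n) := by
  by_cases h0 : n = 0
  · subst h0
    exact ModuleCat.isZero_of_subsingleton (ModuleCat.of ℂ A)
  · exact isZero_twoTermX h0 h1

end TwoTermMaps

section TwoTermRetracts

variable {A B G : Type u} [AddCommGroup A] [Module ℂ A] [AddCommGroup B] [Module ℂ B]
  [AddCommGroup G] [Module ℂ G] {d : A →ₗ[ℂ] B} {i : G →ₗ[ℂ] B} {p : B →ₗ[ℂ] G} {h : B →ₗ[ℂ] A}

theorem IsTwoTermRetract.homotopy (H : IsTwoTermRetract d i p h) (n : ℤ) :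
    twoTermF (0 : A →ₗ[ℂ] PUnit.{u + 1}) p n ≫ twoTermF 0 i n - 𝟙 (twoTermX A B n) =
      -(twoTermH h n (n - 1) ≫ twoTermD d (n - 1) n +
        twoTermD d n (n + 1) ≫ twoTermH h (n + 1) n) := by
  by_cases h0 : n = 0
  · subst h0
    have proj_zero : twoTermF (0 : A →ₗ[ℂ] PUnit.{u + 1}) p 0 = 0 := rfl
    rw [twoTermH_eq_zero h 0 (0 - 1) (by simp), Limits.zero_comp, zero_add, proj_zero,
      Limits.zero_comp, zero_sub]
    exact congrArg (fun f : A →ₗ[ℂ] A => -ModuleCat.ofHom f) H.contr_comp_diff.symm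
  by_cases h1 : n = 1
  · subst h1
    rw [twoTermD_eq_zero d 1 (1 + 1) (by simp), Limits.zero_comp, add_zero]
    have hlin : i ∘ₗ p - LinearMap.id = -(d ∘ₗ h) := by rw [H.diff_comp_contr, neg_sub]
    exact congrArg (fun f : B →ₗ[ℂ] B => ModuleCat.ofHom f) hlin
  · exact (isZero_twoTermX h0 h1).eq_of_src _ _

/-- The pointed DG vector space given by the two-term complex `d` and the map `u` from `ℂ` to its
cocycles of degree `1`. -/
def pointedTwoTerm (d : A →ₗ[ℂ] B) (u : ℂ →ₗ[ℂ] B) : PointedComplex.{u} :=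
  ⟨twoTerm d, u, fun _ => rfl⟩

/-- The strong deformation retract of pointed DG vector spaces given by a two-term retract whose
inclusion respects the distinguished maps from `ℂ`. -/
def IsTwoTermRetract.strongDeformationRetract (H : IsTwoTermRetract d i p h) {uG : ℂ →ₗ[ℂ] G}
    {uB : ℂ →ₗ[ℂ] B} (hu : ∀ z, i (uG z) = uB z) :
    StrongDeformationRetract (pointedTwoTerm (0 : PUnit.{u + 1} →ₗ[ℂ] G) uG)
      (pointedTwoTerm d uB) where
  i := ⟨twoTermMap 0 i (by simp), hu⟩
  p := ⟨twoTermMap 0 p (LinearMap.ext fun x => by simp [H.proj_diff]), fun z => by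
    change p (uB z) = uG z
    rw [← hu, H.proj_incl]⟩
  h := twoTermH h
  h_degree m n hmn := twoTermH_eq_zero h m n fun h => hmn (by omega)
  p_i := by
    ext1 n
    by_cases h1 : n = 1
    · subst h1
      exact congrArg ModuleCat.ofHom H.proj_comp_incl
    · exact (isZero_twoTermX_of_subsingleton (A := PUnit.{u + 1}) (B := G) h1).eq_of_src _ _
  homotopy := H.homotopy
  p_h m n := by
    change twoTermH h m n ≫ twoTermF 0 p n = 0
    by_cases hmn : m = 1 ∧ n = 0
    · obtain ⟨rfl, rfl⟩ := hmn
      exact Limits.comp_zero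
    · rw [twoTermH_eq_zero h m n hmn, Limits.zero_comp]
  h_i m n := by
    change twoTermF 0 i m ≫ twoTermH h m n = 0
    by_cases hmn : m = 1 ∧ n = 0
    · obtain ⟨rfl, rfl⟩ := hmn
      exact congrArg ModuleCat.ofHom (LinearMap.ext H.contr_incl)
    · rw [twoTermH_eq_zero h m n hmn, Limits.comp_zero]
  h_h := twoTermH_comp_twoTermH h

end TwoTermRetracts

namespace StrongDeformationRetract

variable {A B : PointedComplex.{u}}

/-- The homotopy equivalence underlying a strong deformation retract; its homotopy is `-h`. -/
def homotopyEquiv (S : StrongDeformationRetract A B) : HomotopyEquiv B.cx A.cx where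
  hom := S.p.map
  inv := S.i.map
  homotopyHomInvId :=
    { hom := fun m n => -S.h m n
      zero := fun m n hmn => by
        rw [S.h_degree m n hmn, neg_zero]
      comm := fun n => by
        rw [dNext_eq (c := ComplexShape.up ℤ) _ (i' := n + 1) rfl,
          prevD_eq (c := ComplexShape.up ℤ) _ (j' := n - 1) (by simp),
          Preadditive.comp_neg, Preadditive.neg_comp, HomologicalComplex.id_f,
          sub_eq_iff_eq_add.1 (S.homotopy n)]
        abel }
  homotopyInvHomId := Homotopy.ofEq S.p_i

theorem isZero_homology (S : StrongDeformationRetract A B) {n : ℤ}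
    (h : Limits.IsZero (A.cx.X n)) : Limits.IsZero (B.cx.homology n) := by
  refine Limits.IsZero.of_iso ?_ (S.homotopyEquiv.toHomologyIso n)
  exact (A.cx.exactAt_iff_isZero_homology n).1 (ShortComplex.exact_of_isZero_X₂ _ h)

theorem exists_homologyIso (S : StrongDeformationRetract A B) (n : ℤ)
    (d_to : A.cx.d (n - 1) n = 0) (d_from : A.cx.d n (n + 1) = 0) :
    ∃ Φ : B.cx.homology n ≅ A.cx.X n,
      B.cx.homologyπ n ≫ Φ.hom = B.cx.iCycles n ≫ S.p.map.f n := by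
  have := A.cx.isIso_homologyπ (n - 1) n (by simp) d_to
  have := A.cx.isIso_iCycles n (n + 1) (by simp) d_from
  refine ⟨S.homotopyEquiv.toHomologyIso n ≪≫ (asIso (A.cx.homologyπ n)).symm ≪≫
    asIso (A.cx.iCycles n), ?_⟩
  change B.cx.homologyπ n ≫ HomologicalComplex.homologyMap S.p.map n ≫
    inv (A.cx.homologyπ n) ≫ A.cx.iCycles n = _
  rw [HomologicalComplex.homologyπ_naturality_assoc, IsIso.hom_inv_id_assoc,
    HomologicalComplex.cyclesMap_i]

end StrongDeformationRetract

/-! ## The retract onto germs -/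

section GermRetract

theorem piMap_lTensor_single {R M J : Type*} [CommRing R] [AddCommGroup M] [Module R M]
    [DecidableEq J] {A B : J → Type*} [∀ j, AddCommGroup (A j)] [∀ j, AddCommGroup (B j)]
    [∀ j, Module R (A j)] [∀ j, Module R (B j)] (f : ∀ j, A j →ₗ[R] B j) (j : J) (m : M)
    (x : A j) :
    LinearMap.piMap (fun j => (f j).lTensor M) (Pi.single j (m ⊗ₜ x)) =
      Pi.single j (m ⊗ₜ f j x) :=
  funext fun k => Pi.apply_single (fun j => (f j).lTensor M) (fun _ => map_zero _) j (m ⊗ₜ x) k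

variable {F : Type u} [NormedAddCommGroup F] [NormedSpace ℂ F]
  {X : Type u} [TopologicalSpace X] [ChartedSpace ℂ X] [IsManifold 𝓘(ℂ, ℂ) ω X] [T2Space X]
  {L : X → Type u} [TopologicalSpace (TotalSpace F L)] [∀ x, AddCommGroup (L x)]
  [∀ x, Module ℂ (L x)] [∀ x, TopologicalSpace (L x)] [FiberBundle F L] [VectorBundle ℂ F L]
  {𝔞 : Type u} [AddCommGroup 𝔞] [Module ℂ 𝔞] [FiniteDimensional ℂ 𝔞] {V : Set X}
  (ξ : BoundedCoords V) (T : CoordTrivialization F L 𝔞) (c : ∀ j, LiftChoice (ξ.image j))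

/-- The map `(a_j ⊗ f_j)_j ↦ ∑_j (a_j)_{ξ_j} ⊗ ξ_j^* ⌈f_j⌉`. -/
def germInclusion : (∀ j, 𝔞 ⊗[ℂ] OInfty (ξ.image j)) →ₗ[ℂ] Omega1 F L V :=
  formEquiv ξ T ∘ₗ LinearMap.piMap fun j => (c j).lift.lTensor 𝔞

/-- The map `∑_j (a_j)_{ξ_j} ⊗ ξ_j^* ω_j ↦ (a_j ⊗ [ω_j^↓])_j`. -/
def germProjection : Omega1 F L V →ₗ[ℂ] ∀ j, 𝔞 ⊗[ℂ] OInfty (ξ.image j) :=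
  (LinearMap.piMap fun j => (down (ξ.image j)).lTensor 𝔞) ∘ₗ (formEquiv ξ T).symm

/-- The map `∑_j (a_j)_{ξ_j} ⊗ ξ_j^* ω_j ↦ ∑_j (a_j)_{ξ_j} ⊗ ξ_j^* (ω_j - ⌈ω_j^↓⌉)^↓`. -/
def germContraction : Omega1 F L V →ₗ[ℂ] Omega0 F L V :=
  sectionEquiv ξ T ∘ₗ (LinearMap.piMap fun j => (c j).contraction.lTensor 𝔞) ∘ₗ
    (formEquiv ξ T).symm

theorem isTwoTermRetract_dbar [ContMDiffVectorBundle ω F L 𝓘(ℂ, ℂ)] :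
    IsTwoTermRetract (dbar F L V) (germInclusion ξ T c) (germProjection ξ T)
      (germContraction ξ T c) :=
  (IsTwoTermRetract.piMap fun j => (c j).isTwoTermRetract.lTensor 𝔞).congr (sectionEquiv ξ T)
    (formEquiv ξ T) fun t => dbar_totalSection ξ T t

theorem eq_formEquiv_single {j : Fin ξ.m} {a : 𝔞} {w : PlaneForm (ξ.image j)} {s : Omega1 F L V}
    (hs : s.1 = tensorForm T (ξ.coord j) a w.1) : s = formEquiv ξ T (Pi.single j (a ⊗ₜ w)) :=
  Subtype.ext (hs.trans (totalForm_single ξ T j a w).symm)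

theorem germInclusion_single (j : Fin ξ.m) (a : 𝔞) (f : OInfty (ξ.image j)) :
    (germInclusion ξ T c (Pi.single j (a ⊗ₜ f))).1 =
      tensorForm T (ξ.coord j) a ((c j).lift f).1 := by
  rw [germInclusion, LinearMap.comp_apply, piMap_lTensor_single]
  exact totalForm_single ξ T j a _

theorem germProjection_eq_single {j : Fin ξ.m} {a : 𝔞} {w : PlaneForm (ξ.image j)}
    {s : Omega1 F L V} (hs : s.1 = tensorForm T (ξ.coord j) a w.1) :
    germProjection ξ T s = Pi.single j (a ⊗ₜ down (ξ.image j) w) := by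
  rw [eq_formEquiv_single ξ T hs, germProjection, LinearMap.comp_apply, LinearEquiv.coe_coe,
    LinearEquiv.symm_apply_apply, piMap_lTensor_single]

theorem germContraction_eq_tensorSection {j : Fin ξ.m} {a : 𝔞} {w : PlaneForm (ξ.image j)}
    {s : Omega1 F L V} (hs : s.1 = tensorForm T (ξ.coord j) a w.1) :
    (germContraction ξ T c s).1 = tensorSection T (ξ.coord j) a
      (cauchyTransform (w - (c j).lift (down (ξ.image j) w)).1) := by
  rw [eq_formEquiv_single ξ T hs, germContraction, LinearMap.comp_apply, LinearMap.comp_apply,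
    LinearEquiv.coe_coe, LinearEquiv.coe_coe, LinearEquiv.symm_apply_apply, piMap_lTensor_single]
  exact totalSection_single ξ T j a _

variable [ContMDiffVectorBundle ω F L 𝓘(ℂ, ℂ)] {b : DGLieBracket F L} (α : TwoCocycle b)

/-- The strong deformation retract of `Ω^{0,•}_c(V, L) ⊕ ℂ 𝟏` given by `germInclusion`,
`germProjection` and `germContraction`. -/
def germRetract : StrongDeformationRetract (germComplex 𝔞 ξ) (twistedComplex α V) :=
  ((isTwoTermRetract_dbar ξ T c).prodRight ℂ).strongDeformationRetract
    (uG := LinearMap.inr ℂ _ ℂ) (uB := LinearMap.inr ℂ _ ℂ) fun _ =>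
      Prod.ext (map_zero (germInclusion ξ T c)) rfl

theorem isInclusion_germRetract : IsInclusion T ξ c (germRetract ξ T c α).i :=
  ⟨fun j a f => ⟨germInclusion_single ξ T c j a f, rfl⟩,
    fun _ => Prod.ext (map_zero (germInclusion ξ T c)) rfl⟩

theorem isProjection_germRetract : IsProjection T ξ (germRetract ξ T c α).p :=
  ⟨fun j _ w _ hs => ⟨down (ξ.image j) w, isDownGerm_down w,
    Prod.ext (germProjection_eq_single ξ T hs) rfl⟩,
    fun _ => Prod.ext (map_zero (germProjection ξ T)) rfl⟩

theorem isContraction_germRetract : IsContraction T ξ c (germRetract ξ T c α).h :=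
  ⟨fun j _ w _ hs => ⟨down (ξ.image j) w, isDownGerm_down w,
    germContraction_eq_tensorSection ξ T c hs⟩,
    fun _ => map_zero (germContraction ξ T c)⟩

end GermRetract

end CFT

end

open CFT in
theorem mainTheorem5_general
    {X : Type u} [TopologicalSpace X] [T2Space X] [ChartedSpace ℂ X] [IsManifold 𝓘(ℂ, ℂ) ω X]
    {F : Type u} [NormedAddCommGroup F] [NormedSpace ℂ F]
    {L : X → Type u} [TopologicalSpace (TotalSpace F L)] [∀ x, AddCommGroup (L x)]
    [∀ x, Module ℂ (L x)] [∀ x, TopologicalSpace (L x)] [FiberBundle F L] [VectorBundle ℂ F L]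
    [ContMDiffVectorBundle ω F L 𝓘(ℂ, ℂ)]
    {b : DGLieBracket F L} (α : TwoCocycle b)
    {𝔞 : Type u} [AddCommGroup 𝔞] [Module ℂ 𝔞] (T : CoordTrivialization F L 𝔞)
    {V : Set X} (ξ : BoundedCoords V) (c : ∀ j, LiftChoice (ξ.image j)) :
    ∃ S : StrongDeformationRetract (germComplex 𝔞 ξ) (twistedComplex α V),
      IsInclusion T ξ c S.i ∧ IsProjection T ξ S.p ∧ IsContraction T ξ c S.h ∧
      Limits.IsZero ((twistedComplex α V).cx.homology 0) ∧
      ∃ Φ : (twistedComplex α V).cx.homology 1 ≅ ModuleCat.of ℂ (GermSpace 𝔞 ξ),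
        (twistedComplex α V).cx.homologyπ 1 ≫ Φ.hom =
          (twistedComplex α V).cx.iCycles 1 ≫ S.p.map.f 1 := by
  have j : Fin ξ.m := ⟨0, by have := ξ.m_eq; omega⟩
  have : FiniteDimensional ℂ 𝔞 := (T.iso (ξ.coord j)).symm.finiteDimensional
  exact ⟨germRetract ξ T c α, isInclusion_germRetract ξ T c α, isProjection_germRetract ξ T c α,
    isContraction_germRetract ξ T c α,
    (germRetract ξ T c α).isZero_homology
      (ModuleCat.isZero_of_subsingleton (ModuleCat.of ℂ PUnit.{u + 1})),
    (germRetract ξ T c α).exists_homologyIso 1 rfl rfl⟩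

open CFT in
theorem mainTheorem5
    -- the conformal surface
    {M : Type u} [TopologicalSpace M] [T2Space M] [SecondCountableTopology M] [ConnectedSpace M]
    [ChartedSpace HalfPlane M] [HasGroupoid M conformalGroupoid]
    -- the holomorphic vector bundle over the double, with its Lie bracket and cocycle
    {F : Type u} [NormedAddCommGroup F] [NormedSpace ℂ F] [FiniteDimensional ℂ F]
    {L : Double M → Type u} [TopologicalSpace (TotalSpace F L)] [∀ x, AddCommGroup (L x)]
    [∀ x, Module ℂ (L x)] [∀ x, TopologicalSpace (L x)] [FiberBundle F L] [VectorBundle ℂ F L]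
    [ContMDiffVectorBundle ω F L 𝓘(ℂ, ℂ)]
    {b : DGLieBracket F L} (α : TwoCocycle b)
    {𝔞 : Type u} [AddCommGroup 𝔞] [Module ℂ 𝔞] (T : CoordTrivialization F L 𝔞)
    -- the open subset with its coordinates, and the choices made in `⌈·⌉`
    (U : Set M) (hU : IsOpen U) (hUconn : _root_.IsConnected U) (hUint : U ⊆ surfaceInterior M)
    (ξ : BoundedCoords (Double.proj ⁻¹' U : Set (Double M)))
    (c : ∀ j, LiftChoice (ξ.image j)) :
    ∃ S : StrongDeformationRetract (germComplex 𝔞 ξ) (pushforwardComplex α U),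
      IsInclusion T ξ c S.i ∧ IsProjection T ξ S.p ∧ IsContraction T ξ c S.h ∧
      Limits.IsZero ((pushforwardComplex α U).cx.homology 0) ∧
      ∃ Φ : (pushforwardComplex α U).cx.homology 1 ≅ ModuleCat.of ℂ (GermSpace 𝔞 ξ),
        (pushforwardComplex α U).cx.homologyπ 1 ≫ Φ.hom =
          (pushforwardComplex α U).cx.iCycles 1 ≫ S.p.map.f 1 :=
  mainTheorem5_general α T ξ c
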